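/- **Theorem (Convergence of Quantized Adam).** Let $d=mn$ and let $F(W)=\mathbb E_{\xi}[f(W;\xi)]$, $W\in\mathbb R^{m\times n}$, be bounded below, $F_*=\inf F>-\infty$. Let $\epsilon>0$, $R>\sqrt\epsilon$, and assume: (i) $\mathbb E_\xi[\nabla f(W;\xi)]=\nabla F(W)$ for all $W$; (ii) for every $W$, $\|\nabla f(W;\xi)\|_\infty\le R-\sqrt\epsilon$ almost surely; (iii) $F$ is differentiable and $\|\nabla F(X)-\nabla F(Y)\|_F\le L\|X-Y\|_F$ for all $X,Y$; (iv) $\|W_0\|_F\le D$. Let $Q_W,Q_G,Q_M,Q_V:\mathbb R\to\mathbb R$ be scalar quantizers, applied elementwise, with $|Q_\bullet(x)-x|\le q_\bullet|x|$ for all $x\in\mathbb R$. *Quantized Adam* with parameters $\eta>0$, $\beta_1\in[0,1)$, $\beta_2\in(0,1)$, batch size $B\ge1$ and i.i.d. samples $\xi_{t,i}$ is, for $t=0,\dots,T-1$ (all operations on entries are elementwise), $$G_t=\frac1B\sum_{i=1}^B Q_G\big(\nabla f(Q_W(W_t);\xi_{t,i})\big),\qquad M_t=\beta_1Q_M(M_{t-1})+G_t,\qquad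 V_t=\beta_2Q_V(V_{t-1})+G_t^2,$$ with $M_0=G_0$, $V_0=G_0^2$, and $$W_{t+1}=W_t-\eta_{t+1}\frac{M_t}{\sqrt{V_t+\epsilon}},\qquad \eta_s=(1-\beta_1)\,\Omega_s\,\eta,\qquad \Omega_s=\Big(\sum_{j=0}^{s-1}\beta_2^j\Big)^{1/2}.$$ Let $\tau\in\{0,\dots,T-1\}$ be independent of the samples with $\mathbb P(\tau=j)\propto1-\beta_1^{T-j}$. **1.** Let $T\ge1$, $\beta_1^2(1+q_M)^2<\beta_2(1-q_V)$, $\beta_1(1+q_M)<\beta_2(1-q_V)$ and $2\beta_1/(1-\beta_1)\le T$. Put $r'=\frac{\beta_1^2(1+q_M)^2}{\beta_2(1-q_V)}$. Then $$\begin{aligned}\mathbb E\|\nabla F(W_\tau)\|_F^2\le{}&4(1+q_G)R\,\frac{F(W_0)-F_*}{\eta T}+\frac{\tilde Q(T)}T+\frac{2q_WT(1-\beta_1)d^{3/2}\eta L(1+q_G)R^2}{\sqrt\epsilon\,(1-\beta_2)\sqrt{1-r'}}\\&+\frac{4(1+q_G)d}{\sqrt{\epsilon(1-\beta_2)}}\big(q_GR^3+Lq_WR^2D\big)+\frac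 CT\Big(\ln\Big(1+\frac{((1+q_G)R)^2}{\epsilon(1-\beta_2(1-q_V))}\Big)-T\ln(\beta_2(1-q_V))\Big),\end{aligned}$$ where $$C=\frac{24d((1+q_G)R)^2\sqrt{1-\beta_1}}{(1-\beta_1/\beta_2)^{3/2}\sqrt{1-\beta_2}}+\frac{2d\eta L(1+q_G)R(1-\beta_1)^2}{(1-\beta_1(1+q_M))\big(1-\frac{\beta_1(1+q_M)}{\beta_2(1-q_V)}\big)(1-\beta_2)}+\frac{4d\eta^2L^2\beta_1(1-\beta_1)}{(1-\beta_1(1+q_M))\big(1-\frac{\beta_1(1+q_M)}{\beta_2(1-q_V)}\big)(1-\beta_2)^{3/2}},$$ $$\tilde Q(T)=\frac{4(1+q_G)q_MdR^2(1-\beta_1)T}{\sqrt{1-\beta_2}}\cdot\frac{\sqrt{r'(1+r')}}{(1+q_M)(1-r')^{3/2}}+\frac{4(1+q_G)dR^2(1-\beta_1)}{\sqrt{\big(1-\frac{\beta_1^2}{\beta_2(1-q_V)}\big)(1-\beta_2)}}\Big(T-\frac{1-q_V}{q_V}\big(1-(1-q_V)^T\big)\Big),$$ the last bracket being read as its limit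 $0$ when $q_V=0$. **2.** If $\eta=\Theta(T^{-1/2})$, $1-\beta_2=\Theta(T^{-1})$, $q_G,q_M=O(T^{-1})$ and $q_W,q_V=O(T^{-2})$, then $\mathbb E\|\nabla F(W_\tau)\|_F=\tilde O(T^{-1/4})$. Precisely: for all $m,n,\beta_1,\epsilon,R,L,D,\Delta$ and all $a_1,b_1>0$ and $a_2,b_2,c$, there are $K\in\mathbb R$ and $k,T_0\in\mathbb N$, depending only on these, such that for every $T\ge T_0$ and every run as above with $a_1T^{-1/2}\le\eta\le a_2T^{-1/2}$, $b_1T^{-1}\le1-\beta_2\le b_2T^{-1}$, $q_G,q_M\le cT^{-1}$, $q_W,q_V\le cT^{-2}$ and $F(W_0)-F_*\le\Delta$, $$\mathbb E\|\nabla F(W_\tau)\|_F\le K\,T^{-1/4}(\ln T)^k.$$ -/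

import Mathlib

open MeasureTheory ProbabilityTheory

noncomputable section

namespace QAdam

/-- Real `m × n` matrices with the Frobenius norm (and the entrywise inner product). -/
abbrev Mat (m n : ℕ) : Type := EuclideanSpace ℝ (Fin m × Fin n)

/-! ### The stochastic optimization problem -/

/-- The objective `F(W) = E_x [f(W; x)]`, where the data `x` have law `P`. -/
def objective {m n : ℕ} {Ξ : Type*} [MeasurableSpace Ξ]
    (f : Mat m n → Ξ → ℝ) (P : Measure Ξ) (W : Mat m n) : ℝ :=
  ∫ x, f W x ∂P

/-- The stochastic gradient `∇ f(W; x)` with respect to `W`. -/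
def stochGrad {m n : ℕ} {Ξ : Type*} (f : Mat m n → Ξ → ℝ) (W : Mat m n) (x : Ξ) : Mat m n :=
  gradient (fun W' => f W' x) W

/-- The assumptions on the problem `min_W F(W)`: it is well posed, the stochastic gradient is
unbiased and is bounded by `R - √ε` in every entry almost surely, and `F` is `L`-smooth. -/
structure ProblemAssumptions {m n : ℕ} {Ξ : Type*} [MeasurableSpace Ξ]
    (f : Mat m n → Ξ → ℝ) (P : Measure Ξ) (ε R L : ℝ) : Prop where
  prob : IsProbabilityMeasure P
  integrable_loss : ∀ W, Integrable (f W) P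
  differentiable_loss : ∀ W, ∀ᵐ x ∂P, DifferentiableAt ℝ (fun W' => f W' x) W
  measurable_grad : Measurable (fun p : Mat m n × Ξ => stochGrad f p.1 p.2)
  bddBelow : BddBelow (Set.range (objective f P))
  unbiased : ∀ W, ∫ x, stochGrad f W x ∂P = gradient (objective f P) W
  grad_bound : ∀ W, ∀ᵐ x ∂P, ∀ i, |stochGrad f W x i| ≤ R - √ε
  differentiable : Differentiable ℝ (objective f P)
  smooth : ∀ X Y, ‖gradient (objective f P) X - gradient (objective f P) Y‖ ≤ L * ‖X - Y‖

/-! ### Quantization -/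

/-- A scalar quantization operator with relative error at most `q`. -/
structure IsQuantizer (Q : ℝ → ℝ) (q : ℝ) : Prop where
  measurable : Measurable Q
  rel_error : ∀ x, |Q x - x| ≤ q * |x|

/-- Elementwise application of a scalar quantization operator. -/
def quantize {m n : ℕ} (Q : ℝ → ℝ) (W : Mat m n) : Mat m n :=
  WithLp.toLp 2 (fun i => Q (W i))

/-- The quantization operators for weights, gradients, first and second moments. -/
structure Quantizers where
  QW : ℝ → ℝ
  QG : ℝ → ℝ
  QM : ℝ → ℝ
  QV : ℝ → ℝ

/-! ### The algorithm -/

/-- Hyperparameters of Quantized Adam and the relative errors of the four quantizers. -/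
structure Params where
  η : ℝ
  β₁ : ℝ
  β₂ : ℝ
  ε : ℝ
  qW : ℝ
  qG : ℝ
  qM : ℝ
  qV : ℝ

/-- `Ω_t = √(∑_{j=0}^{t-1} β₂ ^ j)`. -/
def bigOmega (β₂ : ℝ) (t : ℕ) : ℝ := √(∑ j ∈ Finset.range t, β₂ ^ j)

/-- `η_t = (1 - β₁) Ω_t η`, the step size of the `t`-th update, `t = 1, 2, …`. -/
def stepSize (p : Params) (t : ℕ) : ℝ := (1 - p.β₁) * bigOmega p.β₂ t * p.η

/-- The weights `W_t` together with the moments `M_{t-1}`, `V_{t-1}` computed last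
(the moments in the initial state are placeholders that are never used). -/
structure State (m n : ℕ) where
  W : Mat m n
  M : Mat m n
  V : Mat m n

/-- The mean of the `B` quantized stochastic gradients, taken at the quantized weights. -/
def batchGrad {m n B : ℕ} {Ξ : Type*} (f : Mat m n → Ξ → ℝ) (Q : Quantizers)
    (W : Mat m n) (batch : Fin B → Ξ) : Mat m n :=
  (1 / (B : ℝ)) • ∑ i, quantize Q.QG (stochGrad f (quantize Q.QW W) (batch i))

/-- Quantized Adam run from `W₀` on the batches `s 0, s 1, …`: the state after `t` updates. -/
def run {m n B : ℕ} {Ξ : Type*} (f : Mat m n → Ξ → ℝ) (Q : Quantizers) (p : Params)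
    (W₀ : Mat m n) (s : ℕ → Fin B → Ξ) : ℕ → State m n
  | 0 => ⟨W₀, 0, 0⟩
  | t + 1 =>
    let S := run f Q p W₀ s t
    let G := batchGrad f Q S.W (s t)
    let G2 : Mat m n := WithLp.toLp 2 (fun i => G i ^ 2)
    let M := if t = 0 then G else p.β₁ • quantize Q.QM S.M + G
    let V := if t = 0 then G2 else p.β₂ • quantize Q.QV S.V + G2
    ⟨S.W - stepSize p (t + 1) • WithLp.toLp 2 (fun i => M i / √(V i + p.ε)), M, V⟩

/-- All the standing assumptions on a run of `T` iterations of Quantized Adam with batch size `B`: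
`ξ t i` is the `i`-th sample of the `t`-th batch, `τ` is the random output index. -/
structure Setting {m n B : ℕ} {Ξ Ω : Type*} [MeasurableSpace Ξ] [MeasurableSpace Ω]
    (p : Params) (R L D : ℝ) (T : ℕ) (f : Mat m n → Ξ → ℝ) (P : Measure Ξ) (W₀ : Mat m n)
    (Q : Quantizers) (μ : Measure Ω) (ξ : ℕ → Fin B → Ω → Ξ) (τ : Ω → ℕ) : Prop where
  T_pos : 0 < T
  B_pos : 0 < B
  η_pos : 0 < p.η
  β₁_mem : p.β₁ ∈ Set.Ico (0 : ℝ) 1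
  β₂_mem : p.β₂ ∈ Set.Ioo (0 : ℝ) 1
  ε_pos : 0 < p.ε
  R_gt : √p.ε < R
  problem : ProblemAssumptions f P p.ε R L
  init : ‖W₀‖ ≤ D
  quantW : IsQuantizer Q.QW p.qW
  quantG : IsQuantizer Q.QG p.qG
  quantM : IsQuantizer Q.QM p.qM
  quantV : IsQuantizer Q.QV p.qV
  prob : IsProbabilityMeasure μ
  sample_measurable : ∀ t i, Measurable (ξ t i)
  sample_law : ∀ t i, μ.map (ξ t i) = P
  sample_indep : iIndepFun (fun k : ℕ × Fin B => ξ k.1 k.2) μ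
  index_measurable : Measurable τ
  index_law : ∀ j < T, μ.real {ω | τ ω = j} =
    (1 - p.β₁ ^ (T - j)) / ∑ i ∈ Finset.range T, (1 - p.β₁ ^ (T - i))
  index_indep : IndepFun τ (fun ω t i => ξ t i ω) μ

/-- `‖∇ F(W_τ)‖_F`, as a random variable. -/
def gradNorm {m n B : ℕ} {Ξ Ω : Type*} [MeasurableSpace Ξ]
    (p : Params) (f : Mat m n → Ξ → ℝ) (P : Measure Ξ) (W₀ : Mat m n) (Q : Quantizers)
    (ξ : ℕ → Fin B → Ω → Ξ) (τ : Ω → ℕ) (ω : Ω) : ℝ :=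
  ‖gradient (objective f P) (run f Q p W₀ (fun t i => ξ t i ω) (τ ω)).W‖

/-! ### The terms of the bound, in dimension `d` -/

/-- `r' = β₁² (1 + q_M)² / (β₂ (1 - q_V))`. -/
def ratio (p : Params) : ℝ := p.β₁ ^ 2 * (1 + p.qM) ^ 2 / (p.β₂ * (1 - p.qV))

/-- The coefficient `C` of the logarithmic term. -/
def constC (p : Params) (R L d : ℝ) : ℝ :=
  24 * d * ((1 + p.qG) * R) ^ 2 * √(1 - p.β₁) /
      ((1 - p.β₁ / p.β₂) ^ (3 / 2 : ℝ) * √(1 - p.β₂))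
    + 2 * d * p.η * L * (1 + p.qG) * R * (1 - p.β₁) ^ 2 /
      ((1 - p.β₁ * (1 + p.qM)) * (1 - p.β₁ * (1 + p.qM) / (p.β₂ * (1 - p.qV))) * (1 - p.β₂))
    + 4 * d * p.η ^ 2 * L ^ 2 * p.β₁ * (1 - p.β₁) /
      ((1 - p.β₁ * (1 + p.qM)) * (1 - p.β₁ * (1 + p.qM) / (p.β₂ * (1 - p.qV))) *
        (1 - p.β₂) ^ (3 / 2 : ℝ))

/-- The geometric sum `∑_{t=1}^T (1 - q) ^ t`. -/
def geomSum (q : ℝ) (T : ℕ) : ℝ := ∑ t ∈ Finset.Icc 1 T, (1 - q) ^ t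

/-- The closed form of the geometric sum; at `q = 0` its value is the limit `T`. -/
theorem geomSum_eq (q : ℝ) (hq : q ≠ 0) (T : ℕ) :
    geomSum q T = (1 - q) / q * (1 - (1 - q) ^ T) := by
  unfold geomSum
  induction T with
  | zero => simp
  | succ k ih =>
    rw [Finset.sum_Icc_succ_top (by omega), ih]
    field_simp
    ring

theorem geomSum_zero (T : ℕ) : geomSum 0 T = T := by simp [geomSum]

/-- The function `Q̃(T)`, collecting the errors of the two quantized moments. -/
def Qtilde (p : Params) (R d : ℝ) (T : ℕ) : ℝ :=
  4 * (1 + p.qG) * p.qM * d * R ^ 2 * (1 - p.β₁) * T / √(1 - p.β₂) *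
      (√(ratio p * (1 + ratio p)) / ((1 + p.qM) * (1 - ratio p) ^ (3 / 2 : ℝ)))
    + 4 * (1 + p.qG) * d * R ^ 2 * (1 - p.β₁) * T /
      √((1 - p.β₁ ^ 2 / (p.β₂ * (1 - p.qV))) * (1 - p.β₂))
    - 4 * (1 + p.qG) * d * R ^ 2 * (1 - p.β₁) /
      √((1 - p.β₁ ^ 2 / (p.β₂ * (1 - p.qV))) * (1 - p.β₂)) * geomSum p.qV T

/-- The full bound; `gap` stands for `F(W_0) - F_*`. -/
def bound (p : Params) (R L D d gap : ℝ) (T : ℕ) : ℝ :=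
  4 * (1 + p.qG) * R * (gap / (p.η * T))
    + Qtilde p R d T / T
    + 2 * p.qW * T * (1 - p.β₁) * d ^ (3 / 2 : ℝ) * p.η * L * (1 + p.qG) * R ^ 2 /
      (√p.ε * (1 - p.β₂) * √(1 - ratio p))
    + 4 * (1 + p.qG) * d / √(p.ε * (1 - p.β₂)) * (p.qG * R ^ 3 + L * p.qW * R ^ 2 * D)
    + constC p R L d / T *
      (Real.log (1 + ((1 + p.qG) * R) ^ 2 / (p.ε * (1 - p.β₂ * (1 - p.qV))))
        - T * Real.log (p.β₂ * (1 - p.qV)))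

/-- The schedule `η = Θ(1/√T)`, `1 - β₂ = Θ(1/T)`, `q_G, q_M = O(1/T)`, `q_W, q_V = O(1/T²)`,
with explicit constants. -/
structure Schedule (p : Params) (a₁ a₂ b₁ b₂ c : ℝ) (T : ℕ) : Prop where
  η_lower : a₁ / √(T : ℝ) ≤ p.η
  η_upper : p.η ≤ a₂ / √(T : ℝ)
  β₂_lower : b₁ / (T : ℝ) ≤ 1 - p.β₂
  β₂_upper : 1 - p.β₂ ≤ b₂ / (T : ℝ)
  qG_le : p.qG ≤ c / (T : ℝ)
  qM_le : p.qM ≤ c / (T : ℝ)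
  qV_le : p.qV ≤ c / (T : ℝ) ^ 2
  qW_le : p.qW ≤ c / (T : ℝ) ^ 2

end QAdam

end

noncomputable section

namespace QAdam

/-! ### Exponentially weighted sums -/

/-! The descent lemma gives `F(W_{t+1})` in terms of `⟨∇F(W_t), W_{t+1} - W_t⟩`, so the task is to
show that the update direction correlates with the gradient `D_t = ∇F(W_t)`. Two obstacles arise:
the moments are quantized, and the denominator and the momentum depend on the same random gradients
as the numerator.

Quantization is handled one coordinate at a time and deterministically. Unrolling the recursions
compares `M`, `V` with the exact exponentially weighted sums `m`, `v` of `g` and `g^2`: `M` is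
dominated by the sum of rate `β₁(1+q_M)`, and `V` is at least the sum of rate `β₂(1-q_V)`.
Cauchy–Schwarz then bounds the change of the direction uniformly in `g`
(`IsMoments.abs_update_sub_le`).

For the exact direction (`momentum_descent`), `m_t` is expanded into terms `β₁^k g_s`, `s = t-k`. In
each term `D_t` is exchanged for `D_s`, at a cost controlled by smoothness and the squared steps,
and `ε + v_t` for `majorant`, in which `g_s^2, …, g_t^2` are replaced by their almost sure bound.
The cost of this exchange is a fraction of `D_s^2/√w` plus a lag-dependent multiple of
`g_s^2/(ε+v_s)`. Sums of such normalized squares telescope to a logarithm (`sum_div_expSum_le`).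
Summing over `t` gives a pathwise inequality (`IsTrajectory.sum_mainTerm_le`).

In expectation, `D_s/√w` depends only on batches before `s`, so `g_s` may be replaced by its mean,
which is `D_s` up to a bias from `Q_G` and `Q_W` (`Setting.le_integral_mul_runGrad`). What remains
is a multiple of `E‖D_s‖^2 / Ω_{t+1}`, and the factor `Ω_{t+1}` of the step size cancels the
denominator. The momentum weights add up to `1 - β₁^(T-j)`, which is exactly the law of `τ` up to
normalization (`one_sub_mul_sum_expSum`); the normalizer is at least `T/2`.

For the rate, every contraction factor stays at distance at least `(1-β₁)/2` from `1` once `T` is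
large (`Setting.regime`). Each term of the bound is then `O(T^(-1/2))`, the logarithmic one with a
factor `log T`, and the second moment controls the mean. -/

/-- The exponentially weighted sum `∑_{k ≤ t} a ^ k * x (t - k)`. -/
def expSum (a : ℝ) (x : ℕ → ℝ) : ℕ → ℝ
  | 0 => x 0
  | t + 1 => a * expSum a x t + x (t + 1)

theorem expSum_eq_sum (a : ℝ) (x : ℕ → ℝ) (t : ℕ) :
    expSum a x t = ∑ k ∈ Finset.range (t + 1), a ^ k * x (t - k) := by
  induction t with
  | zero => simp [expSum]
  | succ t ih =>
    rw [Finset.sum_range_succ', expSum, ih, Finset.mul_sum]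
    simp only [pow_zero, one_mul, Nat.sub_zero, add_left_inj]
    refine Finset.sum_congr rfl fun k _ => ?_
    rw [Nat.add_sub_add_right]
    ring

theorem expSum_nonneg {a : ℝ} (ha : 0 ≤ a) {x : ℕ → ℝ} (hx : ∀ t, 0 ≤ x t) (t : ℕ) :
    0 ≤ expSum a x t := by
  induction t with
  | zero => exact hx 0
  | succ t ih => exact add_nonneg (mul_nonneg ha ih) (hx _)

theorem expSum_mono {a b : ℝ} (ha : 0 ≤ a) (hab : a ≤ b) {x : ℕ → ℝ} (hx : ∀ t, 0 ≤ x t)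
    (t : ℕ) : expSum a x t ≤ expSum b x t := by
  induction t with
  | zero => exact le_rfl
  | succ t ih =>
    have := expSum_nonneg ha hx t
    have hb := ha.trans hab
    simp only [expSum]
    gcongr

theorem sum_expSum (a : ℝ) (x : ℕ → ℝ) (T : ℕ) :
    (1 - a) * ∑ t ∈ Finset.range (T + 1), expSum a x t + a * expSum a x T =
      ∑ t ∈ Finset.range (T + 1), x t := by
  induction T with
  | zero => simp [expSum]; ring
  | succ T ih =>
    rw [Finset.sum_range_succ, Finset.sum_range_succ _ (T + 1), ← ih]
    simp only [expSum]
    ring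

theorem sum_expSum_le {a : ℝ} (ha : 0 ≤ a) (ha1 : a < 1) {x : ℕ → ℝ} (hx : ∀ t, 0 ≤ x t) (T : ℕ) :
    ∑ t ∈ Finset.range T, expSum a x t ≤ 1 / (1 - a) * ∑ t ∈ Finset.range T, x t := by
  cases T with
  | zero => simp
  | succ T =>
    have h := sum_expSum a x T
    have h2 := mul_nonneg ha (expSum_nonneg ha hx T)
    rw [one_div, ← div_eq_inv_mul, le_div_iff₀ (by linarith)]
    linarith

theorem expSum_le_of_le {a : ℝ} (ha : 0 ≤ a) (ha1 : a < 1) {x : ℕ → ℝ} {X : ℝ} (hX : 0 ≤ X)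
    (hx : ∀ t, x t ≤ X) (t : ℕ) : expSum a x t ≤ X / (1 - a) := by
  have h1 : 0 < 1 - a := by linarith
  have key : a * (X / (1 - a)) + X = X / (1 - a) := by field_simp; ring
  induction t with
  | zero =>
    refine (hx 0).trans ?_
    rw [le_div_iff₀ h1]
    nlinarith
  | succ t ih =>
    simp only [expSum]
    rw [← key]
    have := hx (t + 1)
    gcongr

theorem expSum_le_mul_sum {a : ℝ} (ha : 0 ≤ a) {x : ℕ → ℝ} {X : ℝ}
    (hx : ∀ t, x t ≤ X) (t : ℕ) : expSum a x t ≤ X * ∑ j ∈ Finset.range (t + 1), a ^ j := by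
  rw [expSum_eq_sum, Finset.mul_sum]
  refine Finset.sum_le_sum fun k _ => ?_
  rw [mul_comm X]
  exact mul_le_mul_of_nonneg_left (hx _) (by positivity)

/-- Cauchy–Schwarz for exponentially weighted sums. -/
theorem sq_expSum_le {a b : ℝ} (hab : a ^ 2 < b) (x : ℕ → ℝ) (t : ℕ) :
    expSum a x t ^ 2 ≤ 1 / (1 - a ^ 2 / b) * expSum b (fun j => x j ^ 2) t := by
  have hb : 0 < b := (sq_nonneg a).trans_lt hab
  have h1 : 0 < b - a ^ 2 := by linarith
  have hK : 1 / (1 - a ^ 2 / b) = b / (b - a ^ 2) := by field_simp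
  have hK1 : 1 ≤ b / (b - a ^ 2) := by rw [le_div_iff₀ h1]; nlinarith [sq_nonneg a]
  rw [hK]
  induction t with
  | zero =>
    simp only [expSum]
    nlinarith [sq_nonneg (x 0)]
  | succ t ih =>
    simp only [expSum]
    set S := expSum a x t
    set y := x (t + 1)
    -- Young's inequality with weights chosen so that the defect is a perfect square and the
    -- constant `b / (b - a ^ 2)` reproduces itself in the induction.
    have key : (a * S + y) ^ 2 ≤ b * S ^ 2 + b / (b - a ^ 2) * y ^ 2 := by
      have : b * S ^ 2 + b / (b - a ^ 2) * y ^ 2 - (a * S + y) ^ 2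
          = ((b - a ^ 2) * S - a * y) ^ 2 / (b - a ^ 2) := by field_simp; ring
      have h3 : 0 ≤ ((b - a ^ 2) * S - a * y) ^ 2 / (b - a ^ 2) := by positivity
      linarith
    have := mul_le_mul_of_nonneg_left ih hb.le
    calc _ ≤ _ := key
      _ ≤ b * (b / (b - a ^ 2) * expSum b (fun j => x j ^ 2) t) + b / (b - a ^ 2) * y ^ 2 := by
          gcongr
      _ = _ := by ring

/-- Jensen's inequality for exponentially weighted sums. -/
theorem sq_expSum_le_self {a : ℝ} (ha : 0 ≤ a) (ha1 : a < 1) (x : ℕ → ℝ) (t : ℕ) :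
    expSum a x t ^ 2 ≤ 1 / (1 - a) * expSum a (fun j => x j ^ 2) t := by
  -- The choice `b = a` in Cauchy–Schwarz needs `a ^ 2 < a`, which fails at `a = 0`.
  rcases ha.eq_or_lt with rfl | h
  · cases t <;> simp [expSum]
  · have := sq_expSum_le (a := a) (b := a) (by nlinarith) x t
    rwa [sq a, mul_div_assoc, div_self h.ne', mul_one] at this

/-! ### Geometric sums -/

/-- The partial sum equals the full series minus an explicit nonnegative tail. This exact form,
unlike the inequality, goes through by induction; `sum_sq_mul_geom_le` works the same way. -/
theorem sum_succ_mul_geom_le {r : ℝ} (h0 : 0 ≤ r) (h1 : r < 1) (n : ℕ) :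
    ∑ k ∈ Finset.range n, ((k : ℝ) + 1) * r ^ k ≤ 1 / (1 - r) ^ 2 := by
  have hr : 0 < 1 - r := by linarith
  have key : ∑ k ∈ Finset.range n, ((k : ℝ) + 1) * r ^ k
      = 1 / (1 - r) ^ 2 - r ^ n * (n / (1 - r) + 1 / (1 - r) ^ 2) := by
    induction n with
    | zero => simp
    | succ n ih =>
      rw [Finset.sum_range_succ, ih]
      push_cast
      field_simp
      ring
  rw [key]
  have : 0 ≤ r ^ n * (n / (1 - r) + 1 / (1 - r) ^ 2) := by positivity
  linarith

theorem sum_sq_mul_geom_le {r : ℝ} (h0 : 0 ≤ r) (h1 : r < 1) (n : ℕ) :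
    ∑ k ∈ Finset.range n, (k : ℝ) ^ 2 * r ^ k ≤ r * (1 + r) / (1 - r) ^ 3 := by
  have hr : 0 < 1 - r := by linarith
  have key : ∑ k ∈ Finset.range n, (k : ℝ) ^ 2 * r ^ k
      = r * (1 + r) / (1 - r) ^ 3 -
        r ^ n * (n ^ 2 / (1 - r) + 2 * n * r / (1 - r) ^ 2 + r * (1 + r) / (1 - r) ^ 3) := by
    induction n with
    | zero => simp
    | succ n ih =>
      rw [Finset.sum_range_succ, ih]
      push_cast
      field_simp
      ring
  rw [key]
  have : 0 ≤ r ^ n * (n ^ 2 / (1 - r) + 2 * n * r / (1 - r) ^ 2 + r * (1 + r) / (1 - r) ^ 3) := by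
    positivity
  linarith

theorem sum_geom_le {r : ℝ} (h0 : 0 ≤ r) (h1 : r < 1) (n : ℕ) :
    ∑ k ∈ Finset.range n, r ^ k ≤ 1 / (1 - r) := by
  rw [geom_sum_eq h1.ne, ← neg_div_neg_eq]
  have : 0 < 1 - r := by linarith
  rw [show -(r - 1) = 1 - r by ring]
  gcongr
  have := pow_nonneg h0 n
  linarith

/-- The gap between two exponentially weighted sums whose rates are `a` and `a * (1 + q)`. -/
theorem sq_expSum_sub_le {a q b : ℝ} (ha : 0 ≤ a) (hq : 0 ≤ q) (hab : (a * (1 + q)) ^ 2 < b)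
    {x : ℕ → ℝ} (hx : ∀ t, 0 ≤ x t) (t : ℕ) :
    (expSum (a * (1 + q)) x t - expSum a x t) ^ 2 ≤
      (q / (1 + q)) ^ 2 * ((a * (1 + q)) ^ 2 / b * (1 + (a * (1 + q)) ^ 2 / b) /
        (1 - (a * (1 + q)) ^ 2 / b) ^ 3) * expSum b (fun j => x j ^ 2) t := by
  set p := a * (1 + q) with hp
  have hp0 : 0 ≤ p := by positivity
  have hb : 0 < b := (sq_nonneg p).trans_lt hab
  set r := p ^ 2 / b with hr
  have hr0 : 0 ≤ r := by positivity
  have hr1 : r < 1 := by rw [hr, div_lt_one hb]; exact hab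
  -- The factor `p ^ k` is split as `√r ^ k * √b ^ k`, so that Cauchy–Schwarz separates `∑ k ^ 2 r ^
  -- k` from the sum of rate `b`.
  have hstep : expSum p x t - expSum a x t ≤
      q / (1 + q) * ∑ k ∈ Finset.range (t + 1), (k * √r ^ k) * (√b ^ k * x (t - k)) := by
    rw [expSum_eq_sum, expSum_eq_sum, ← Finset.sum_sub_distrib, Finset.mul_sum]
    refine Finset.sum_le_sum fun k _ => ?_
    have hpk : √r ^ k * √b ^ k = p ^ k := by
      rw [← mul_pow, ← Real.sqrt_mul hr0, hr, div_mul_cancel₀ _ hb.ne', Real.sqrt_sq hp0]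
    have hak : a ^ k = p ^ k * (1 - q / (1 + q)) ^ k := by
      rw [← mul_pow]; congr 1; rw [hp]; field_simp; ring
    -- Since `a = p (1 - q / (1 + q))`, Bernoulli's inequality makes the difference of the `k`-th
    -- powers linear in `k`.
    have hbern := one_add_mul_le_pow (a := -(q / (1 + q)))
      (by have : q / (1 + q) ≤ 1 := by rw [div_le_one (by linarith)]; linarith
          linarith) k
    have : p ^ k - a ^ k ≤ q / (1 + q) * (k * p ^ k) := by
      rw [hak]
      have hpk0 : 0 ≤ p ^ k := by positivity
      rw [← sub_eq_add_neg] at hbern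
      nlinarith
    calc p ^ k * x (t - k) - a ^ k * x (t - k) = (p ^ k - a ^ k) * x (t - k) := by ring
      _ ≤ (q / (1 + q) * (k * p ^ k)) * x (t - k) := mul_le_mul_of_nonneg_right this (hx _)
      _ = _ := by rw [← hpk]; ring
  have h0 : 0 ≤ expSum p x t - expSum a x t :=
    sub_nonneg.2 (expSum_mono ha (by nlinarith) hx t)
  have hsq : ∀ y : ℝ, 0 ≤ y → ∀ k : ℕ, (√y ^ k) ^ 2 = y ^ k := fun y hy k => by
    rw [← pow_mul, mul_comm, pow_mul, Real.sq_sqrt hy]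
  calc (expSum p x t - expSum a x t) ^ 2 ≤ (q / (1 + q) *
        ∑ k ∈ Finset.range (t + 1), (k * √r ^ k) * (√b ^ k * x (t - k))) ^ 2 := by gcongr
    _ ≤ (q / (1 + q)) ^ 2 * ((∑ k ∈ Finset.range (t + 1), (k * √r ^ k) ^ 2) *
        ∑ k ∈ Finset.range (t + 1), (√b ^ k * x (t - k)) ^ 2) := by
        rw [mul_pow]
        gcongr
        exact Finset.sum_mul_sq_le_sq_mul_sq _ _ _
    _ = (q / (1 + q)) ^ 2 * ((∑ k ∈ Finset.range (t + 1), (k : ℝ) ^ 2 * r ^ k) *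
        expSum b (fun j => x j ^ 2) t) := by
        rw [expSum_eq_sum]
        simp only [mul_pow, hsq r hr0, hsq b hb.le]
    _ ≤ (q / (1 + q)) ^ 2 * (r * (1 + r) / (1 - r) ^ 3 * expSum b (fun j => x j ^ 2) t) := by
        have := expSum_nonneg hb.le (fun j => sq_nonneg (x j)) t
        gcongr
        exact sum_sq_mul_geom_le hr0 hr1 _
    _ = _ := by ring

/-! ### Logarithmic bounds -/

/-- With `z = x t` and `y` the rest of the denominator, `z / (y + z) ≤ log (y + z) - log y`. This
would telescope if `y` were the previous denominator; as the old sum is discounted by `b`, each step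
costs an extra `-log b`. -/
theorem sum_div_expSum_le_log {b ε : ℝ} (hb : 0 < b) (hb1 : b ≤ 1) (hε : 0 < ε) {x : ℕ → ℝ}
    (hx : ∀ t, 0 ≤ x t) (T : ℕ) :
    ∑ t ∈ Finset.range (T + 1), x t / (ε + expSum b x t) ≤
      Real.log (1 + expSum b x T / ε) - T * Real.log b := by
  have key : ∀ y z : ℝ, 0 < y → 0 ≤ z → z / (y + z) ≤ Real.log (y + z) - Real.log y := by
    intro y z hy hz
    rw [← Real.log_div (by positivity) hy.ne']
    have := Real.one_sub_inv_le_log_of_pos (show 0 < (y + z) / y by positivity)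
    refine le_trans (le_of_eq ?_) this
    field_simp
    ring
  have h1 : ∀ t, Real.log (1 + expSum b x t / ε) = Real.log (ε + expSum b x t) - Real.log ε := by
    intro t
    have := expSum_nonneg hb.le hx t
    rw [← Real.log_div (by positivity) hε.ne']
    congr 1
    field_simp
  rw [h1]
  induction T with
  | zero => simpa [expSum] using key ε (x 0) hε (hx 0)
  | succ T ih =>
    rw [Finset.sum_range_succ]
    have hS := expSum_nonneg hb.le hx T
    have h2 := key (ε + b * expSum b x T) (x (T + 1)) (by positivity) (hx _)
    have h3 : Real.log b + Real.log (ε + expSum b x T) ≤ Real.log (ε + b * expSum b x T) := by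
      rw [← Real.log_mul hb.ne' (by positivity)]
      exact Real.log_le_log (by positivity) (by nlinarith)
    simp only [expSum] at h2 ⊢
    rw [← add_assoc]
    push_cast
    linarith

/-- Upper bound on `∑ x_t / (ε + ∑_k b ^ k x_{t-k})` for a bounded nonnegative sequence `x`. -/
def logTerm (b ε X : ℝ) (T : ℕ) : ℝ := Real.log (1 + X / (ε * (1 - b))) - T * Real.log b

theorem sum_div_expSum_le {b ε X : ℝ} (hb : 0 < b) (hb1 : b < 1) (hε : 0 < ε) {x : ℕ → ℝ}
    (hx : ∀ t, 0 ≤ x t) (hX : ∀ t, x t ≤ X) (T : ℕ) :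
    ∑ t ∈ Finset.range T, x t / (ε + expSum b x t) ≤ logTerm b ε X T := by
  have hX0 : 0 ≤ X := (hx 0).trans (hX 0)
  have h1 : 0 < 1 - b := by linarith
  have hlog : Real.log b ≤ 0 := Real.log_nonpos hb.le hb1.le
  unfold logTerm
  cases T with
  | zero =>
    simp only [Finset.range_zero, Finset.sum_empty, Nat.cast_zero, zero_mul, sub_zero]
    exact Real.log_nonneg (le_add_of_nonneg_right (by positivity))
  | succ T =>
    refine (sum_div_expSum_le_log hb hb1.le hε hx T).trans ?_
    have h2 := expSum_le_of_le hb.le hb1 hX0 hX T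
    have h3 : Real.log (1 + expSum b x T / ε) ≤ Real.log (1 + X / (ε * (1 - b))) := by
      have h4 := expSum_nonneg hb.le hx T
      apply Real.log_le_log (by positivity)
      rw [mul_comm ε, ← div_div]
      gcongr
    push_cast
    linarith

theorem logTerm_nonneg {b ε X : ℝ} (hb : 0 < b) (hb1 : b < 1) (hε : 0 < ε) (hX : 0 ≤ X) (T : ℕ) :
    0 ≤ logTerm b ε X T := by
  simpa using sum_div_expSum_le hb hb1 hε (x := fun _ => 0) (fun _ => le_rfl) (fun _ => hX) T

/-- Denominators cannot shrink faster than by the factor `b` per step, so `x (t - k)` normalized at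
time `t` is at most `b ^ (-k)` times its value normalized at time `t - k`; this turns the rate `a`
into `a / b`. -/
theorem expSum_le_mul_expSum_div {a b ε : ℝ} (ha : 0 ≤ a) (hb : 0 < b) (hb1 : b ≤ 1) (hε : 0 < ε)
    {x : ℕ → ℝ} (hx : ∀ t, 0 ≤ x t) (t : ℕ) :
    expSum a x t ≤ (ε + expSum b x t) * expSum (a / b) (fun j => x j / (ε + expSum b x j)) t := by
  have hpos : ∀ j, 0 < ε + expSum b x j := fun j => by
    have := expSum_nonneg hb.le hx j; positivity
  have hy : ∀ j, 0 ≤ x j / (ε + expSum b x j) := fun j => div_nonneg (hx j) (hpos j).le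
  induction t with
  | zero =>
    have := (hpos 0).ne'
    simp only [expSum] at this ⊢
    rw [mul_div_cancel₀ _ this]
  | succ t ih =>
    have hE := expSum_nonneg (div_nonneg ha hb.le) hy t
    have hle : b * (ε + expSum b x t) ≤ ε + expSum b x (t + 1) := by
      have := hx (t + 1)
      simp only [expSum]
      nlinarith
    calc expSum a x (t + 1) = a * expSum a x t + x (t + 1) := rfl
      _ ≤ a * ((ε + expSum b x t) * expSum (a / b) (fun j => x j / (ε + expSum b x j)) t) +
          x (t + 1) := by gcongr
      _ = (b * (ε + expSum b x t)) *
          (a / b * expSum (a / b) (fun j => x j / (ε + expSum b x j)) t) +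
          (ε + expSum b x (t + 1)) * (x (t + 1) / (ε + expSum b x (t + 1))) := by
          rw [mul_div_cancel₀ _ (hpos _).ne']; field_simp
      _ ≤ (ε + expSum b x (t + 1)) *
          (a / b * expSum (a / b) (fun j => x j / (ε + expSum b x j)) t) +
          (ε + expSum b x (t + 1)) * (x (t + 1) / (ε + expSum b x (t + 1))) := by gcongr
      _ = _ := by rw [← mul_add]; rfl

/-- The two factors have different origins: `1 / (1 - a)` comes from Jensen and `1 / (1 - a / b)`
from summing the lags after the change of rate. -/
theorem sum_sq_expSum_div_le {a b ε X : ℝ} (ha : 0 ≤ a) (hab : a < b) (hb1 : b < 1) (hε : 0 < ε)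
    (x : ℕ → ℝ) (hX : ∀ t, x t ^ 2 ≤ X) (T : ℕ) :
    ∑ t ∈ Finset.range T, expSum a x t ^ 2 / (ε + expSum b (fun j => x j ^ 2) t) ≤
      1 / ((1 - a) * (1 - a / b)) * logTerm b ε X T := by
  have hb : 0 < b := ha.trans_lt hab
  have hx2 : ∀ t, 0 ≤ (fun j => x j ^ 2) t := fun t => sq_nonneg _
  have hab1 : a / b < 1 := (div_lt_one hb).2 hab
  have hpos : ∀ j, 0 < ε + expSum b (fun j => x j ^ 2) j := fun j => by
    have := expSum_nonneg hb.le hx2 j; positivity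
  have h1a : 0 < 1 - a := by linarith
  have h1ab : 0 < 1 - a / b := by linarith
  set y : ℕ → ℝ := fun j => x j ^ 2 / (ε + expSum b (fun j => x j ^ 2) j) with hy
  have hy0 : ∀ j, 0 ≤ y j := fun j => div_nonneg (hx2 j) (hpos j).le
  calc _ ≤ ∑ t ∈ Finset.range T, 1 / (1 - a) * expSum (a / b) y t := by
        refine Finset.sum_le_sum fun t _ => ?_
        rw [div_le_iff₀ (hpos t)]
        refine (sq_expSum_le_self ha (by linarith) x t).trans ?_
        rw [mul_assoc, mul_comm (expSum (a / b) y t)]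
        gcongr
        exact expSum_le_mul_expSum_div ha hb hb1.le hε hx2 t
    _ = 1 / (1 - a) * ∑ t ∈ Finset.range T, expSum (a / b) y t := by rw [Finset.mul_sum]
    _ ≤ 1 / (1 - a) * (1 / (1 - a / b) * logTerm b ε X T) := by
        gcongr
        refine (sum_expSum_le (by positivity) hab1 hy0 T).trans ?_
        gcongr
        exact sum_div_expSum_le hb hb1 hε hx2 hX T
    _ = _ := by field_simp

/-! ### Quantized moments of a single coordinate -/

theorem IsQuantizer.nonneg {Q : ℝ → ℝ} {q : ℝ} (h : IsQuantizer Q q) : 0 ≤ q := by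
  have := (abs_nonneg _).trans (h.rel_error 1)
  simpa using this

theorem IsQuantizer.abs_le {Q : ℝ → ℝ} {q : ℝ} (h : IsQuantizer Q q) (x : ℝ) :
    |Q x| ≤ (1 + q) * |x| := by
  have h1 := h.rel_error x
  have h2 := abs_add_le (Q x - x) x
  rw [sub_add_cancel] at h2
  linarith

theorem IsQuantizer.le_of_nonneg {Q : ℝ → ℝ} {q : ℝ} (h : IsQuantizer Q q) {x : ℝ} (hx : 0 ≤ x) :
    (1 - q) * x ≤ Q x ∧ Q x ≤ (1 + q) * x := by
  have h1 := _root_.abs_le.1 (h.rel_error x)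
  rw [abs_of_nonneg hx] at h1
  constructor <;> linarith

/-- The recursion of the quantized moments `M`, `V` of a sequence `g` of gradient entries. -/
structure IsMoments (β₁ β₂ : ℝ) (QM QV : ℝ → ℝ) (g M V : ℕ → ℝ) : Prop where
  M_zero : M 0 = g 0
  M_succ : ∀ t, M (t + 1) = β₁ * QM (M t) + g (t + 1)
  V_zero : V 0 = g 0 ^ 2
  V_succ : ∀ t, V (t + 1) = β₂ * QV (V t) + g (t + 1) ^ 2

namespace IsMoments

variable {β₁ β₂ qM qV : ℝ} {QM QV : ℝ → ℝ} {g M V : ℕ → ℝ}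

theorem abs_M_le (h : IsMoments β₁ β₂ QM QV g M V) (hQM : IsQuantizer QM qM) (hβ₁ : 0 ≤ β₁)
    (t : ℕ) : |M t| ≤ expSum (β₁ * (1 + qM)) (fun j => |g j|) t := by
  induction t with
  | zero => rw [h.M_zero]; exact le_rfl
  | succ t ih =>
    have := hQM.nonneg
    rw [h.M_succ]
    refine (abs_add_le _ _).trans ?_
    rw [abs_mul, abs_of_nonneg hβ₁]
    simp only [expSum]
    rw [mul_assoc]
    have h2 := hQM.abs_le (M t)
    gcongr
    exact h2.trans (by gcongr)

/-- The new error `β₁ (q_M |M| + |M - m|)` is bounded by inserting `abs_M_le`; the two sums on the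
right satisfy exactly the resulting recursion, so nothing further is lost. -/
theorem abs_M_sub_le (h : IsMoments β₁ β₂ QM QV g M V) (hQM : IsQuantizer QM qM) (hβ₁ : 0 ≤ β₁)
    (t : ℕ) : |M t - expSum β₁ g t| ≤
      expSum (β₁ * (1 + qM)) (fun j => |g j|) t - expSum β₁ (fun j => |g j|) t := by
  induction t with
  | zero => simp [h.M_zero, expSum]
  | succ t ih =>
    have hq := hQM.nonneg
    have h1 := hQM.rel_error (M t)
    have h2 := h.abs_M_le hQM hβ₁ t
    have h3 : |QM (M t) - expSum β₁ g t| ≤ qM * |M t| + |M t - expSum β₁ g t| := by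
      refine le_trans (le_of_eq ?_) ((abs_add_le (QM (M t) - M t) (M t - expSum β₁ g t)).trans ?_)
      · congr 1; ring
      · linarith
    rw [h.M_succ]
    simp only [expSum]
    rw [show β₁ * QM (M t) + g (t + 1) - (β₁ * expSum β₁ g t + g (t + 1)) =
      β₁ * (QM (M t) - expSum β₁ g t) by ring, abs_mul, abs_of_nonneg hβ₁]
    have h4 := mul_le_mul_of_nonneg_left h2 hq
    have h5 := mul_le_mul_of_nonneg_left (h3.trans (add_le_add h4 ih)) hβ₁
    refine h5.trans (le_of_eq ?_)
    ring

theorem expSum_le_V (h : IsMoments β₁ β₂ QM QV g M V) (hQV : IsQuantizer QV qV) (hβ₂ : 0 ≤ β₂)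
    (hq : qV ≤ 1) (t : ℕ) : expSum (β₂ * (1 - qV)) (fun j => g j ^ 2) t ≤ V t := by
  have hb : 0 ≤ β₂ * (1 - qV) := mul_nonneg hβ₂ (by linarith)
  induction t with
  | zero => rw [h.V_zero]; exact le_rfl
  | succ t ih =>
    have h0 := expSum_nonneg hb (fun j => sq_nonneg (g j)) t
    rw [h.V_succ]
    simp only [expSum]
    rw [mul_assoc]
    have h2 := (hQV.le_of_nonneg (h0.trans ih)).1
    gcongr
    refine le_trans ?_ h2
    have : 0 ≤ 1 - qV := by linarith
    gcongr

theorem V_nonneg (h : IsMoments β₁ β₂ QM QV g M V) (hQV : IsQuantizer QV qV) (hβ₂ : 0 ≤ β₂)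
    (hq : qV ≤ 1) (t : ℕ) : 0 ≤ V t :=
  (expSum_nonneg (mul_nonneg hβ₂ (by linarith)) (fun j => sq_nonneg (g j)) t).trans
    (h.expSum_le_V hQV hβ₂ hq t)

/-- Together with `V_le_pow_mul_expSum` this compares `V` with the exact second moment
multiplicatively. The exponent is `t`, not `t + 1`, because `V 0` is not quantized. -/
theorem pow_mul_expSum_le_V (h : IsMoments β₁ β₂ QM QV g M V) (hQV : IsQuantizer QV qV)
    (hβ₂ : 0 ≤ β₂) (hq : qV ≤ 1) (t : ℕ) :
    (1 - qV) ^ t * expSum β₂ (fun j => g j ^ 2) t ≤ V t := by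
  have h1 : 0 ≤ 1 - qV := by linarith
  induction t with
  | zero => simp [h.V_zero, expSum]
  | succ t ih =>
    have h2 := (hQV.le_of_nonneg (h.V_nonneg hQV hβ₂ hq t)).1
    have h3 := mul_le_mul_of_nonneg_left ih h1
    have h4 := mul_le_mul_of_nonneg_left (h3.trans h2) hβ₂
    have h5 : (1 - qV) ^ (t + 1) ≤ 1 := pow_le_one₀ h1 (by linarith [hQV.nonneg])
    have h6 := mul_le_mul_of_nonneg_right h5 (sq_nonneg (g (t + 1)))
    rw [h.V_succ]
    simp only [expSum]
    calc _ = β₂ * ((1 - qV) * ((1 - qV) ^ t * expSum β₂ (fun j => g j ^ 2) t)) +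
          (1 - qV) ^ (t + 1) * g (t + 1) ^ 2 := by ring
      _ ≤ _ := by linarith

theorem V_le_pow_mul_expSum (h : IsMoments β₁ β₂ QM QV g M V) (hQV : IsQuantizer QV qV)
    (hβ₂ : 0 ≤ β₂) (hq : qV ≤ 1) (t : ℕ) :
    V t ≤ (1 + qV) ^ t * expSum β₂ (fun j => g j ^ 2) t := by
  have h0 := hQV.nonneg
  have h1 : 0 ≤ 1 + qV := by linarith
  induction t with
  | zero => simp [h.V_zero, expSum]
  | succ t ih =>
    have h2 := (hQV.le_of_nonneg (h.V_nonneg hQV hβ₂ hq t)).2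
    have h3 := mul_le_mul_of_nonneg_left ih h1
    have h4 := mul_le_mul_of_nonneg_left (h2.trans h3) hβ₂
    have h5 : 1 ≤ (1 + qV) ^ (t + 1) := one_le_pow₀ (by linarith)
    have h6 := mul_le_mul_of_nonneg_right h5 (sq_nonneg (g (t + 1)))
    rw [h.V_succ]
    simp only [expSum]
    calc _ ≤ β₂ * ((1 + qV) * ((1 + qV) ^ t * expSum β₂ (fun j => g j ^ 2) t)) +
          (1 + qV) ^ (t + 1) * g (t + 1) ^ 2 := by linarith
      _ = _ := by ring

theorem sq_M_le (h : IsMoments β₁ β₂ QM QV g M V) (hQM : IsQuantizer QM qM)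
    (hQV : IsQuantizer QV qV) (hβ₁ : 0 ≤ β₁) (hβ₂ : 0 ≤ β₂) (hq : qV ≤ 1)
    (hr : (β₁ * (1 + qM)) ^ 2 < β₂ * (1 - qV)) (t : ℕ) :
    M t ^ 2 ≤ 1 / (1 - (β₁ * (1 + qM)) ^ 2 / (β₂ * (1 - qV))) * V t := by
  have hb : 0 < β₂ * (1 - qV) := (sq_nonneg _).trans_lt hr
  have hr1 : 0 < 1 - (β₁ * (1 + qM)) ^ 2 / (β₂ * (1 - qV)) := sub_pos.2 ((div_lt_one hb).2 hr)
  calc M t ^ 2 = |M t| ^ 2 := (sq_abs _).symm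
    _ ≤ expSum (β₁ * (1 + qM)) (fun j => |g j|) t ^ 2 := by
        gcongr
        exact h.abs_M_le hQM hβ₁ t
    _ ≤ _ := sq_expSum_le hr _ t
    _ ≤ _ := by
        simp only [sq_abs]
        gcongr
        exact h.expSum_le_V hQV hβ₂ hq t

/-- Enlarging the numerator to rate `β₁ (1 + q_M)` and shrinking the denominator to rate `β₂ (1 -
q_V)` reduces the quantized quotient to `sum_sq_expSum_div_le`. It controls the squared step
lengths. -/
theorem sum_sq_M_div_le (h : IsMoments β₁ β₂ QM QV g M V) (hQM : IsQuantizer QM qM)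
    (hQV : IsQuantizer QV qV) (hβ₁ : 0 ≤ β₁) (hβ₂ : 0 ≤ β₂) (hq : qV ≤ 1)
    (hr : β₁ * (1 + qM) < β₂ * (1 - qV)) (hb1 : β₂ * (1 - qV) < 1) {ε X : ℝ} (hε : 0 < ε)
    (hX : ∀ t, g t ^ 2 ≤ X) (T : ℕ) :
    ∑ t ∈ Finset.range T, M t ^ 2 / (V t + ε) ≤
      1 / ((1 - β₁ * (1 + qM)) * (1 - β₁ * (1 + qM) / (β₂ * (1 - qV)))) *
        logTerm (β₂ * (1 - qV)) ε X T := by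
  have hqM := hQM.nonneg
  have hb0 : 0 ≤ β₁ * (1 + qM) := by positivity
  refine le_trans (Finset.sum_le_sum fun t _ => ?_)
    (sum_sq_expSum_div_le hb0 hr hb1 hε (fun j => |g j|) (fun t => by simpa using hX t) T)
  simp only [sq_abs]
  have h1 := h.abs_M_le hQM hβ₁ t
  have h2 := h.expSum_le_V hQV hβ₂ hq t
  have h3 := expSum_nonneg (hb0.trans hr.le) (fun j => sq_nonneg (g j)) t
  rw [← sq_abs (M t), add_comm ε]
  gcongr

/-- The effect of the quantization of both moments on the update direction. -/
theorem abs_update_sub_le (h : IsMoments β₁ β₂ QM QV g M V) (hQM : IsQuantizer QM qM)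
    (hQV : IsQuantizer QV qV) (hβ₁ : 0 ≤ β₁) (hβ₂ : 0 ≤ β₂) (hq : qV ≤ 1)
    (hr : (β₁ * (1 + qM)) ^ 2 < β₂ * (1 - qV)) {ε : ℝ} (hε : 0 < ε) (t : ℕ) :
    |M t / √(V t + ε) - expSum β₁ g t / √(ε + expSum β₂ (fun j => g j ^ 2) t)| ≤
      qM / (1 + qM) * √((β₁ * (1 + qM)) ^ 2 / (β₂ * (1 - qV)) *
        (1 + (β₁ * (1 + qM)) ^ 2 / (β₂ * (1 - qV))) /
        (1 - (β₁ * (1 + qM)) ^ 2 / (β₂ * (1 - qV))) ^ 3) +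
      1 / √(1 - β₁ ^ 2 / (β₂ * (1 - qV))) * (1 - (1 - qV) ^ t) := by
  have hqM := hQM.nonneg
  have hqV := hQV.nonneg
  have hb : 0 < β₂ * (1 - qV) := (sq_nonneg _).trans_lt hr
  have hβ₁b : β₁ ^ 2 < β₂ * (1 - qV) := by
    refine lt_of_le_of_lt ?_ hr
    gcongr
    nlinarith
  set b := β₂ * (1 - qV) with hbdef
  set S := expSum b (fun j => g j ^ 2) t with hS
  set m := expSum β₁ g t with hm
  set v := expSum β₂ (fun j => g j ^ 2) t with hv
  have hS0 : 0 ≤ S := expSum_nonneg hb.le (fun j => sq_nonneg (g j)) t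
  have hSV : S ≤ V t := h.expSum_le_V hQV hβ₂ hq t
  have hSv : S ≤ v := expSum_mono hb.le (by rw [hbdef]; nlinarith) (fun j => sq_nonneg (g j)) t
  have hV0 : 0 < V t + ε := by linarith
  have hv0 : 0 < ε + v := by linarith
  set K := 1 / (1 - β₁ ^ 2 / b) with hK
  have hK0 : 0 < 1 - β₁ ^ 2 / b := sub_pos.2 ((div_lt_one hb).2 hβ₁b)
  have hKs : 1 / √(1 - β₁ ^ 2 / b) = √K := by rw [hK, Real.sqrt_div zero_le_one, Real.sqrt_one]
  rw [hKs]
  have hmK : m ^ 2 ≤ K * S := sq_expSum_le hβ₁b g t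
  -- The normalized exact momentum is bounded for any denominator above `S`; both `V t + ε` and `ε +
  -- v` qualify.
  have hmz : ∀ z, 0 < z → S ≤ z → |m| / √z ≤ √K := by
    intro z hz hSz
    rw [div_le_iff₀ (Real.sqrt_pos.2 hz), ← Real.sqrt_mul (by positivity)]
    apply Real.le_sqrt_of_sq_le
    rw [sq_abs]
    exact hmK.trans (by gcongr)
  have hpow : 0 ≤ (1 - qV) ^ t := pow_nonneg (by linarith) t
  have hpow1 : (1 - qV) ^ t ≤ 1 := pow_le_one₀ (by linarith) (by linarith)
  have hfirst : |(M t - m) / √(V t + ε)| ≤ qM / (1 + qM) * √((β₁ * (1 + qM)) ^ 2 / b *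
        (1 + (β₁ * (1 + qM)) ^ 2 / b) / (1 - (β₁ * (1 + qM)) ^ 2 / b) ^ 3) := by
    have h1 := h.abs_M_sub_le hQM hβ₁ t
    have h2 := sq_expSum_sub_le hβ₁ hqM hr (fun j => abs_nonneg (g j)) t
    simp only [sq_abs] at h2
    have hr1 : 0 < 1 - (β₁ * (1 + qM)) ^ 2 / b := sub_pos.2 ((div_lt_one hb).2 hr)
    rw [abs_div, abs_of_pos (Real.sqrt_pos.2 hV0), div_le_iff₀ (Real.sqrt_pos.2 hV0), mul_assoc,
      ← Real.sqrt_mul (by positivity)]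
    refine h1.trans (abs_le_of_sq_le_sq' ?_ (by positivity)).2
    rw [mul_pow, Real.sq_sqrt (by positivity), ← mul_assoc]
    refine h2.trans ?_
    gcongr
    linarith
  -- Here `y` is the smaller and `z` the larger of the two denominators, which treats both orders at
  -- once. The bound `√(y / z) ≥ c` follows from `c ^ 2 ≤ c ≤ y / z`.
  have hratio : ∀ y z c : ℝ, 0 < y → y ≤ z → 0 ≤ c → c ≤ 1 → c * z ≤ y → S ≤ y →
      |m| * (1 / √y - 1 / √z) ≤ √K * (1 - c) := by
    intro y z c hy hyz hc hc1 hcz hSy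
    have hz : 0 < z := hy.trans_le hyz
    have h1 : c ≤ √(y / z) := by
      refine Real.le_sqrt_of_sq_le ?_
      rw [le_div_iff₀ hz]
      nlinarith
    have h2 : |m| * (1 / √y - 1 / √z) = |m| / √y * (1 - √(y / z)) := by
      rw [Real.sqrt_div hy.le]
      have := (Real.sqrt_pos.2 hy).ne'
      have := (Real.sqrt_pos.2 hz).ne'
      field_simp
    rw [h2]
    have h3 : 0 ≤ 1 - c := by linarith
    calc _ ≤ |m| / √y * (1 - c) := by gcongr
      _ ≤ _ := by gcongr; exact hmz y hy hSy
  have hsecond : |m * (1 / √(V t + ε) - 1 / √(ε + v))| ≤ √K * (1 - (1 - qV) ^ t) := by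
    rw [abs_mul]
    rcases le_total (V t + ε) (ε + v) with hle | hle
    · rw [abs_of_nonneg (sub_nonneg.2
        (one_div_le_one_div_of_le (Real.sqrt_pos.2 hV0) (Real.sqrt_le_sqrt hle)))]
      refine hratio _ _ _ hV0 hle hpow hpow1 ?_ (by linarith)
      have := h.pow_mul_expSum_le_V hQV hβ₂ hq t
      nlinarith
    · rw [abs_of_nonpos (sub_nonpos.2
        (one_div_le_one_div_of_le (Real.sqrt_pos.2 hv0) (Real.sqrt_le_sqrt hle))), neg_sub]
      refine hratio _ _ _ hv0 hle hpow hpow1 ?_ (by linarith)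
      have h1 := h.V_le_pow_mul_expSum hQV hβ₂ hq t
      -- Because `(1 - q)(1 + q) ≤ 1`, overestimation of `V` obeys the same factor `(1 - qV) ^ t` as
      -- underestimation.
      have h2 : (1 - qV) ^ t * (1 + qV) ^ t ≤ 1 := by
        rw [← mul_pow]
        exact pow_le_one₀ (mul_nonneg (by linarith) (by linarith)) (by nlinarith)
      have h3 : (1 - qV) ^ t * V t ≤ v := by
        refine (mul_le_mul_of_nonneg_left h1 hpow).trans ?_
        rw [← mul_assoc]
        exact mul_le_of_le_one_left (by linarith) h2
      nlinarith
  calc _ = |(M t - m) / √(V t + ε) + m * (1 / √(V t + ε) - 1 / √(ε + v))| := by congr 1; ring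
    _ ≤ _ := (abs_add_le _ _).trans (add_le_add hfirst hsecond)

end IsMoments

/-! ### Descent along the momentum direction, one coordinate -/

/-- The part of `expSum β x s` that does not involve `x s`. -/
def prevSum (β : ℝ) (x : ℕ → ℝ) : ℕ → ℝ
  | 0 => 0
  | s + 1 => β * expSum β x s

theorem expSum_eq_prevSum_add (β : ℝ) (x : ℕ → ℝ) (s : ℕ) :
    expSum β x s = prevSum β x s + x s := by
  cases s <;> simp [expSum, prevSum]

theorem prevSum_nonneg {β : ℝ} (hβ : 0 ≤ β) {x : ℕ → ℝ} (hx : ∀ t, 0 ≤ x t) (s : ℕ) :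
    0 ≤ prevSum β x s := by
  cases s with
  | zero => exact le_rfl
  | succ s => exact mul_nonneg hβ (expSum_nonneg hβ hx s)

/-- An upper bound for `ε + expSum β x (s + k)` that does not involve `x s, …, x (s + k)`. -/
def majorant (β ε X : ℝ) (x : ℕ → ℝ) (s k : ℕ) : ℝ :=
  ε + β ^ k * prevSum β x s + X * ∑ j ∈ Finset.range (k + 1), β ^ j

theorem expSum_add_le {β X : ℝ} (hβ : 0 ≤ β) {x : ℕ → ℝ} (hX : ∀ t, x t ≤ X) (s k : ℕ) :
    expSum β x (s + k) ≤ β ^ k * prevSum β x s + X * ∑ j ∈ Finset.range (k + 1), β ^ j := by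
  induction k with
  | zero => simpa [expSum_eq_prevSum_add] using hX s
  | succ k ih =>
    have h1 := hX (s + k + 1)
    have h2 := mul_le_mul_of_nonneg_left ih hβ
    rw [← add_assoc, expSum, Finset.sum_range_succ', pow_zero, pow_succ]
    have h3 : ∑ j ∈ Finset.range (k + 1), β ^ (j + 1) =
        β * ∑ j ∈ Finset.range (k + 1), β ^ j := by
      rw [Finset.mul_sum]; exact Finset.sum_congr rfl fun j _ => by ring
    rw [h3]
    nlinarith

theorem pow_mul_expSum_le {β : ℝ} (hβ : 0 ≤ β) {x : ℕ → ℝ} (hx : ∀ t, 0 ≤ x t) (s k : ℕ) :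
    β ^ k * expSum β x s ≤ expSum β x (s + k) := by
  induction k with
  | zero => simp
  | succ k ih =>
    have h1 := hx (s + k + 1)
    have h2 := mul_le_mul_of_nonneg_left ih hβ
    rw [← add_assoc, expSum, pow_succ]
    nlinarith

theorem add_expSum_le_majorant {β ε X : ℝ} (hβ : 0 ≤ β) {x : ℕ → ℝ} (hX : ∀ t, x t ≤ X)
    (s k : ℕ) : ε + expSum β x (s + k) ≤ majorant β ε X x s k := by
  have := expSum_add_le hβ hX s k
  unfold majorant
  linarith

/-- Along the run, with `s + k = t`, the square root of the right-hand side is at most a constant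
times `bigOmega β (t + 1)`, the factor built into the step size. -/
theorem majorant_le {β ε X : ℝ} (hβ : 0 ≤ β) (hε : 0 ≤ ε) {x : ℕ → ℝ}
    (hX : ∀ t, x t ≤ X) (s k : ℕ) :
    majorant β ε X x s k ≤ (ε + X) * ∑ j ∈ Finset.range (s + k + 1), β ^ j := by
  have h1 : prevSum β x s ≤ X * ∑ j ∈ Finset.range s, β ^ (j + 1) := by
    cases s with
    | zero => simp [prevSum]
    | succ s =>
      have := mul_le_mul_of_nonneg_left (expSum_le_mul_sum hβ hX s) hβ
      refine this.trans (le_of_eq ?_)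
      simp only [pow_succ, ← Finset.sum_mul]
      ring
  have h2 : ∑ j ∈ Finset.range (s + k + 1), β ^ j =
      ∑ j ∈ Finset.range (k + 1), β ^ j + β ^ k * ∑ j ∈ Finset.range s, β ^ (j + 1) := by
    rw [show s + k + 1 = k + 1 + s by ring, Finset.sum_range_add, Finset.mul_sum]
    congr 1
    exact Finset.sum_congr rfl fun j _ => by ring
  have h3 : 1 ≤ ∑ j ∈ Finset.range (s + k + 1), β ^ j := by
    rw [Finset.sum_range_succ', pow_zero]
    have : 0 ≤ ∑ j ∈ Finset.range (s + k), β ^ (j + 1) :=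
      Finset.sum_nonneg fun j _ => by positivity
    linarith
  have h4 := mul_le_mul_of_nonneg_left h1 (pow_nonneg hβ k)
  have h5 := mul_le_mul_of_nonneg_left h3 hε
  unfold majorant
  rw [add_mul, h2] at *
  nlinarith

/-- The price of enlarging the denominator from `x` to `y`. Half of it is charged to `D ^ 2 / √y`,
which the main term can afford, and the rest to the normalized square `g ^ 2 / x`, which is
summable. -/
theorem div_sqrt_ge_of_majorant {x y r : ℝ} (hx : 0 < x) (hxy : x ≤ y) (hr : 0 ≤ r)
    (hyx : y - x ≤ r ^ 2) (hry : r ^ 2 ≤ y) (D g : ℝ) :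
    D * g / √y - D ^ 2 / (4 * √y) - r * (g ^ 2 / x) ≤ D * g / √x := by
  have hy : 0 < y := hx.trans_le hxy
  set X := √x with hX
  set Y := √y with hY
  have hX0 : 0 < X := Real.sqrt_pos.2 hx
  have hY0 : 0 < Y := Real.sqrt_pos.2 hy
  have hXY : X ≤ Y := Real.sqrt_le_sqrt hxy
  have hxX : x = X ^ 2 := (Real.sq_sqrt hx.le).symm
  have hyY : y = Y ^ 2 := (Real.sq_sqrt hy.le).symm
  have hrY : r ≤ Y := Real.le_sqrt_of_sq_le hry
  have h1 : |D * g / Y - D * g / X| ≤ |D| * (|g| / X) * (r * r) / Y ^ 2 := by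
    have : D * g / Y - D * g / X = -(D * (g / X) * (Y - X) / Y) := by field_simp; ring
    rw [this, abs_neg, abs_div, abs_mul, abs_mul, abs_div, abs_of_pos hX0, abs_of_pos hY0,
      abs_of_nonneg (sub_nonneg.2 hXY)]
    -- This is `(Y - X) * Y ≤ (Y - X) * (Y + X) = y - x`.
    have h2 : (Y - X) * Y ≤ r * r := by nlinarith
    rw [div_le_div_iff₀ hY0 (by positivity)]
    have h3 : 0 ≤ |D| * (|g| / X) := by positivity
    calc _ = |D| * (|g| / X) * Y * ((Y - X) * Y) := by ring
      _ ≤ |D| * (|g| / X) * Y * (r * r) := by gcongr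
      _ = _ := by ring
  have h2 : |D| * (|g| / X) * (r * r) / Y ^ 2 ≤ D ^ 2 / (4 * Y) + r * (g ^ 2 / x) := by
    set z := |g| / X with hz
    have hz0 : 0 ≤ z := by positivity
    have hzg : g ^ 2 / x = z ^ 2 := by rw [hz, div_pow, sq_abs, hxX]
    rw [hzg]
    -- Young's inequality, weighted to leave exactly `D ^ 2 / (4 * Y)`; three of the four powers of
    -- `r` are then absorbed by `Y ^ 3`.
    have h5 : |D| * z * (r * r) / Y ^ 2 ≤ D ^ 2 / (4 * Y) + z ^ 2 * (r * r) ^ 2 / Y ^ 3 := by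
      have : D ^ 2 / (4 * Y) + z ^ 2 * (r * r) ^ 2 / Y ^ 3 - |D| * z * (r * r) / Y ^ 2
          = (|D| * Y / 2 - z * (r * r)) ^ 2 / Y ^ 3 := by
        rw [← sq_abs D]; field_simp; ring
      have h6 : 0 ≤ (|D| * Y / 2 - z * (r * r)) ^ 2 / Y ^ 3 := by positivity
      linarith
    have h7 : z ^ 2 * (r * r) ^ 2 / Y ^ 3 ≤ r * z ^ 2 := by
      rw [div_le_iff₀ (by positivity)]
      have : r ^ 3 ≤ Y ^ 3 := by gcongr
      calc _ = r * z ^ 2 * r ^ 3 := by ring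
        _ ≤ _ := by gcongr
    linarith
  have h3 := (abs_le.1 (h1.trans h2)).2
  linarith

/-- The weight of the squared normalized gradient `k` steps back. -/
def lagWeight (a β₁ A : ℝ) (k : ℕ) : ℝ :=
  A * (1 / 2 * (√(1 - a) * (k + 1) + 1 / √(1 - a)) + 1 / (1 - β₁))

/-- For each lag `k`, with `s = t - k`, two exchanges are made in `D t * g s / √v`: `D t` becomes `D
s` and `v` becomes the majorant `w`, which is free of `g s, …, g t`. The three sums on the left are
the main term, the normalized squares paid in both exchanges, and the gradient drift. -/
theorem momentum_descent {β₁ β₂ ε A X : ℝ} (hβ₁ : 0 ≤ β₁) (hβ₁' : β₁ < 1) (hβ₂ : 0 < β₂)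
    (hβ₂' : β₂ ≤ 1) (hβ : β₁ < β₂) (hε : 0 < ε) (hA : 0 < A) (hXA : ε + X ≤ A ^ 2) (g D : ℕ → ℝ)
    (hX : ∀ t, g t ^ 2 ≤ X) (t : ℕ) :
    ∑ k ∈ Finset.range (t + 1), β₁ ^ k *
      (D (t - k) * g (t - k) / √(majorant β₂ ε X (fun j => g j ^ 2) (t - k) k) -
        D (t - k) ^ 2 / (4 * √(majorant β₂ ε X (fun j => g j ^ 2) (t - k) k))) -
    ∑ k ∈ Finset.range (t + 1), (β₁ / β₂) ^ k * lagWeight (β₁ / β₂) β₁ A k *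
      (g (t - k) ^ 2 / (ε + expSum β₂ (fun j => g j ^ 2) (t - k))) -
    ∑ k ∈ Finset.range (t + 1), β₁ ^ k * ((1 - β₁) / (4 * A)) * (D t - D (t - k)) ^ 2 ≤
    D t * (expSum β₁ g t / √(ε + expSum β₂ (fun j => g j ^ 2) t)) := by
  set x : ℕ → ℝ := fun j => g j ^ 2 with hx
  have hx0 : ∀ j, 0 ≤ x j := fun j => sq_nonneg _
  have hX0 : 0 ≤ X := (hx0 0).trans (hX 0)
  have ha0 : 0 ≤ β₁ / β₂ := by positivity
  have ha1 : β₁ / β₂ < 1 := (div_lt_one hβ₂).2 hβ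
  rw [expSum_eq_sum, ← Finset.sum_sub_distrib, ← Finset.sum_sub_distrib, Finset.sum_div,
    Finset.mul_sum]
  refine Finset.sum_le_sum fun k hk => ?_
  have hkt : t - k + k = t := Nat.sub_add_cancel (Nat.lt_succ_iff.1 (Finset.mem_range.1 hk))
  set s := t - k with hs
  have hv0 := expSum_nonneg hβ₂.le hx0 t
  have hvs0 := expSum_nonneg hβ₂.le hx0 s
  set v := ε + expSum β₂ x t with hv
  set vs := ε + expSum β₂ x s with hvs
  have hvpos : 0 < v := by positivity
  have hvspos : 0 < vs := by positivity
  have hvv : β₂ ^ k * vs ≤ v := by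
    have h1 := pow_mul_expSum_le hβ₂.le hx0 s k
    rw [hkt] at h1
    have h2 : β₂ ^ k ≤ 1 := pow_le_one₀ hβ₂.le hβ₂'
    rw [hv, hvs, mul_add]
    nlinarith
  set w := majorant β₂ ε X x s k with hw
  have hvw : v ≤ w := by
    have := add_expSum_le_majorant (ε := ε) hβ₂.le hX s k
    rwa [hkt] at this
  set Sg := ∑ j ∈ Finset.range (k + 1), β₂ ^ j with hSg
  have hSg0 : 0 ≤ Sg := Finset.sum_nonneg fun j _ => by positivity
  have hSgk : Sg ≤ k + 1 := by
    calc Sg ≤ ∑ j ∈ Finset.range (k + 1), 1 :=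
          Finset.sum_le_sum fun j _ => pow_le_one₀ hβ₂.le hβ₂'
      _ = _ := by simp
  set r := √(X * Sg) with hr
  have hr2 : r ^ 2 = X * Sg := Real.sq_sqrt (by positivity)
  have hprev := prevSum_nonneg hβ₂.le hx0 s
  have hrw : r ^ 2 ≤ w := by
    rw [hr2, hw, majorant, ← hSg]
    have : 0 ≤ β₂ ^ k * prevSum β₂ x s := by positivity
    linarith
  have hwv : w - v ≤ r ^ 2 := by
    have h1 := pow_mul_expSum_le hβ₂.le hx0 s k
    rw [hkt, expSum_eq_prevSum_add] at h1
    have h2 : 0 ≤ β₂ ^ k * x s := mul_nonneg (by positivity) (hx0 s)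
    rw [hr2, hw, majorant, ← hSg, hv]
    linarith
  have h1 := div_sqrt_ge_of_majorant hvpos hvw (Real.sqrt_nonneg _) hwv hrw (D s) (g s)
  rw [← hr] at h1
  have hσ : 0 < √(1 - β₁ / β₂) := Real.sqrt_pos.2 (by linarith)
  set σ := √(1 - β₁ / β₂) with hσd
  -- By AM-GM, `√(k + 1)` is bounded by an affine function of `k`, whose geometric sums are
  -- explicit. The weight `σ` balances the two parts after summation.
  have hrA : r ≤ A * (1 / 2 * (σ * (k + 1) + 1 / σ)) := by
    have hle : X * Sg ≤ A ^ 2 * (k + 1) := by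
      have : X ≤ A ^ 2 := by linarith
      gcongr
    have h2 : (k : ℝ) + 1 ≤ (1 / 2 * (σ * (k + 1) + 1 / σ)) ^ 2 := by
      have : (1 / 2 * (σ * ((k : ℝ) + 1) + 1 / σ)) ^ 2 - (k + 1) =
          (1 / 2 * (σ * (k + 1) - 1 / σ)) ^ 2 := by field_simp; ring
      have h3 := sq_nonneg (1 / 2 * (σ * ((k : ℝ) + 1) - 1 / σ))
      linarith
    refine Real.sqrt_le_iff.2 ⟨by positivity, hle.trans ?_⟩
    rw [mul_pow]
    gcongr
  -- Moving the denominator back from time `t` to time `s` costs `β₂ ^ (-k)`; this is why the lag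
  -- weights decay like `(β₁ / β₂) ^ k`.
  have hU : g s ^ 2 / v ≤ 1 / β₂ ^ k * (g s ^ 2 / vs) := by
    rw [← mul_div_mul_comm, one_mul]
    gcongr
  have hU0 : 0 ≤ g s ^ 2 / v := by positivity
  have h1β : 0 < 1 - β₁ := by linarith
  -- Young's inequality for `(D t - D s) * g s / √v`, with the weights `(1 - β₁) / (4 A)` and `A /
  -- (1 - β₁)`, whose product is `1/4`.
  have hB : D s * g s / √v - (1 - β₁) / (4 * A) * (D t - D s) ^ 2 - A / (1 - β₁) * (g s ^ 2 / v) ≤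
      D t * g s / √v := by
    have hsv : 0 < √v := Real.sqrt_pos.2 hvpos
    have : g s ^ 2 / v = (g s / √v) ^ 2 := by rw [div_pow, Real.sq_sqrt hvpos.le]
    rw [this, mul_div_assoc, mul_div_assoc]
    set z := g s / √v
    have h4 : (1 - β₁) / (4 * A) * (D t - D s) ^ 2 + A / (1 - β₁) * z ^ 2 + (D t - D s) * z =
        ((1 - β₁) * (D t - D s) / 2 + A * z) ^ 2 / (A * (1 - β₁)) := by field_simp; ring
    have h5 : 0 ≤ ((1 - β₁) * (D t - D s) / 2 + A * z) ^ 2 / (A * (1 - β₁)) := by positivity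
    linarith
  have hlag : (r + A / (1 - β₁)) * (g s ^ 2 / v) ≤
      lagWeight (β₁ / β₂) β₁ A k * (1 / β₂ ^ k * (g s ^ 2 / vs)) := by
    have hle : r + A / (1 - β₁) ≤ lagWeight (β₁ / β₂) β₁ A k := by
      unfold lagWeight
      rw [← hσd, mul_add, ← div_eq_mul_one_div]
      linarith
    have hw0 : 0 ≤ lagWeight (β₁ / β₂) β₁ A k := le_trans (by positivity) hle
    gcongr
  have hp : 0 ≤ β₁ ^ k := by positivity
  have hfin : D s * g s / √w - D s ^ 2 / (4 * √w) -
      lagWeight (β₁ / β₂) β₁ A k * (1 / β₂ ^ k * (g s ^ 2 / vs)) -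
      (1 - β₁) / (4 * A) * (D t - D s) ^ 2 ≤ D t * g s / √v := by
    rw [add_mul] at hlag
    linarith
  have := mul_le_mul_of_nonneg_left hfin hp
  refine le_trans (le_of_eq ?_) (this.trans (le_of_eq ?_))
  · rw [div_pow]; ring
  · ring

/-! ### Double sums over lags -/

theorem sum_lag_comm (F : ℕ → ℕ → ℝ) (T : ℕ) :
    ∑ t ∈ Finset.range T, ∑ k ∈ Finset.range (t + 1), F t k =
      ∑ k ∈ Finset.range T, ∑ t ∈ Finset.Ico k T, F t k := by
  refine Finset.sum_comm' fun t k => ?_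
  simp only [Finset.mem_range, Finset.mem_Ico]
  omega

theorem sum_Ico_shift_le {z : ℕ → ℝ} (hz : ∀ j, 0 ≤ z j) {k l : ℕ} (hl : l ≤ k) (T : ℕ) :
    ∑ t ∈ Finset.Ico k T, z (t - k + l) ≤ ∑ j ∈ Finset.range T, z j := by
  have hinj : Set.InjOn (fun t => t - k + l) (Finset.Ico k T : Set ℕ) := by
    intro a ha b hb hab
    simp only [Finset.coe_Ico, Set.mem_Ico] at ha hb hab
    omega
  rw [← Finset.sum_image (f := z) hinj]
  refine Finset.sum_le_sum_of_subset_of_nonneg (fun j hj => ?_) fun j _ _ => hz j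
  simp only [Finset.mem_image, Finset.mem_Ico, Finset.mem_range] at hj ⊢
  omega

theorem sum_sum_lag_le {c y : ℕ → ℝ} (hc : ∀ k, 0 ≤ c k) (hy : ∀ j, 0 ≤ y j) (T : ℕ) :
    ∑ t ∈ Finset.range T, ∑ k ∈ Finset.range (t + 1), c k * y (t - k) ≤
      (∑ k ∈ Finset.range T, c k) * ∑ j ∈ Finset.range T, y j := by
  rw [sum_lag_comm, Finset.sum_mul]
  refine Finset.sum_le_sum fun k _ => ?_
  rw [← Finset.mul_sum]
  exact mul_le_mul_of_nonneg_left (by simpa using sum_Ico_shift_le hy (zero_le (a := k)) T) (hc k)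

/-- For a fixed lag, Cauchy–Schwarz over the `k` intermediate increments gives one factor `k`. Each
increment then occurs at most once for each of the `k` offsets, which gives the other. -/
theorem sum_sum_lag_sq_norm_sub_le {E : Type*} [SeminormedAddCommGroup E] (W : ℕ → E)
    {c : ℕ → ℝ} (hc : ∀ k, 0 ≤ c k) (T : ℕ) :
    ∑ t ∈ Finset.range T, ∑ k ∈ Finset.range (t + 1), c k * ‖W t - W (t - k)‖ ^ 2 ≤
      (∑ k ∈ Finset.range T, c k * (k : ℝ) ^ 2) *
        ∑ j ∈ Finset.range T, ‖W (j + 1) - W j‖ ^ 2 := by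
  rw [sum_lag_comm, Finset.sum_mul]
  refine Finset.sum_le_sum fun k _ => ?_
  rw [← Finset.mul_sum, mul_assoc]
  refine mul_le_mul_of_nonneg_left ?_ (hc k)
  have h1 : ∀ t ∈ Finset.Ico k T, ‖W t - W (t - k)‖ ^ 2 ≤
      k * ∑ l ∈ Finset.range k, ‖W (t - k + l + 1) - W (t - k + l)‖ ^ 2 := by
    intro t ht
    have hkt : t - k + k = t := Nat.sub_add_cancel (Finset.mem_Ico.1 ht).1
    have h2 : W t - W (t - k) = ∑ l ∈ Finset.range k, (W (t - k + l + 1) - W (t - k + l)) := by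
      have := Finset.sum_range_sub (fun l => W (t - k + l)) k
      rw [hkt, add_zero] at this
      exact this.symm
    rw [h2]
    refine (pow_le_pow_left₀ (norm_nonneg _) (norm_sum_le _ _) 2).trans ?_
    simpa using sq_sum_le_card_mul_sum_sq (s := Finset.range k)
      (f := fun l => ‖W (t - k + l + 1) - W (t - k + l)‖)
  refine (Finset.sum_le_sum h1).trans ?_
  rw [← Finset.mul_sum, Finset.sum_comm, sq, mul_assoc]
  refine mul_le_mul_of_nonneg_left ?_ (Nat.cast_nonneg k)
  refine (Finset.sum_le_card_nsmul _ _ _ fun l hl => sum_Ico_shift_le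
    (z := fun j => ‖W (j + 1) - W j‖ ^ 2) (fun j => by positivity)
    (Finset.mem_range.1 hl).le T).trans ?_
  simp

theorem rpow_three_halves {y : ℝ} (hy : 0 ≤ y) : y ^ (3 / 2 : ℝ) = √y ^ 3 := by
  rw [Real.sqrt_eq_rpow, ← Real.rpow_natCast, ← Real.rpow_mul hy]
  norm_num

/-- With `σ = √(1 - a)` and `τ = √(1 - β₁)` the geometric sums give `A (τ ^ 2 + σ) / (τ ^ 2 σ ^ 3)`;
the form stated follows from `σ ≤ τ ≤ 1`. -/
theorem sum_lagWeight_le {a β₁ A : ℝ} (ha1 : a < 1) (hβ₁ : 0 ≤ β₁) (hβ : β₁ ≤ a)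
    (hA : 0 ≤ A) (n : ℕ) : ∑ k ∈ Finset.range n, a ^ k * lagWeight a β₁ A k ≤
      2 * A / (√(1 - β₁) * (1 - a) ^ (3 / 2 : ℝ)) := by
  have ha : 0 ≤ a := hβ₁.trans hβ
  have h1 : 0 < 1 - a := by linarith
  have h2 : 0 < 1 - β₁ := by linarith
  rw [rpow_three_halves h1.le]
  unfold lagWeight
  set σ := √(1 - a) with hσ
  set τ := √(1 - β₁) with hτ
  have hσ0 : 0 < σ := Real.sqrt_pos.2 h1
  have hτ0 : 0 < τ := Real.sqrt_pos.2 h2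
  have hστ : σ ≤ τ := Real.sqrt_le_sqrt (by linarith)
  have hτ1 : τ ≤ 1 := by rw [hτ, Real.sqrt_le_one]; linarith
  have hσ2 : 1 - a = σ ^ 2 := (Real.sq_sqrt h1.le).symm
  have hτ2 : 1 - β₁ = τ ^ 2 := (Real.sq_sqrt h2.le).symm
  have hs1 := sum_succ_mul_geom_le ha ha1 n
  have hs2 := sum_geom_le ha ha1 n
  rw [hσ2] at hs1 hs2
  rw [hτ2]
  have hsum : ∑ k ∈ Finset.range n, a ^ k * (A * (1 / 2 * (σ * ((k : ℝ) + 1) + 1 / σ) + 1 / τ ^ 2))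
      = A * (σ / 2) * ∑ k ∈ Finset.range n, ((k : ℝ) + 1) * a ^ k +
        A * (1 / (2 * σ) + 1 / τ ^ 2) * ∑ k ∈ Finset.range n, a ^ k := by
    rw [Finset.mul_sum, Finset.mul_sum, ← Finset.sum_add_distrib]
    refine Finset.sum_congr rfl fun k _ => ?_
    field_simp
    ring
  rw [hsum]
  calc _ ≤ A * (σ / 2) * (1 / (σ ^ 2) ^ 2) + A * (1 / (2 * σ) + 1 / τ ^ 2) * (1 / σ ^ 2) := by
        gcongr
    _ = A * (τ ^ 2 + σ) / (τ ^ 2 * σ ^ 3) := by field_simp; ring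
    _ ≤ A * (τ + τ) / (τ ^ 2 * σ ^ 3) := by
        gcongr
        nlinarith
    _ = _ := by field_simp; ring

/-! ### The descent lemma -/

theorem le_add_inner_gradient_add {E : Type*} [NormedAddCommGroup E] [InnerProductSpace ℝ E]
    [CompleteSpace E] {F : E → ℝ} {L : ℝ} (hF : Differentiable ℝ F)
    (hL : ∀ x y, ‖gradient F x - gradient F y‖ ≤ L * ‖x - y‖) (x v : E) :
    F (x + v) ≤ F x + inner ℝ (gradient F x) v + L / 2 * ‖v‖ ^ 2 := by
  -- The linear and quadratic parts are subtracted so that the Lipschitz bound says `φ' ≤ 0` on `(0,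
  -- 1)`; the claim is `φ 1 ≤ φ 0`.
  set φ : ℝ → ℝ := fun t =>
    F (x + t • v) - t * inner ℝ (gradient F x) v - L / 2 * t ^ 2 * ‖v‖ ^ 2 with hφ
  have hd : ∀ t, HasDerivAt φ (inner ℝ (gradient F (x + t • v)) v - inner ℝ (gradient F x) v -
      L * t * ‖v‖ ^ 2) t := by
    intro t
    have h1 : HasDerivAt (fun t : ℝ => x + t • v) v t := by
      simpa using ((hasDerivAt_id t).smul_const v).const_add x
    have h2 := ((hF (x + t • v)).hasGradientAt.hasFDerivAt).comp_hasDerivAt t h1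
    simp only [InnerProductSpace.toDual_apply_apply] at h2
    have h3 := (hasDerivAt_id t).mul_const (inner ℝ (gradient F x) v)
    have h4 := (((hasDerivAt_id t).pow 2).const_mul (L / 2)).mul_const (‖v‖ ^ 2)
    refine ((h2.sub h3).sub h4).congr_deriv ?_
    simp only [id, Nat.cast_ofNat, Nat.reduceSub, pow_one]
    ring
  have hanti : AntitoneOn φ (Set.Icc 0 1) := by
    refine antitoneOn_of_deriv_nonpos (convex_Icc 0 1)
      (fun t _ => (hd t).continuousAt.continuousWithinAt)
      (fun t _ => (hd t).differentiableAt.differentiableWithinAt) fun t ht => ?_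
    rw [interior_Icc] at ht
    rw [(hd t).deriv, ← inner_sub_left]
    have h1 := real_inner_le_norm (gradient F (x + t • v) - gradient F x) v
    have h2 := hL (x + t • v) x
    rw [add_sub_cancel_left, norm_smul, Real.norm_of_nonneg ht.1.le] at h2
    have h3 := mul_le_mul_of_nonneg_right h2 (norm_nonneg v)
    nlinarith
  have := hanti (Set.left_mem_Icc.2 zero_le_one) (Set.right_mem_Icc.2 zero_le_one) zero_le_one
  simp only [hφ, one_smul, zero_smul, add_zero] at this
  linarith

/-! ### Step sizes -/

theorem one_le_bigOmega {β : ℝ} (hβ : 0 ≤ β) (t : ℕ) : 1 ≤ bigOmega β (t + 1) := by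
  rw [bigOmega, Real.one_le_sqrt, Finset.sum_range_succ', pow_zero]
  exact le_add_of_nonneg_left (Finset.sum_nonneg fun j _ => by positivity)

theorem bigOmega_le {β : ℝ} (hβ : 0 ≤ β) (hβ1 : β < 1) (t : ℕ) :
    bigOmega β t ≤ 1 / √(1 - β) := by
  rw [bigOmega, ← Real.sqrt_one, ← Real.sqrt_div zero_le_one, Real.sqrt_one]
  exact Real.sqrt_le_sqrt (sum_geom_le hβ hβ1 t)

/-- An upper bound for all step sizes. -/
def maxStep (p : Params) : ℝ := (1 - p.β₁) * p.η / √(1 - p.β₂)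

/-- The ranges of the parameters. -/
structure Params.Valid (p : Params) : Prop where
  η_pos : 0 < p.η
  β₁_nonneg : 0 ≤ p.β₁
  β₁_lt : p.β₁ < 1
  β₂_pos : 0 < p.β₂
  β₂_lt : p.β₂ < 1
  ε_pos : 0 < p.ε
  qM_nonneg : 0 ≤ p.qM
  qV_nonneg : 0 ≤ p.qV
  qG_nonneg : 0 ≤ p.qG
  qW_nonneg : 0 ≤ p.qW
  ratio_lt : p.β₁ ^ 2 * (1 + p.qM) ^ 2 < p.β₂ * (1 - p.qV)
  rate_lt : p.β₁ * (1 + p.qM) < p.β₂ * (1 - p.qV)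

theorem ratio_eq (p : Params) : ratio p = (p.β₁ * (1 + p.qM)) ^ 2 / (p.β₂ * (1 - p.qV)) := by
  rw [ratio, mul_pow]

namespace Params.Valid

variable {p : Params}

theorem stepSize_nonneg (h : p.Valid) (t : ℕ) : 0 ≤ stepSize p t := by
  have := h.β₁_lt
  have := h.η_pos
  have : 0 ≤ 1 - p.β₁ := by linarith
  have : 0 ≤ bigOmega p.β₂ t := Real.sqrt_nonneg _
  unfold stepSize
  positivity

theorem stepSize_le (h : p.Valid) (t : ℕ) : stepSize p t ≤ maxStep p := by
  have h1 := bigOmega_le h.β₂_pos.le h.β₂_lt t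
  have := h.β₁_lt
  have := h.η_pos
  have : 0 ≤ 1 - p.β₁ := by linarith
  calc stepSize p t ≤ (1 - p.β₁) * (1 / √(1 - p.β₂)) * p.η := by unfold stepSize; gcongr
    _ = _ := by unfold maxStep; ring

theorem maxStep_nonneg (h : p.Valid) : 0 ≤ maxStep p := (h.stepSize_nonneg 0).trans (h.stepSize_le 0)

theorem qV_lt (h : p.Valid) : p.qV < 1 := by
  have h1 : 0 < p.β₂ * (1 - p.qV) := lt_of_le_of_lt (by
    have := h.β₁_nonneg; have := h.qM_nonneg; positivity) h.ratio_lt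
  have := pos_of_mul_pos_right h1 h.β₂_pos.le
  linarith

theorem rate_pos (h : p.Valid) : 0 < p.β₂ * (1 - p.qV) :=
  mul_pos h.β₂_pos (by linarith [h.qV_lt])

theorem rate_le (h : p.Valid) : p.β₂ * (1 - p.qV) ≤ p.β₂ := by
  nlinarith [h.β₂_pos, h.qV_nonneg]

theorem β₁_le_rate (h : p.Valid) : p.β₁ ≤ p.β₁ * (1 + p.qM) := by
  nlinarith [h.β₁_nonneg, h.qM_nonneg]

theorem β₁_lt_β₂ (h : p.Valid) : p.β₁ < p.β₂ := by
  linarith [h.β₁_le_rate, h.rate_lt, h.rate_le]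

theorem ratio_nonneg (h : p.Valid) : 0 ≤ ratio p := by
  have := h.rate_pos
  rw [ratio_eq]
  positivity

theorem ratio_lt_one (h : p.Valid) : ratio p < 1 := by
  rw [ratio, div_lt_one h.rate_pos]
  exact h.ratio_lt

theorem ratio_lt' (h : p.Valid) : (p.β₁ * (1 + p.qM)) ^ 2 < p.β₂ * (1 - p.qV) := by
  rw [mul_pow]; exact h.ratio_lt

end Params.Valid

/-! ### The pathwise bound -/

/-- A trajectory of Adam with quantized moments, driven by an arbitrary sequence `g`. -/
structure IsTrajectory {ι : Type*} (p : Params) (QM QV : ℝ → ℝ) (W : ℕ → EuclideanSpace ℝ ι)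
    (g M V : ℕ → ι → ℝ) : Prop where
  moments : ∀ i, IsMoments p.β₁ p.β₂ QM QV (fun t => g t i) (fun t => M t i) (fun t => V t i)
  step : ∀ t i, W (t + 1) i = W t i - stepSize p (t + 1) * (M t i / √(V t i + p.ε))

/-- The constant `1 / ((1 - β₁ (1 + q_M)) (1 - β₁ (1 + q_M) / (β₂ (1 - q_V))))`. -/
def momentFactor (p : Params) : ℝ :=
  1 / ((1 - p.β₁ * (1 + p.qM)) * (1 - p.β₁ * (1 + p.qM) / (p.β₂ * (1 - p.qV))))

/-- The error of the update direction caused by the quantization of the first moment. -/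
def firstMomentError (p : Params) : ℝ :=
  p.qM / (1 + p.qM) * √(ratio p * (1 + ratio p) / (1 - ratio p) ^ 3)

/-- The factor in the error caused by the quantization of the second moment. -/
def secondMomentFactor (p : Params) : ℝ :=
  1 / √(1 - p.β₁ ^ 2 / (p.β₂ * (1 - p.qV)))

theorem Params.Valid.firstMomentError_nonneg {p : Params} (h : p.Valid) :
    0 ≤ firstMomentError p :=
  mul_nonneg (div_nonneg h.qM_nonneg (by linarith [h.qM_nonneg])) (Real.sqrt_nonneg _)

theorem secondMomentFactor_nonneg (p : Params) : 0 ≤ secondMomentFactor p := by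
  unfold secondMomentFactor
  positivity

/-- The main term on the left of the pathwise bound. -/
def mainTerm {ι : Type*} [Fintype ι] (p : Params) (X : ℝ) (D g : ℕ → ι → ℝ) (t : ℕ) : ℝ :=
  ∑ i, ∑ k ∈ Finset.range (t + 1), p.β₁ ^ k *
    (D (t - k) i * g (t - k) i / √(majorant p.β₂ p.ε X (fun j => g j i ^ 2) (t - k) k) -
      D (t - k) i ^ 2 / (4 * √(majorant p.β₂ p.ε X (fun j => g j i ^ 2) (t - k) k)))

namespace IsTrajectory

variable {ι : Type*} {p : Params} {QM QV : ℝ → ℝ} {W : ℕ → EuclideanSpace ℝ ι}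
  {g M V : ℕ → ι → ℝ}

theorem le_inner_update (h : IsTrajectory p QM QV W g M V) (hp : p.Valid)
    (hQM : IsQuantizer QM p.qM) (hQV : IsQuantizer QV p.qV) {D : ℝ} {R : ℝ} (hD : |D| ≤ R)
    (i : ι) (t : ℕ) :
    D * (expSum p.β₁ (fun j => g j i) t /
        √(p.ε + expSum p.β₂ (fun j => g j i ^ 2) t)) -
      R * (firstMomentError p + secondMomentFactor p * (1 - (1 - p.qV) ^ t)) ≤
    D * (M t i / √(V t i + p.ε)) := by
  have h1 := (h.moments i).abs_update_sub_le hQM hQV hp.β₁_nonneg hp.β₂_pos.le hp.qV_lt.le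
    hp.ratio_lt' hp.ε_pos t
  rw [← ratio_eq] at h1
  change _ ≤ firstMomentError p + secondMomentFactor p * (1 - (1 - p.qV) ^ t) at h1
  have h2 := mul_le_mul hD h1 (abs_nonneg _) ((abs_nonneg _).trans hD)
  rw [← abs_mul] at h2
  have h3 := (abs_le.1 h2).1
  linarith

variable [Fintype ι]

theorem norm_step_sq (h : IsTrajectory p QM QV W g M V) (hp : p.Valid)
    (hQV : IsQuantizer QV p.qV) (t : ℕ) : ‖W (t + 1) - W t‖ ^ 2 =
      stepSize p (t + 1) ^ 2 * ∑ i, M t i ^ 2 / (V t i + p.ε) := by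
  rw [EuclideanSpace.norm_sq_eq, Finset.mul_sum]
  refine Finset.sum_congr rfl fun i _ => ?_
  have hV := (h.moments i).V_nonneg hQV hp.β₂_pos.le hp.qV_lt.le t
  have := hp.ε_pos
  rw [PiLp.sub_apply, h.step, Real.norm_eq_abs, sq_abs, sub_sub_cancel_left, neg_sq, mul_pow,
    div_pow, Real.sq_sqrt (by positivity)]

theorem norm_step_sq_le (h : IsTrajectory p QM QV W g M V) (hp : p.Valid)
    (hQV : IsQuantizer QV p.qV) (t : ℕ) : ‖W (t + 1) - W t‖ ^ 2 ≤
      maxStep p ^ 2 * ∑ i, M t i ^ 2 / (V t i + p.ε) := by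
  rw [h.norm_step_sq hp hQV]
  have h1 := hp.stepSize_nonneg (t + 1)
  have h2 := hp.stepSize_le (t + 1)
  have h3 : 0 ≤ ∑ i, M t i ^ 2 / (V t i + p.ε) := by
    refine Finset.sum_nonneg fun i _ => div_nonneg (sq_nonneg _) ?_
    have hV := (h.moments i).V_nonneg hQV hp.β₂_pos.le hp.qV_lt.le t
    linarith [hp.ε_pos]
  gcongr

theorem sum_norm_step_sq_le (h : IsTrajectory p QM QV W g M V) (hp : p.Valid)
    (hQM : IsQuantizer QM p.qM) (hQV : IsQuantizer QV p.qV) {X : ℝ}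
    (hX : ∀ t i, g t i ^ 2 ≤ X) (T : ℕ) :
    ∑ t ∈ Finset.range T, ‖W (t + 1) - W t‖ ^ 2 ≤
      maxStep p ^ 2 * (Fintype.card ι * (momentFactor p *
        logTerm (p.β₂ * (1 - p.qV)) p.ε X T)) := by
  refine (Finset.sum_le_sum fun t _ => h.norm_step_sq_le hp hQV t).trans ?_
  rw [← Finset.mul_sum, Finset.sum_comm]
  refine mul_le_mul_of_nonneg_left ?_ (sq_nonneg _)
  refine (Finset.sum_le_card_nsmul _ _ _ fun i _ => (h.moments i).sum_sq_M_div_le hQM hQV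
    hp.β₁_nonneg hp.β₂_pos.le hp.qV_lt.le hp.rate_lt (hp.rate_le.trans_lt hp.β₂_lt) hp.ε_pos
    (fun t => hX t i) T).trans ?_
  simp [momentFactor, Finset.card_univ]

theorem norm_step_le (h : IsTrajectory p QM QV W g M V) (hp : p.Valid)
    (hQM : IsQuantizer QM p.qM) (hQV : IsQuantizer QV p.qV) (t : ℕ) :
    ‖W (t + 1) - W t‖ ≤ maxStep p * √(Fintype.card ι) / √(1 - ratio p) := by
  have hr : 0 < 1 - ratio p := by linarith [hp.ratio_lt_one]
  have hm := hp.maxStep_nonneg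
  refine (abs_le_of_sq_le_sq' ?_ (by positivity)).2
  refine (h.norm_step_sq_le hp hQV t).trans ?_
  rw [div_pow, mul_pow, Real.sq_sqrt (Nat.cast_nonneg _), Real.sq_sqrt hr.le, mul_div_assoc]
  refine mul_le_mul_of_nonneg_left ?_ (sq_nonneg _)
  refine (Finset.sum_le_card_nsmul Finset.univ _ (1 / (1 - ratio p)) fun i _ => ?_).trans ?_
  · have hV := (h.moments i).V_nonneg hQV hp.β₂_pos.le hp.qV_lt.le t
    have hε := hp.ε_pos
    have := (h.moments i).sq_M_le hQM hQV hp.β₁_nonneg hp.β₂_pos.le hp.qV_lt.le hp.ratio_lt' t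
    rw [← ratio_eq] at this
    rw [div_le_iff₀ (by positivity)]
    refine this.trans ?_
    gcongr
    linarith
  · rw [nsmul_eq_mul, Finset.card_univ, mul_one_div]

theorem norm_le (h : IsTrajectory p QM QV W g M V) (hp : p.Valid)
    (hQM : IsQuantizer QM p.qM) (hQV : IsQuantizer QV p.qV) (t : ℕ) :
    ‖W t‖ ≤ ‖W 0‖ + t * (maxStep p * √(Fintype.card ι) / √(1 - ratio p)) := by
  induction t with
  | zero => simp
  | succ t ih =>
    have h1 := h.norm_step_le hp hQM hQV t
    have h2 := norm_le_norm_add_norm_sub' (W (t + 1)) (W t)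
    push_cast
    linarith

/-- A deterministic statement about any driving sequence with bounded entries; probability enters
later, and only through `mainTerm`. The right side collects the decrease of `F`, the quantization
error of the moments, the normalized squares, and the squared steps from smoothness, directly and
through gradient drift. -/
theorem sum_mainTerm_le (h : IsTrajectory p QM QV W g M V) (hp : p.Valid)
    (hQM : IsQuantizer QM p.qM) (hQV : IsQuantizer QV p.qV) {X A R L Fmin : ℝ}
    (hX : ∀ t i, g t i ^ 2 ≤ X) (hA : 0 < A) (hXA : p.ε + X ≤ A ^ 2) (hL0 : 0 ≤ L)
    {F : EuclideanSpace ℝ ι → ℝ} (hF : Differentiable ℝ F)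
    (hL : ∀ x y, ‖gradient F x - gradient F y‖ ≤ L * ‖x - y‖)
    (hR : ∀ x i, |gradient F x i| ≤ R) (hFmin : ∀ x, Fmin ≤ F x) (T : ℕ) :
    ∑ t ∈ Finset.range T, stepSize p (t + 1) *
        mainTerm p X (fun j i => gradient F (W j) i) g t ≤
      F (W 0) - Fmin +
      maxStep p * (Fintype.card ι * R *
        (T * firstMomentError p + secondMomentFactor p * (T - geomSum p.qV T))) +
      maxStep p * (2 * A / (√(1 - p.β₁) * (1 - p.β₁ / p.β₂) ^ (3 / 2 : ℝ)) *
        (Fintype.card ι * logTerm (p.β₂ * (1 - p.qV)) p.ε X T)) +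
      (L / 2 * maxStep p ^ 2 + maxStep p ^ 3 * L ^ 2 * p.β₁ / (2 * A * (1 - p.β₁) ^ 2)) *
        (Fintype.card ι * (momentFactor p * logTerm (p.β₂ * (1 - p.qV)) p.ε X T)) := by
  set Λ := logTerm (p.β₂ * (1 - p.qV)) p.ε X T with hΛ
  set D : ℕ → ι → ℝ := fun j i => gradient F (W j) i with hD
  set d : ℝ := (Fintype.card ι : ℝ) with hd
  set a := p.β₁ / p.β₂ with ha
  have hβ₂ := hp.β₂_pos
  have hβ₁ := hp.β₁_nonneg
  have h1β₁ : 0 < 1 - p.β₁ := by linarith [hp.β₁_lt]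
  have ha0 : 0 ≤ a := by positivity
  have ha1 : a < 1 := (div_lt_one hβ₂).2 hp.β₁_lt_β₂
  have hβa : p.β₁ ≤ a := by
    rw [ha, le_div_iff₀ hβ₂]
    exact mul_le_of_le_one_right hβ₁ hp.β₂_lt.le
  set err : ℕ → ℝ := fun t =>
    firstMomentError p + secondMomentFactor p * (1 - (1 - p.qV) ^ t) with herr
  set U : ℕ → ι → ℝ := fun j i => g j i ^ 2 / (p.ε + expSum p.β₂ (fun j => g j i ^ 2) j) with hU
  set c : ℕ → ℝ := fun k => p.β₁ ^ k * ((1 - p.β₁) / (4 * A)) with hc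
  set w : ℕ → ℝ := fun k => a ^ k * lagWeight a p.β₁ A k with hw
  have hc0 : ∀ k, 0 ≤ c k := fun k => by simp only [hc]; positivity
  have hU0 : ∀ j i, 0 ≤ U j i := fun j i => by
    have := expSum_nonneg hβ₂.le (x := fun j => g j i ^ 2) (fun j => sq_nonneg _) j
    have := hp.ε_pos
    simp only [hU]
    positivity
  have hw0 : ∀ k, 0 ≤ w k := fun k => by
    simp only [hw, lagWeight]
    positivity
  have hstep : ∀ t, stepSize p (t + 1) * mainTerm p X D g t ≤ F (W t) - F (W (t + 1)) +
      maxStep p * (d * R * err t + ∑ i, ∑ k ∈ Finset.range (t + 1), w k * U (t - k) i +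
        ∑ k ∈ Finset.range (t + 1), c k * (L ^ 2 * ‖W t - W (t - k)‖ ^ 2)) +
      L / 2 * ‖W (t + 1) - W t‖ ^ 2 := by
    intro t
    have hdesc := le_add_inner_gradient_add hF hL (W t) (W (t + 1) - W t)
    rw [add_sub_cancel] at hdesc
    have hinner : inner ℝ (gradient F (W t)) (W (t + 1) - W t) =
        -(stepSize p (t + 1) * ∑ i, D t i * (M t i / √(V t i + p.ε))) := by
      rw [PiLp.inner_apply, Finset.mul_sum, ← Finset.sum_neg_distrib]
      refine Finset.sum_congr rfl fun i _ => ?_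
      rw [PiLp.sub_apply, h.step, sub_sub_cancel_left]
      simp only [RCLike.inner_apply, conj_trivial, hD]
      ring
    have hlow : mainTerm p X D g t - (d * R * err t +
        ∑ i, ∑ k ∈ Finset.range (t + 1), w k * U (t - k) i +
        ∑ i, ∑ k ∈ Finset.range (t + 1), c k * (D t i - D (t - k) i) ^ 2) ≤
        ∑ i, D t i * (M t i / √(V t i + p.ε)) := by
      have hcard : d * R * err t = ∑ _i : ι, R * err t := by
        rw [Finset.sum_const, Finset.card_univ, nsmul_eq_mul, mul_assoc]
      rw [hcard, mainTerm, ← Finset.sum_add_distrib, ← Finset.sum_add_distrib,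
        ← Finset.sum_sub_distrib]
      refine Finset.sum_le_sum fun i _ => ?_
      have h1 := h.le_inner_update hp hQM hQV (hR (W t) i) i t
      have h2 := momentum_descent hβ₁ hp.β₁_lt hβ₂ hp.β₂_lt.le hp.β₁_lt_β₂ hp.ε_pos hA hXA
        (fun j => g j i) (fun j => D j i) (fun j => hX j i) t
      linarith
    have hsm : ∑ i, ∑ k ∈ Finset.range (t + 1), c k * (D t i - D (t - k) i) ^ 2 ≤
        ∑ k ∈ Finset.range (t + 1), c k * (L ^ 2 * ‖W t - W (t - k)‖ ^ 2) := by
      rw [Finset.sum_comm]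
      refine Finset.sum_le_sum fun k _ => ?_
      rw [← Finset.mul_sum, ← mul_pow]
      refine mul_le_mul_of_nonneg_left ?_ (hc0 k)
      have h1 : ∑ i, (D t i - D (t - k) i) ^ 2 =
          ‖gradient F (W t) - gradient F (W (t - k))‖ ^ 2 := by
        rw [EuclideanSpace.norm_sq_eq]
        simp [hD]
      rw [h1]
      exact pow_le_pow_left₀ (norm_nonneg _) (hL _ _) 2
    -- Nonnegativity allows the varying step size in front of the errors to be replaced by `maxStep
    -- p`; the main term keeps its exact step size.
    have hE0 : 0 ≤ d * R * err t + ∑ i, ∑ k ∈ Finset.range (t + 1), w k * U (t - k) i +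
        ∑ k ∈ Finset.range (t + 1), c k * (L ^ 2 * ‖W t - W (t - k)‖ ^ 2) := by
      have hdR : 0 ≤ d * R := by
        rcases isEmpty_or_nonempty ι with hι | ⟨⟨i⟩⟩
        · simp [hd]
        · exact mul_nonneg (Nat.cast_nonneg _) ((abs_nonneg _).trans (hR (W t) i))
      have h1 : 0 ≤ ∑ i, ∑ k ∈ Finset.range (t + 1), w k * U (t - k) i :=
        Finset.sum_nonneg fun i _ => Finset.sum_nonneg fun k _ => mul_nonneg (hw0 k) (hU0 _ i)
      have h2 : 0 ≤ ∑ k ∈ Finset.range (t + 1), c k * (L ^ 2 * ‖W t - W (t - k)‖ ^ 2) :=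
        Finset.sum_nonneg fun k _ => mul_nonneg (hc0 k) (by positivity)
      have h3 : 0 ≤ err t := by
        have := hp.firstMomentError_nonneg
        have h4 := secondMomentFactor_nonneg p
        have h5 : (1 - p.qV) ^ t ≤ 1 :=
          pow_le_one₀ (by linarith [hp.qV_lt]) (by linarith [hp.qV_nonneg])
        have := mul_nonneg h4 (sub_nonneg.2 h5)
        simp only [herr]
        linarith
      have := mul_nonneg hdR h3
      linarith
    have hs0 := hp.stepSize_nonneg (t + 1)
    have h1 := mul_le_mul_of_nonneg_left hlow hs0
    have h2 := mul_le_mul_of_nonneg_left hsm hs0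
    have h3 := mul_le_mul_of_nonneg_right (hp.stepSize_le (t + 1)) hE0
    rw [hinner] at hdesc
    linarith
  -- The errors carry exponents `0, …, T - 1` while `geomSum` runs over `1, …, T`; shifting the
  -- exponent up by one only weakens the bound.
  have hgeom : ∑ t ∈ Finset.range T, err t ≤
      T * firstMomentError p + secondMomentFactor p * (T - geomSum p.qV T) := by
    have h1 : (T : ℝ) - geomSum p.qV T = ∑ t ∈ Finset.range T, (1 - (1 - p.qV) ^ (t + 1)) := by
      rw [Finset.sum_sub_distrib, geomSum, Finset.range_eq_Ico,
        Finset.sum_Ico_add' (fun t => (1 - p.qV) ^ t) 0 T 1]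
      simp [Finset.Ico_add_one_right_eq_Icc]
    have h2 := secondMomentFactor_nonneg p
    simp only [herr]
    rw [Finset.sum_add_distrib, ← Finset.mul_sum, h1]
    simp only [Finset.sum_const, Finset.card_range, nsmul_eq_mul]
    refine add_le_add_right (mul_le_mul_of_nonneg_left (Finset.sum_le_sum fun t _ => ?_) h2) _
    have := pow_le_pow_of_le_one (show 0 ≤ 1 - p.qV by linarith [hp.qV_lt])
      (by linarith [hp.qV_nonneg]) (Nat.le_add_right t 1)
    linarith
  have hlag : ∑ t ∈ Finset.range T, ∑ i, ∑ k ∈ Finset.range (t + 1), w k * U (t - k) i ≤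
      2 * A / (√(1 - p.β₁) * (1 - a) ^ (3 / 2 : ℝ)) * (d * Λ) := by
    have h1 : ∀ i, ∑ j ∈ Finset.range T, U j i ≤ Λ := by
      intro i
      refine le_trans (Finset.sum_le_sum fun j _ => ?_) (sum_div_expSum_le hp.rate_pos
        (hp.rate_le.trans_lt hp.β₂_lt) hp.ε_pos (x := fun j => g j i ^ 2)
        (fun j => sq_nonneg _) (fun j => hX j i) T)
      have h2 := expSum_mono hp.rate_pos.le hp.rate_le (x := fun j => g j i ^ 2)
        (fun j => sq_nonneg _) j
      have h3 := expSum_nonneg hp.rate_pos.le (x := fun j => g j i ^ 2) (fun j => sq_nonneg _) j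
      have := hp.ε_pos
      simp only [hU]
      gcongr
    rw [Finset.sum_comm]
    refine (Finset.sum_le_card_nsmul Finset.univ _ (2 * A / (√(1 - p.β₁) *
      (1 - a) ^ (3 / 2 : ℝ)) * Λ) fun i _ => ?_).trans (le_of_eq ?_)
    · refine (sum_sum_lag_le hw0 (fun j => hU0 j i) T).trans ?_
      have h2 : 0 ≤ ∑ j ∈ Finset.range T, U j i := Finset.sum_nonneg fun j _ => hU0 j i
      have h3 := sum_lagWeight_le ha1 hβ₁ hβa hA.le T
      exact mul_le_mul h3 (h1 i) h2 ((Finset.sum_nonneg fun k _ => hw0 k).trans h3)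
    · rw [nsmul_eq_mul, Finset.card_univ]
      ring
  have hZ := h.sum_norm_step_sq_le hp hQM hQV hX T
  have hcc : ∑ t ∈ Finset.range T, ∑ k ∈ Finset.range (t + 1),
      c k * (L ^ 2 * ‖W t - W (t - k)‖ ^ 2) ≤ L ^ 2 * p.β₁ / (2 * A * (1 - p.β₁) ^ 2) *
        ∑ t ∈ Finset.range T, ‖W (t + 1) - W t‖ ^ 2 := by
    have h1 := sum_sum_lag_sq_norm_sub_le W (fun k => mul_nonneg (hc0 k) (sq_nonneg L)) T
    simp only [mul_assoc (c _)] at h1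
    refine h1.trans ?_
    refine mul_le_mul_of_nonneg_right ?_ (Finset.sum_nonneg fun t _ => sq_nonneg _)
    have h2 : ∑ k ∈ Finset.range T, c k * (L ^ 2 * (k : ℝ) ^ 2) =
        L ^ 2 * ((1 - p.β₁) / (4 * A)) * ∑ k ∈ Finset.range T, (k : ℝ) ^ 2 * p.β₁ ^ k := by
      rw [Finset.mul_sum]
      exact Finset.sum_congr rfl fun k _ => by simp only [hc]; ring
    rw [h2]
    calc _ ≤ L ^ 2 * ((1 - p.β₁) / (4 * A)) * (p.β₁ * (1 + p.β₁) / (1 - p.β₁) ^ 3) := by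
          gcongr
          exact sum_sq_mul_geom_le hβ₁ hp.β₁_lt T
      _ ≤ L ^ 2 * ((1 - p.β₁) / (4 * A)) * (p.β₁ * 2 / (1 - p.β₁) ^ 3) := by
          gcongr
          linarith [hp.β₁_lt]
      _ = _ := by field_simp; ring
  have hdR : 0 ≤ d * R := by
    rcases isEmpty_or_nonempty ι with hι | ⟨⟨i⟩⟩
    · simp [hd]
    · exact mul_nonneg (Nat.cast_nonneg _) ((abs_nonneg _).trans (hR (W 0) i))
  have hm0 := hp.maxStep_nonneg
  refine (Finset.sum_le_sum fun t _ => hstep t).trans ?_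
  rw [Finset.sum_add_distrib, Finset.sum_add_distrib, Finset.sum_range_sub', ← Finset.mul_sum,
    ← Finset.mul_sum, Finset.sum_add_distrib, Finset.sum_add_distrib, ← Finset.mul_sum]
  set Z := ∑ t ∈ Finset.range T, ‖W (t + 1) - W t‖ ^ 2
  have h1 := hFmin (W T)
  have h2 := mul_le_mul_of_nonneg_left (mul_le_mul_of_nonneg_left hgeom hdR) hm0
  have h3 := mul_le_mul_of_nonneg_left hlag hm0
  have hK : 0 ≤ L ^ 2 * p.β₁ / (2 * A * (1 - p.β₁) ^ 2) := by positivity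
  have h4 := mul_le_mul_of_nonneg_left (hcc.trans (mul_le_mul_of_nonneg_left hZ hK)) hm0
  have h5 := mul_le_mul_of_nonneg_left hZ (show 0 ≤ L / 2 by linarith)
  rw [mul_add, mul_add]
  refine (add_le_add (add_le_add (sub_le_sub_left h1 _)
    (add_le_add (add_le_add h2 h3) h4)) h5).trans (le_of_eq ?_)
  ring

end IsTrajectory

/-! ### Measurability and causality of the iterates -/

section Run

variable {m n B : ℕ} {Ξ : Type*}

/-- Causality: the state before step `t` is determined by the batches `0, …, t - 1`. This is what
makes the current batch independent of the weights. -/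
theorem run_congr (f : Mat m n → Ξ → ℝ) (Q : Quantizers) (p : Params) (W₀ : Mat m n)
    {s s' : ℕ → Fin B → Ξ} (t : ℕ) (h : ∀ j < t, s j = s' j) :
    run f Q p W₀ s t = run f Q p W₀ s' t := by
  induction t with
  | zero => rfl
  | succ t ih =>
    have h1 := ih fun j hj => h j (hj.trans (Nat.lt_succ_self t))
    have h2 := h t (Nat.lt_succ_self t)
    simp only [run, h1, h2]

/-- The stochastic gradient used in step `t`. -/
def runGrad (f : Mat m n → Ξ → ℝ) (Q : Quantizers) (p : Params) (W₀ : Mat m n)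
    (s : ℕ → Fin B → Ξ) (t : ℕ) : Mat m n :=
  batchGrad f Q (run f Q p W₀ s t).W (s t)

theorem runGrad_congr (f : Mat m n → Ξ → ℝ) (Q : Quantizers) (p : Params) (W₀ : Mat m n)
    {s s' : ℕ → Fin B → Ξ} (t : ℕ) (h : ∀ j < t + 1, s j = s' j) :
    runGrad f Q p W₀ s t = runGrad f Q p W₀ s' t := by
  rw [runGrad, runGrad, run_congr f Q p W₀ t fun j hj => h j (hj.trans (Nat.lt_succ_self t)),
    h t (Nat.lt_succ_self t)]

/-- The state after `t + 1` updates stores the moments computed in step `t`, hence the shift of `M`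
and `V` against `W`. -/
theorem run_isTrajectory (f : Mat m n → Ξ → ℝ) (Q : Quantizers) (p : Params) (W₀ : Mat m n)
    (s : ℕ → Fin B → Ξ) :
    IsTrajectory p Q.QM Q.QV (fun t => (run f Q p W₀ s t).W) (fun t i => runGrad f Q p W₀ s t i)
      (fun t i => (run f Q p W₀ s (t + 1)).M i) (fun t i => (run f Q p W₀ s (t + 1)).V i) where
  moments i :=
    { M_zero := by simp [run, runGrad]
      M_succ := fun t => by
        rw [run]
        simp [runGrad, quantize]
      V_zero := by simp [run, runGrad]
      V_succ := fun t => by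
        rw [run]
        simp [runGrad, quantize] }
  step t i := by
    simp only [run]
    simp

theorem runGrad_coord (f : Mat m n → Ξ → ℝ) (Q : Quantizers) (p : Params) (W₀ : Mat m n)
    (s : ℕ → Fin B → Ξ) (t : ℕ) (i : Fin m × Fin n) : runGrad f Q p W₀ s t i =
      1 / (B : ℝ) * ∑ l, Q.QG (stochGrad f (quantize Q.QW (run f Q p W₀ s t).W) (s t l) i) := by
  simp [runGrad, batchGrad, quantize]

theorem run_succ_M (f : Mat m n → Ξ → ℝ) (Q : Quantizers) (p : Params) (W₀ : Mat m n)
    (s : ℕ → Fin B → Ξ) (t : ℕ) : (run f Q p W₀ s (t + 1)).M =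
      if t = 0 then runGrad f Q p W₀ s t
      else p.β₁ • quantize Q.QM (run f Q p W₀ s t).M + runGrad f Q p W₀ s t := rfl

theorem run_succ_V (f : Mat m n → Ξ → ℝ) (Q : Quantizers) (p : Params) (W₀ : Mat m n)
    (s : ℕ → Fin B → Ξ) (t : ℕ) : (run f Q p W₀ s (t + 1)).V =
      if t = 0 then WithLp.toLp 2 (fun i => runGrad f Q p W₀ s t i ^ 2)
      else p.β₂ • quantize Q.QV (run f Q p W₀ s t).V +
        WithLp.toLp 2 (fun i => runGrad f Q p W₀ s t i ^ 2) := rfl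

theorem measurable_mat {α : Type*} [MeasurableSpace α] {X : α → Mat m n}
    (h : ∀ i, Measurable fun a => X a i) : Measurable X :=
  (WithLp.measurable_toLp 2 _).comp (measurable_pi_lambda _ h)

theorem measurable_coord (i : Fin m × Fin n) : Measurable fun W : Mat m n => W i :=
  (measurable_pi_apply i).comp (WithLp.measurable_ofLp 2 _)

variable [MeasurableSpace Ξ]

theorem measurable_quantize {Q : ℝ → ℝ} (hQ : Measurable Q) :
    Measurable (quantize Q : Mat m n → Mat m n) :=
  measurable_mat fun i => hQ.comp (measurable_coord i)

theorem measurable_batchGrad {f : Mat m n → Ξ → ℝ} {Q : Quantizers}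
    (hf : Measurable (fun p : Mat m n × Ξ => stochGrad f p.1 p.2)) (hQW : Measurable Q.QW)
    (hQG : Measurable Q.QG) {α : Type*} [MeasurableSpace α] {W : α → Mat m n}
    {b : α → Fin B → Ξ} (hW : Measurable W) (hb : Measurable b) :
    Measurable fun a => batchGrad f Q (W a) (b a) := by
  have h1 : ∀ i, Measurable fun a =>
      quantize Q.QG (stochGrad f (quantize Q.QW (W a)) (b a i)) := fun i =>
    (measurable_quantize hQG).comp (hf.comp
      (((measurable_quantize hQW).comp hW).prodMk ((measurable_pi_apply i).comp hb)))
  refine measurable_mat fun i => ?_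
  simp only [batchGrad, PiLp.smul_apply, WithLp.ofLp_sum, Finset.sum_apply, smul_eq_mul]
  exact (Finset.measurable_fun_sum _ fun j _ => (measurable_coord i).comp (h1 j)).const_mul _

theorem measurable_run {f : Mat m n → Ξ → ℝ} {Q : Quantizers} (p : Params) (W₀ : Mat m n)
    (hf : Measurable (fun p : Mat m n × Ξ => stochGrad f p.1 p.2)) (hQW : Measurable Q.QW)
    (hQG : Measurable Q.QG) (hQM : Measurable Q.QM) (hQV : Measurable Q.QV) (t : ℕ) :
    Measurable (fun s : ℕ → Fin B → Ξ => (run f Q p W₀ s t).W) ∧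
    Measurable (fun s : ℕ → Fin B → Ξ => (run f Q p W₀ s t).M) ∧
    Measurable (fun s : ℕ → Fin B → Ξ => (run f Q p W₀ s t).V) := by
  induction t with
  | zero => exact ⟨measurable_const, measurable_const, measurable_const⟩
  | succ t ih =>
    obtain ⟨hW, hM, hV⟩ := ih
    have hG : Measurable fun s : ℕ → Fin B → Ξ => runGrad f Q p W₀ s t :=
      measurable_batchGrad hf hQW hQG hW (measurable_pi_apply t)
    have hGi := fun i => (measurable_coord i).comp hG
    have hM' : Measurable (fun s : ℕ → Fin B → Ξ => (run f Q p W₀ s (t + 1)).M) := by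
      simp only [run_succ_M]
      split_ifs
      · exact hG
      · refine measurable_mat fun i => ?_
        exact ((hQM.comp ((measurable_coord i).comp hM)).const_mul _).add (hGi i)
    have hV' : Measurable (fun s : ℕ → Fin B → Ξ => (run f Q p W₀ s (t + 1)).V) := by
      simp only [run_succ_V]
      split_ifs
      · exact measurable_mat fun i => (hGi i).pow_const 2
      · refine measurable_mat fun i => ?_
        exact ((hQV.comp ((measurable_coord i).comp hV)).const_mul _).add ((hGi i).pow_const 2)
    refine ⟨measurable_mat fun i => ?_, hM', hV'⟩
    have h1 := fun s => (run_isTrajectory f Q p W₀ (B := B) s).step t i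
    simp only [h1]
    exact ((measurable_coord i).comp hW).sub ((((measurable_coord i).comp hM').div
      ((((measurable_coord i).comp hV').add_const _).sqrt)).const_mul _)

theorem measurable_runGrad {f : Mat m n → Ξ → ℝ} {Q : Quantizers} (p : Params) (W₀ : Mat m n)
    (hf : Measurable (fun p : Mat m n × Ξ => stochGrad f p.1 p.2)) (hQW : Measurable Q.QW)
    (hQG : Measurable Q.QG) (hQM : Measurable Q.QM) (hQV : Measurable Q.QV) (t : ℕ) :
    Measurable fun s : ℕ → Fin B → Ξ => runGrad f Q p W₀ s t :=
  measurable_batchGrad hf hQW hQG (measurable_run p W₀ hf hQW hQG hQM hQV t).1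
    (measurable_pi_apply t)

end Run

/-! ### Independence of the next sample from the past -/

section Indep

variable {B : ℕ} {Ξ Ω β : Type*} [MeasurableSpace Ξ] [MeasurableSpace Ω] [MeasurableSpace β]
  {μ : Measure Ω} {ξ : ℕ → Fin B → Ω → Ξ}

/-- A functional that sees only batches before `t` factors through finitely many samples, so
independence of disjoint finite blocks applies. -/
theorem indepFun_past (hξ : ∀ t i, Measurable (ξ t i))
    (hind : iIndepFun (fun k : ℕ × Fin B => ξ k.1 k.2) μ) [Nonempty Ξ]
    {Φ : (ℕ → Fin B → Ξ) → β} (hΦ : Measurable Φ) (t : ℕ)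
    (hpast : ∀ s s' : ℕ → Fin B → Ξ, (∀ j < t, s j = s' j) → Φ s = Φ s') (i : Fin B) :
    IndepFun (fun ω => Φ fun t i => ξ t i ω) (ξ t i) μ := by
  classical
  set S : Finset (ℕ × Fin B) := Finset.range t ×ˢ Finset.univ with hS
  have hdisj : Disjoint S {(t, i)} := by simp [hS]
  have h := hind.indepFun_finset S {(t, i)} hdisj fun k => hξ k.1 k.2
  -- Unseen samples are filled with an arbitrary point; `hpast` makes the choice irrelevant.
  let x₀ : Ξ := Classical.arbitrary Ξ
  let ext : (S → Ξ) → ℕ → Fin B → Ξ := fun y j l => if h : (j, l) ∈ S then y ⟨(j, l), h⟩ else x₀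
  have hext : Measurable ext := by
    refine measurable_pi_lambda _ fun j => measurable_pi_lambda _ fun l => ?_
    by_cases h : (j, l) ∈ S
    · simp only [ext, h, dite_true]
      exact measurable_pi_apply _
    · simp only [ext, h, dite_false]
      exact measurable_const
  have h2 := h.comp (hΦ.comp hext)
    (measurable_pi_apply (⟨(t, i), Finset.mem_singleton_self _⟩ : ({(t, i)} : Finset _)))
  refine h2.congr (Filter.Eventually.of_forall fun ω => ?_) (Filter.Eventually.of_forall fun ω => rfl)
  refine hpast _ _ fun j hj => funext fun l => ?_
  have : (j, l) ∈ S := by simp [hS, hj]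
  simp [ext, this]

variable {X : Ω → β} {Y : Ω → Ξ} {P : Measure Ξ}

/-- The gradient bound holds almost surely for each fixed `W`, with an exceptional set depending on
`W`. For random weights independent of the sample, Fubini on the product law restores it. -/
theorem ae_of_indepFun [IsFiniteMeasure μ] (hX : Measurable X) (hY : Measurable Y)
    (hXY : IndepFun X Y μ) (hP : μ.map Y = P) {q : β → Ξ → Prop}
    (hq : MeasurableSet {z : β × Ξ | q z.1 z.2}) (h : ∀ x, ∀ᵐ y ∂P, q x y) :
    ∀ᵐ ω ∂μ, q (X ω) (Y ω) := by
  have h1 := (indepFun_iff_map_prod_eq_prod_map_map hX.aemeasurable hY.aemeasurable).1 hXY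
  rw [hP] at h1
  have : IsFiniteMeasure P := hP ▸ inferInstance
  have h2 : ∀ᵐ z ∂(μ.map fun ω => (X ω, Y ω)), q z.1 z.2 := by
    rw [h1, Measure.ae_prod_iff_ae_ae hq]
    exact Filter.Eventually.of_forall h
  exact (ae_map_iff (hX.prodMk hY).aemeasurable hq).1 h2

/-- Plays the role of conditioning on the past: the fresh sample is integrated out under its own
law. -/
theorem integral_of_indepFun [IsFiniteMeasure μ] (hX : Measurable X) (hY : Measurable Y)
    (hXY : IndepFun X Y μ) (hP : μ.map Y = P) {ψ : β → Ξ → ℝ}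
    (hψ : Measurable fun z : β × Ξ => ψ z.1 z.2)
    (hint : Integrable (fun ω => ψ (X ω) (Y ω)) μ) :
    ∫ ω, ψ (X ω) (Y ω) ∂μ = ∫ ω, (∫ y, ψ (X ω) y ∂P) ∂μ := by
  have h1 := (indepFun_iff_map_prod_eq_prod_map_map hX.aemeasurable hY.aemeasurable).1 hXY
  rw [hP] at h1
  have : IsFiniteMeasure P := hP ▸ inferInstance
  have hXYm := (hX.prodMk hY).aemeasurable (μ := μ)
  have h2 := integral_map (f := fun z : β × Ξ => ψ z.1 z.2) hXYm hψ.aestronglyMeasurable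
  have h3 : Integrable (fun z : β × Ξ => ψ z.1 z.2) ((μ.map X).prod P) := by
    rw [← h1]
    exact (integrable_map_measure hψ.aestronglyMeasurable hXYm).2 hint
  rw [← h2, h1, integral_prod _ h3,
    integral_map hX.aemeasurable hψ.stronglyMeasurable.integral_prod_right.aestronglyMeasurable]

end Indep

/-! ### Bias of the quantized stochastic gradient -/

theorem norm_quantize_sub_le {m n : ℕ} {Q : ℝ → ℝ} {q : ℝ} (hQ : IsQuantizer Q q) (W : Mat m n) :
    ‖quantize Q W - W‖ ≤ q * ‖W‖ := by
  have hq := hQ.nonneg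
  refine (abs_le_of_sq_le_sq' ?_ (by positivity)).2
  rw [mul_pow, EuclideanSpace.norm_sq_eq, EuclideanSpace.norm_sq_eq, Finset.mul_sum]
  refine Finset.sum_le_sum fun i _ => ?_
  rw [← mul_pow]
  exact pow_le_pow_left₀ (norm_nonneg _) (hQ.rel_error (W i)) 2

/-- The mean of the quantized stochastic gradient at the quantized weights. -/
def gradMean {m n : ℕ} {Ξ : Type*} [MeasurableSpace Ξ] (f : Mat m n → Ξ → ℝ) (P : Measure Ξ)
    (Q : Quantizers) (W : Mat m n) (i : Fin m × Fin n) : ℝ :=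
  ∫ x, Q.QG (stochGrad f (quantize Q.QW W) x i) ∂P

namespace ProblemAssumptions

variable {m n : ℕ} {Ξ : Type*} [MeasurableSpace Ξ] {f : Mat m n → Ξ → ℝ} {P : Measure Ξ}
  {ε R L : ℝ}

theorem measurable_stochGrad (h : ProblemAssumptions f P ε R L) (W : Mat m n) :
    Measurable fun x => stochGrad f W x :=
  h.measurable_grad.comp (measurable_const.prodMk measurable_id)

theorem integrable_stochGrad_coord (h : ProblemAssumptions f P ε R L) (W : Mat m n)
    (i : Fin m × Fin n) : Integrable (fun x => stochGrad f W x i) P := by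
  have := h.prob
  refine Integrable.of_bound
    ((measurable_coord i).comp (h.measurable_stochGrad W)).aestronglyMeasurable (R - √ε) ?_
  filter_upwards [h.grad_bound W] with x hx using hx i

theorem integrable_stochGrad (h : ProblemAssumptions f P ε R L) (W : Mat m n) :
    Integrable (fun x => stochGrad f W x) P := by
  have := h.prob
  refine Integrable.of_bound (h.measurable_stochGrad W).aestronglyMeasurable
    (√(∑ _i : Fin m × Fin n, (R - √ε) ^ 2)) ?_
  filter_upwards [h.grad_bound W] with x hx
  rw [EuclideanSpace.norm_eq]
  refine Real.sqrt_le_sqrt (Finset.sum_le_sum fun i _ => ?_)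
  exact pow_le_pow_left₀ (norm_nonneg _) (hx i) 2

theorem integral_stochGrad_coord (h : ProblemAssumptions f P ε R L) (W : Mat m n)
    (i : Fin m × Fin n) :
    ∫ x, stochGrad f W x i ∂P = gradient (objective f P) W i := by
  rw [← h.unbiased W]
  exact (EuclideanSpace.proj i : Mat m n →L[ℝ] ℝ).integral_comp_comm (h.integrable_stochGrad W)

theorem abs_gradient_le (h : ProblemAssumptions f P ε R L) (W : Mat m n) (i : Fin m × Fin n) :
    |gradient (objective f P) W i| ≤ R - √ε := by
  have := h.prob
  rw [← h.integral_stochGrad_coord]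
  have h1 := norm_integral_le_of_norm_le_const (μ := P) (f := fun x => stochGrad f W x i)
    (C := R - √ε) (by filter_upwards [h.grad_bound W] with x hx using hx i)
  simpa using h1

theorem measurable_gradient (h : ProblemAssumptions f P ε R L) (hL : 0 ≤ L) :
    Measurable (gradient (objective f P)) := by
  have : LipschitzWith L.toNNReal (gradient (objective f P)) :=
    LipschitzWith.of_dist_le_mul fun X Y => by
      rw [dist_eq_norm, dist_eq_norm, Real.coe_toNNReal L hL]
      exact h.smooth X Y
  exact this.continuous.measurable

theorem abs_quantized_le (h : ProblemAssumptions f P ε R L) {Q : Quantizers} {qG : ℝ}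
    (hQ : IsQuantizer Q.QG qG) (W : Mat m n) (i : Fin m × Fin n) :
    ∀ᵐ x ∂P, |Q.QG (stochGrad f (quantize Q.QW W) x i)| ≤ (1 + qG) * (R - √ε) := by
  have hq := hQ.nonneg
  filter_upwards [h.grad_bound (quantize Q.QW W)] with x hx
  exact (hQ.abs_le _).trans (mul_le_mul_of_nonneg_left (hx i) (by linarith))

/-- The bias has two sources: `Q_G` perturbs the sampled entries, and evaluation at the quantized
weights shifts the true gradient by smoothness. The second part grows with `‖W‖`, hence the need for
a bound on the weights. -/
theorem abs_gradMean_sub_le (h : ProblemAssumptions f P ε R L) (hL : 0 ≤ L) {Q : Quantizers}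
    {qG qW : ℝ} (hQG : IsQuantizer Q.QG qG) (hQW : IsQuantizer Q.QW qW) (W : Mat m n)
    (i : Fin m × Fin n) :
    |gradMean f P Q W i - gradient (objective f P) W i| ≤ qG * (R - √ε) + L * (qW * ‖W‖) := by
  have := h.prob
  set W' := quantize Q.QW W with hW'
  have hm : Measurable fun x => stochGrad f W' x i :=
    (measurable_coord i).comp (h.measurable_stochGrad W')
  have hint : Integrable (fun x => Q.QG (stochGrad f W' x i)) P :=
    Integrable.of_bound (hQG.measurable.comp hm).aestronglyMeasurable _ (h.abs_quantized_le hQG W i)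
  have h1 : |gradMean f P Q W i - gradient (objective f P) W' i| ≤ qG * (R - √ε) := by
    rw [gradMean, ← h.integral_stochGrad_coord,
      ← integral_sub hint (h.integrable_stochGrad_coord W' i)]
    have h2 := norm_integral_le_of_norm_le_const (μ := P)
      (f := fun x => Q.QG (stochGrad f W' x i) - stochGrad f W' x i) (C := qG * (R - √ε)) (by
        filter_upwards [h.grad_bound W'] with x hx
        exact (hQG.rel_error _).trans (mul_le_mul_of_nonneg_left (hx i) hQG.nonneg))
    simpa using h2
  have h2 : |gradient (objective f P) W' i - gradient (objective f P) W i| ≤ L * (qW * ‖W‖) := by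
    have h3 := PiLp.norm_apply_le (gradient (objective f P) W' - gradient (objective f P) W) i
    rw [PiLp.sub_apply] at h3
    exact h3.trans ((h.smooth W' W).trans
      (mul_le_mul_of_nonneg_left (norm_quantize_sub_le hQW W) hL))
  have h3 := abs_add_le (gradMean f P Q W i - gradient (objective f P) W' i)
    (gradient (objective f P) W' i - gradient (objective f P) W i)
  rw [sub_add_sub_cancel] at h3
  linarith

end ProblemAssumptions

/-! ### Expectations along the run -/

namespace Setting

variable {m n B : ℕ} {Ξ Ω : Type*} [MeasurableSpace Ξ] [MeasurableSpace Ω] {p : Params}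
  {R L D : ℝ} {T : ℕ} {f : Mat m n → Ξ → ℝ} {P : Measure Ξ} {W₀ : Mat m n} {Q : Quantizers}
  {μ : Measure Ω} {ξ : ℕ → Fin B → Ω → Ξ} {τ : Ω → ℕ}

theorem measurable_path (h : Setting p R L D T f P W₀ Q μ ξ τ) :
    Measurable fun ω t i => ξ t i ω :=
  measurable_pi_lambda _ fun t => measurable_pi_lambda _ fun i => h.sample_measurable t i

theorem measurable_W (h : Setting p R L D T f P W₀ Q μ ξ τ) (t : ℕ) :
    Measurable fun s : ℕ → Fin B → Ξ => (run f Q p W₀ s t).W :=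
  (measurable_run p W₀ h.problem.measurable_grad h.quantW.measurable h.quantG.measurable
    h.quantM.measurable h.quantV.measurable t).1

theorem measurable_grad (h : Setting p R L D T f P W₀ Q μ ξ τ) (t : ℕ) :
    Measurable fun s : ℕ → Fin B → Ξ => runGrad f Q p W₀ s t :=
  measurable_runGrad p W₀ h.problem.measurable_grad h.quantW.measurable h.quantG.measurable
    h.quantM.measurable h.quantV.measurable t

theorem nonempty_sample (h : Setting p R L D T f P W₀ Q μ ξ τ) : Nonempty Ξ := by
  have := h.problem.prob
  exact nonempty_of_isProbabilityMeasure P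

theorem measurable_quantGrad (h : Setting p R L D T f P W₀ Q μ ξ τ) (i : Fin m × Fin n) :
    Measurable fun z : Mat m n × Ξ => Q.QG (stochGrad f (quantize Q.QW z.1) z.2 i) :=
  h.quantG.measurable.comp ((measurable_coord i).comp (h.problem.measurable_grad.comp
    (((measurable_quantize h.quantW.measurable).comp measurable_fst).prodMk measurable_snd)))

theorem ae_abs_sample_le (h : Setting p R L D T f P W₀ Q μ ξ τ) (t : ℕ) (l : Fin B)
    (i : Fin m × Fin n) :
    ∀ᵐ ω ∂μ, |Q.QG (stochGrad f (quantize Q.QW (run f Q p W₀ (fun t i => ξ t i ω) t).W)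
      (ξ t l ω) i)| ≤ (1 + p.qG) * (R - √p.ε) := by
  have := h.prob
  have := h.nonempty_sample
  refine ae_of_indepFun ((h.measurable_W t).comp h.measurable_path) (h.sample_measurable t l)
    (indepFun_past h.sample_measurable h.sample_indep (h.measurable_W t) t
      (fun s s' hs => by rw [run_congr f Q p W₀ t hs]) l) (h.sample_law t l)
    (q := fun W x => |Q.QG (stochGrad f (quantize Q.QW W) x i)| ≤ (1 + p.qG) * (R - √p.ε))
    (measurableSet_le (h.measurable_quantGrad i).abs measurable_const) fun W => ?_
  exact h.problem.abs_quantized_le h.quantG W i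

theorem ae_abs_runGrad_le (h : Setting p R L D T f P W₀ Q μ ξ τ) :
    ∀ᵐ ω ∂μ, ∀ t i, |runGrad f Q p W₀ (fun t i => ξ t i ω) t i| ≤ (1 + p.qG) * (R - √p.ε) := by
  rw [ae_all_iff]
  intro t
  rw [ae_all_iff]
  intro i
  have h1 : ∀ᵐ ω ∂μ, ∀ l, |Q.QG (stochGrad f (quantize Q.QW
      (run f Q p W₀ (fun t i => ξ t i ω) t).W) (ξ t l ω) i)| ≤ (1 + p.qG) * (R - √p.ε) :=
    ae_all_iff.2 fun l => h.ae_abs_sample_le t l i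
  filter_upwards [h1] with ω hω
  have hB : (0 : ℝ) < B := Nat.cast_pos.2 h.B_pos
  rw [runGrad_coord, abs_mul, abs_of_pos (by positivity), one_div, inv_mul_le_iff₀ hB]
  refine (Finset.abs_sum_le_sum_abs _ _).trans ((Finset.sum_le_card_nsmul _ _ _
    fun l _ => hω l).trans ?_)
  simp

/-- Since `Φ` and the weights are functions of the past, each sample of batch `t` can be averaged
out separately. No independence between `Φ` and the weights is needed, and the batch mean has the
same expectation as a single sample. -/
theorem le_integral_mul_runGrad (h : Setting p R L D T f P W₀ Q μ ξ τ) (hL : 0 ≤ L) (t : ℕ)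
    (i : Fin m × Fin n) {Φ : (ℕ → Fin B → Ξ) → ℝ} (hΦ : Measurable Φ)
    (hpast : ∀ s s' : ℕ → Fin B → Ξ, (∀ j < t, s j = s' j) → Φ s = Φ s') {H N : ℝ}
    (hH : ∀ s, |Φ s| ≤ H) (hN : ∀ s : ℕ → Fin B → Ξ, ‖(run f Q p W₀ s t).W‖ ≤ N) :
    ∫ ω, Φ (fun t i => ξ t i ω) *
        gradient (objective f P) (run f Q p W₀ (fun t i => ξ t i ω) t).W i ∂μ -
      H * (p.qG * (R - √p.ε) + L * (p.qW * N)) ≤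
    ∫ ω, Φ (fun t i => ξ t i ω) * runGrad f Q p W₀ (fun t i => ξ t i ω) t i ∂μ := by
  have := h.prob
  have := h.problem.prob
  have := h.nonempty_sample
  have hB : (0 : ℝ) < B := Nat.cast_pos.2 h.B_pos
  set path : Ω → ℕ → Fin B → Ξ := fun ω t i => ξ t i ω with hpath
  have hpm : Measurable path := h.measurable_path
  set W : Ω → Mat m n := fun ω => (run f Q p W₀ (path ω) t).W with hW
  have hWm : Measurable W := (h.measurable_W t).comp hpm
  have hΦm : Measurable fun ω => Φ (path ω) := hΦ.comp hpm
  set c := p.qG * (R - √p.ε) + L * (p.qW * N) with hc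
  have hbias : ∀ ω, |gradMean f P Q (W ω) i - gradient (objective f P) (W ω) i| ≤ c := fun ω => by
    refine (h.problem.abs_gradMean_sub_le hL h.quantG h.quantW (W ω) i).trans ?_
    have := h.quantW.nonneg
    have := hN (path ω)
    simp only [hc, hW]
    gcongr
  have hterm : ∀ l, Integrable (fun ω => Φ (path ω) *
      Q.QG (stochGrad f (quantize Q.QW (W ω)) (ξ t l ω) i)) μ := fun l => by
    refine Integrable.of_bound (hΦm.mul ((h.measurable_quantGrad i).comp
      (hWm.prodMk (h.sample_measurable t l)))).aestronglyMeasurable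
      (H * ((1 + p.qG) * (R - √p.ε))) ?_
    filter_upwards [h.ae_abs_sample_le t l i] with ω hω
    rw [Real.norm_eq_abs, abs_mul]
    exact mul_le_mul (hH _) hω (abs_nonneg _) ((abs_nonneg _).trans (hH (path ω)))
  have hmean : ∀ l, ∫ ω, Φ (path ω) * Q.QG (stochGrad f (quantize Q.QW (W ω)) (ξ t l ω) i) ∂μ =
      ∫ ω, Φ (path ω) * gradMean f P Q (W ω) i ∂μ := fun l => by
    have hind := indepFun_past h.sample_measurable h.sample_indep (hΦ.prodMk (h.measurable_W t)) t
      (fun s s' hs => by rw [run_congr f Q p W₀ t hs, hpast s s' hs]) l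
    have h1 := integral_of_indepFun (hΦm.prodMk hWm) (h.sample_measurable t l) hind
      (h.sample_law t l)
      (ψ := fun z x => z.1 * Q.QG (stochGrad f (quantize Q.QW z.2) x i))
      (measurable_fst.fst.mul ((h.measurable_quantGrad i).comp
        (measurable_fst.snd.prodMk measurable_snd))) (hterm l)
    refine h1.trans (integral_congr_ae (Filter.Eventually.of_forall fun ω => ?_))
    exact integral_const_mul _ _
  have hgm : Measurable fun ω => gradMean f P Q (W ω) i :=
    (h.measurable_quantGrad i).stronglyMeasurable.integral_prod_right'.measurable.comp hWm
  have hDm : Measurable fun ω => gradient (objective f P) (W ω) i :=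
    (measurable_coord i).comp ((h.problem.measurable_gradient hL).comp hWm)
  have hDint : Integrable (fun ω => Φ (path ω) * gradient (objective f P) (W ω) i) μ := by
    refine Integrable.of_bound (hΦm.mul hDm).aestronglyMeasurable (H * (R - √p.ε))
      (Filter.Eventually.of_forall fun ω => ?_)
    rw [Real.norm_eq_abs, abs_mul]
    exact mul_le_mul (hH _) (h.problem.abs_gradient_le _ i) (abs_nonneg _)
      ((abs_nonneg _).trans (hH (path ω)))
  have hdiff : Integrable (fun ω => Φ (path ω) * (gradMean f P Q (W ω) i -
      gradient (objective f P) (W ω) i)) μ := by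
    refine Integrable.of_bound (hΦm.mul (hgm.sub hDm)).aestronglyMeasurable (H * c)
      (Filter.Eventually.of_forall fun ω => ?_)
    rw [Real.norm_eq_abs, abs_mul]
    exact mul_le_mul (hH _) (hbias ω) (abs_nonneg _) ((abs_nonneg _).trans (hH (path ω)))
  have hmain : ∫ ω, Φ (path ω) * runGrad f Q p W₀ (path ω) t i ∂μ =
      ∫ ω, Φ (path ω) * gradMean f P Q (W ω) i ∂μ := by
    have h1 : ∀ ω, Φ (path ω) * runGrad f Q p W₀ (path ω) t i = 1 / (B : ℝ) *
        ∑ l, Φ (path ω) * Q.QG (stochGrad f (quantize Q.QW (W ω)) (ξ t l ω) i) := fun ω => by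
      rw [runGrad_coord, ← Finset.mul_sum]
      ring
    simp only [h1]
    rw [integral_const_mul, integral_finsetSum _ fun l _ => hterm l]
    simp only [hmean, Finset.sum_const, Finset.card_univ, Fintype.card_fin, nsmul_eq_mul]
    field_simp
  rw [hmain]
  have hlow : -(H * c) ≤ ∫ ω, Φ (path ω) * (gradMean f P Q (W ω) i -
      gradient (objective f P) (W ω) i) ∂μ := by
    have h1 := norm_integral_le_of_norm_le_const (μ := μ) (f := fun ω => Φ (path ω) *
      (gradMean f P Q (W ω) i - gradient (objective f P) (W ω) i)) (C := H * c)
      (Filter.Eventually.of_forall fun ω => by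
        rw [Real.norm_eq_abs, abs_mul]
        exact mul_le_mul (hH _) (hbias ω) (abs_nonneg _) ((abs_nonneg _).trans (hH (path ω))))
    rw [probReal_univ, mul_one, Real.norm_eq_abs] at h1
    exact (abs_le.1 h1).1
  have hsplit : ∫ ω, Φ (path ω) * gradMean f P Q (W ω) i ∂μ =
      ∫ ω, Φ (path ω) * gradient (objective f P) (W ω) i ∂μ + ∫ ω, Φ (path ω) *
        (gradMean f P Q (W ω) i - gradient (objective f P) (W ω) i) ∂μ := by
    rw [← integral_add hDint hdiff]
    exact integral_congr_ae (Filter.Eventually.of_forall fun ω => by ring)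
  rw [hsplit]
  linarith

end Setting

/-! ### Expectation of the main term -/

theorem expSum_congr {a : ℝ} {x y : ℕ → ℝ} (t : ℕ) (h : ∀ j ≤ t, x j = y j) :
    expSum a x t = expSum a y t := by
  induction t with
  | zero => exact h 0 le_rfl
  | succ t ih =>
    rw [expSum, expSum, ih fun j hj => h j (hj.trans (Nat.le_succ t)), h _ le_rfl]

theorem majorant_congr {β ε X : ℝ} {x y : ℕ → ℝ} (s k : ℕ) (h : ∀ j < s, x j = y j) :
    majorant β ε X x s k = majorant β ε X y s k := by
  cases s with
  | zero => rfl
  | succ s =>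
    rw [majorant, majorant, prevSum, prevSum, expSum_congr s fun j hj => h j (Nat.lt_succ_of_le hj)]

theorem measurable_majorant {α : Type*} [MeasurableSpace α] {β ε X : ℝ} {x : α → ℕ → ℝ}
    (hx : ∀ j, Measurable fun a => x a j) (s k : ℕ) :
    Measurable fun a => majorant β ε X (x a) s k := by
  have h1 : ∀ t, Measurable fun a => expSum β (x a) t := by
    intro t
    induction t with
    | zero => exact hx 0
    | succ t ih => exact (ih.const_mul β).add (hx (t + 1))
  have h2 : Measurable fun a => prevSum β (x a) s := by
    cases s with
    | zero => exact measurable_const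
    | succ s => exact (h1 s).const_mul β
  exact ((h2.const_mul _).const_add _).add_const _

theorem le_majorant {β ε X : ℝ} (hβ : 0 ≤ β) (hX : 0 ≤ X) {x : ℕ → ℝ} (hx : ∀ t, 0 ≤ x t)
    (s k : ℕ) : ε ≤ majorant β ε X x s k := by
  have h1 := prevSum_nonneg hβ hx s
  have h2 : 0 ≤ ∑ j ∈ Finset.range (k + 1), β ^ j := Finset.sum_nonneg fun j _ => by positivity
  have h3 : 0 ≤ β ^ k * prevSum β x s := by positivity
  have h4 := mul_nonneg hX h2
  unfold majorant
  linarith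

/-- The square of the almost sure bound on the entries of the quantized gradients. -/
def gradBoundSq (p : Params) (R : ℝ) : ℝ := ((1 + p.qG) * (R - √p.ε)) ^ 2

theorem Params.Valid.add_gradBoundSq_le {p : Params} (hp : p.Valid) {R : ℝ} (hR : √p.ε < R) :
    p.ε + gradBoundSq p R ≤ ((1 + p.qG) * R) ^ 2 := by
  have h1 := Real.sqrt_nonneg p.ε
  have h2 := Real.sq_sqrt hp.ε_pos.le
  have h3 : 0 ≤ (1 + p.qG) * (R - √p.ε) :=
    mul_nonneg (by linarith [hp.qG_nonneg]) (by linarith)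
  have h4 : (1 + p.qG) * (R - √p.ε) + √p.ε ≤ (1 + p.qG) * R := by
    nlinarith [hp.qG_nonneg]
  have h5 := pow_le_pow_left₀ (by positivity) h4 2
  unfold gradBoundSq
  nlinarith

/-- A bound on the norm of the weights after `t` steps, in dimension `d`. -/
def weightBound (p : Params) (D d : ℝ) (t : ℕ) : ℝ :=
  D + t * (maxStep p * √d / √(1 - ratio p))

/-- A bound on the bias of the quantized stochastic gradient in step `t`. -/
def biasBound (p : Params) (R L D d : ℝ) (t : ℕ) : ℝ :=
  p.qG * (R - √p.ε) + L * (p.qW * weightBound p D d t)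

namespace Setting

variable {m n B : ℕ} {Ξ Ω : Type*} [MeasurableSpace Ξ] [MeasurableSpace Ω] {p : Params}
  {R L D : ℝ} {T : ℕ} {f : Mat m n → Ξ → ℝ} {P : Measure Ξ} {W₀ : Mat m n} {Q : Quantizers}
  {μ : Measure Ω} {ξ : ℕ → Fin B → Ω → Ξ} {τ : Ω → ℕ}

theorem norm_W_le (h : Setting p R L D T f P W₀ Q μ ξ τ) (hp : p.Valid) (s : ℕ → Fin B → Ξ)
    (t : ℕ) : ‖(run f Q p W₀ s t).W‖ ≤ weightBound p D ((m : ℝ) * n) t := by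
  have h1 := (run_isTrajectory f Q p W₀ s).norm_le hp h.quantM h.quantV t
  have h2 : ‖(run f Q p W₀ s 0).W‖ ≤ D := h.init
  simp only [Fintype.card_prod, Fintype.card_fin, Nat.cast_mul] at h1
  unfold weightBound
  linarith

theorem measurable_D (h : Setting p R L D T f P W₀ Q μ ξ τ) (hL : 0 ≤ L) (t : ℕ) :
    Measurable fun s : ℕ → Fin B → Ξ => gradient (objective f P) (run f Q p W₀ s t).W :=
  (h.problem.measurable_gradient hL).comp (h.measurable_W t)

theorem abs_gradient_le (h : Setting p R L D T f P W₀ Q μ ξ τ) (W : Mat m n)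
    (i : Fin m × Fin n) : |gradient (objective f P) W i| ≤ R :=
  (h.problem.abs_gradient_le W i).trans (sub_le_self _ (Real.sqrt_nonneg _))

theorem norm_gradient_sq_le (h : Setting p R L D T f P W₀ Q μ ξ τ) (W : Mat m n) :
    ‖gradient (objective f P) W‖ ^ 2 ≤ (m : ℝ) * n * R ^ 2 := by
  rw [EuclideanSpace.norm_sq_eq]
  refine (Finset.sum_le_card_nsmul Finset.univ _ (R ^ 2) fun i _ =>
    pow_le_pow_left₀ (norm_nonneg _) (h.abs_gradient_le W i) 2).trans ?_
  simp

theorem integrable_norm_gradient_sq (h : Setting p R L D T f P W₀ Q μ ξ τ) (hL : 0 ≤ L)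
    (t : ℕ) : Integrable (fun ω =>
      ‖gradient (objective f P) (run f Q p W₀ (fun t i => ξ t i ω) t).W‖ ^ 2) μ := by
  have := h.prob
  refine Integrable.of_bound (((h.measurable_D hL t).comp h.measurable_path).norm.pow_const
    2).aestronglyMeasurable ((m : ℝ) * n * R ^ 2) (Filter.Eventually.of_forall fun ω => ?_)
  rw [Real.norm_of_nonneg (by positivity)]
  exact h.norm_gradient_sq_le _

/-- The past functional is `D_s / √w`. Replacing `g_s` by its mean turns the product into `D_s ^ 2 /
√w`, up to the bias times `R / √ε`, because `w ≥ ε`. -/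
theorem le_integral_mainTerm_summand (h : Setting p R L D T f P W₀ Q μ ξ τ) (hp : p.Valid)
    (hL : 0 ≤ L) (s k : ℕ) (i : Fin m × Fin n) {Dg w : Ω → ℝ} {g : Ω → ℕ → ℝ}
    (hDg : Dg = fun ω => gradient (objective f P) (run f Q p W₀ (fun t i => ξ t i ω) s).W i)
    (hg : g = fun ω j => runGrad f Q p W₀ (fun t i => ξ t i ω) j i)
    (hw : w = fun ω => majorant p.β₂ p.ε (gradBoundSq p R) (fun j => g ω j ^ 2) s k) :
    Integrable (fun ω => Dg ω ^ 2) μ ∧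
    Integrable (fun ω => Dg ω * g ω s / √(w ω) - Dg ω ^ 2 / (4 * √(w ω))) μ ∧
    1 / (2 * ((1 + p.qG) * R * bigOmega p.β₂ (s + k + 1))) * ∫ ω, Dg ω ^ 2 ∂μ -
        R / √p.ε * biasBound p R L D ((m : ℝ) * n) s ≤
      ∫ ω, (Dg ω * g ω s / √(w ω) - Dg ω ^ 2 / (4 * √(w ω))) ∂μ := by
  have := h.prob
  have hε := hp.ε_pos
  have hsε : 0 < √p.ε := Real.sqrt_pos.2 hε
  have hR0 : 0 < R := hsε.trans h.R_gt
  have hqG := hp.qG_nonneg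
  set X := gradBoundSq p R with hX
  have hX0 : 0 ≤ X := sq_nonneg _
  set Φ : (ℕ → Fin B → Ξ) → ℝ := fun q => gradient (objective f P) (run f Q p W₀ q s).W i /
    √(majorant p.β₂ p.ε X (fun j => runGrad f Q p W₀ q j i ^ 2) s k) with hΦ
  have hgm : ∀ j, Measurable fun q : ℕ → Fin B → Ξ => runGrad f Q p W₀ q j i := fun j =>
    (measurable_coord i).comp (h.measurable_grad j)
  have hmajm : Measurable fun q : ℕ → Fin B → Ξ =>
      majorant p.β₂ p.ε X (fun j => runGrad f Q p W₀ q j i ^ 2) s k :=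
    measurable_majorant (fun j => (hgm j).pow_const 2) s k
  have hDm : Measurable fun q : ℕ → Fin B → Ξ =>
      gradient (objective f P) (run f Q p W₀ q s).W i :=
    (measurable_coord i).comp (h.measurable_D hL s)
  have hΦm : Measurable Φ := hDm.div hmajm.sqrt
  have hlow : ∀ q : ℕ → Fin B → Ξ, √p.ε ≤ √(majorant p.β₂ p.ε X (fun j => runGrad f Q p W₀ q j i ^ 2) s k) :=
    fun q => Real.sqrt_le_sqrt (le_majorant hp.β₂_pos.le hX0 (fun j => sq_nonneg _) s k)
  have hΦH : ∀ q : ℕ → Fin B → Ξ, |Φ q| ≤ R / √p.ε := fun q => by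
    rw [hΦ, abs_div, abs_of_nonneg (Real.sqrt_nonneg _)]
    exact div_le_div₀ hR0.le (h.abs_gradient_le _ i) hsε (hlow q)
  -- The majorant at `(s, k)` uses gradients strictly before `s` only; this is the reason for
  -- introducing it.
  have hpast : ∀ q q' : ℕ → Fin B → Ξ, (∀ j < s, q j = q' j) → Φ q = Φ q' := fun q q' hq => by
    simp only [hΦ]
    rw [run_congr f Q p W₀ s hq, majorant_congr s k fun j hj => by
      rw [runGrad_congr f Q p W₀ j fun l hl => hq l (lt_of_lt_of_le hl hj)]]
  have hmain := h.le_integral_mul_runGrad hL s i hΦm hpast hΦH fun q => h.norm_W_le hp q s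
  change _ - R / √p.ε * biasBound p R L D ((m : ℝ) * n) s ≤ _ at hmain
  have hwlow : ∀ ω, √p.ε ≤ √(w ω) := fun ω => by rw [hw, hg]; exact hlow _
  have hDR : ∀ ω, |Dg ω| ≤ R := fun ω => by rw [hDg]; exact h.abs_gradient_le _ i
  have hDgm : Measurable Dg := by rw [hDg]; exact hDm.comp h.measurable_path
  have hwm : Measurable w := by rw [hw, hg]; exact hmajm.comp h.measurable_path
  have hgsm : Measurable fun ω => g ω s := by rw [hg]; exact (hgm s).comp h.measurable_path
  have hgb : ∀ᵐ ω ∂μ, ∀ j, |g ω j| ≤ (1 + p.qG) * (R - √p.ε) := by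
    filter_upwards [h.ae_abs_runGrad_le] with ω hω j
    rw [hg]
    exact hω j i
  have hI1 : Integrable (fun ω => Dg ω ^ 2) μ := by
    refine Integrable.of_bound (hDgm.pow_const 2).aestronglyMeasurable (R ^ 2)
      (Filter.Eventually.of_forall fun ω => ?_)
    rw [Real.norm_eq_abs, abs_pow]
    exact pow_le_pow_left₀ (abs_nonneg _) (hDR ω) 2
  have hI2 : Integrable (fun ω => Dg ω / √(w ω) * g ω s) μ := by
    refine Integrable.of_bound ((hDgm.div hwm.sqrt).mul hgsm).aestronglyMeasurable
      (R / √p.ε * ((1 + p.qG) * (R - √p.ε))) ?_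
    filter_upwards [hgb] with ω hω
    rw [Real.norm_eq_abs, abs_mul, abs_div, abs_of_nonneg (Real.sqrt_nonneg _)]
    exact mul_le_mul (div_le_div₀ hR0.le (hDR ω) hsε (hwlow ω)) (hω s) (abs_nonneg _)
      (by positivity)
  have hI3 : Integrable (fun ω => Dg ω / √(w ω) * Dg ω) μ := by
    refine Integrable.of_bound ((hDgm.div hwm.sqrt).mul hDgm).aestronglyMeasurable
      (R / √p.ε * R) (Filter.Eventually.of_forall fun ω => ?_)
    rw [Real.norm_eq_abs, abs_mul, abs_div, abs_of_nonneg (Real.sqrt_nonneg _)]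
    exact mul_le_mul (div_le_div₀ hR0.le (hDR ω) hsε (hwlow ω)) (hDR ω) (abs_nonneg _)
      (by positivity)
  have heq : (fun ω => Dg ω * g ω s / √(w ω) - Dg ω ^ 2 / (4 * √(w ω))) =
      fun ω => Dg ω / √(w ω) * g ω s - 1 / 4 * (Dg ω / √(w ω) * Dg ω) := by
    funext ω
    have := (hsε.trans_le (hwlow ω)).ne'
    field_simp
  rw [heq]
  refine ⟨hI1, hI2.sub (hI3.const_mul _), ?_⟩
  rw [integral_sub hI2 (hI3.const_mul _), integral_const_mul]
  have hm2 : ∫ ω, Dg ω / √(w ω) * Dg ω ∂μ - R / √p.ε * biasBound p R L D ((m : ℝ) * n) s ≤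
      ∫ ω, Dg ω / √(w ω) * g ω s ∂μ := by
    rw [hw, hg, hDg]
    exact hmain
  have hlb : 1 / ((1 + p.qG) * R * bigOmega p.β₂ (s + k + 1)) * ∫ ω, Dg ω ^ 2 ∂μ ≤
      ∫ ω, Dg ω / √(w ω) * Dg ω ∂μ := by
    rw [← integral_const_mul]
    refine integral_mono_ae (hI1.const_mul _) hI3 ?_
    filter_upwards [hgb] with ω hω
    have hwup : √(w ω) ≤ (1 + p.qG) * R * bigOmega p.β₂ (s + k + 1) := by
      have h1 := majorant_le hp.β₂_pos.le hε.le (x := fun j => g ω j ^ 2) (X := X)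
        (fun j => by
          rw [hX, gradBoundSq, ← sq_abs (g ω j)]
          exact pow_le_pow_left₀ (abs_nonneg _) (hω j) 2) s k
      have h2 : 0 ≤ ∑ j ∈ Finset.range (s + k + 1), p.β₂ ^ j :=
        Finset.sum_nonneg fun j _ => pow_nonneg hp.β₂_pos.le j
      have h3 := h1.trans (mul_le_mul_of_nonneg_right (hp.add_gradBoundSq_le h.R_gt) h2)
      have h4 : w ω ≤ ((1 + p.qG) * R) ^ 2 * ∑ j ∈ Finset.range (s + k + 1), p.β₂ ^ j := by
        rw [hw]; exact h3
      refine (Real.sqrt_le_sqrt h4).trans (le_of_eq ?_)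
      rw [Real.sqrt_mul (sq_nonneg _), Real.sqrt_sq (by positivity), bigOmega]
    have hw0 := hsε.trans_le (hwlow ω)
    change 1 / _ * Dg ω ^ 2 ≤ Dg ω / √(w ω) * Dg ω
    rw [one_div_mul_eq_div, div_mul_eq_mul_div (Dg ω), ← sq]
    gcongr
  have hnn : 0 ≤ ∫ ω, Dg ω / √(w ω) * Dg ω ∂μ := integral_nonneg fun ω => by
    have := Real.sqrt_nonneg (w ω)
    change 0 ≤ Dg ω / √(w ω) * Dg ω
    rw [div_mul_eq_mul_div, ← sq]
    positivity
  have hhalf : 1 / (2 * ((1 + p.qG) * R * bigOmega p.β₂ (s + k + 1))) * ∫ ω, Dg ω ^ 2 ∂μ =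
      1 / 2 * (1 / ((1 + p.qG) * R * bigOmega p.β₂ (s + k + 1)) * ∫ ω, Dg ω ^ 2 ∂μ) := by
    rw [← mul_assoc (1 / 2 : ℝ), one_div_mul_one_div]
  -- Subtracting the correction leaves three quarters of `∫ D ^ 2 / √w`, of which one half suffices.
  rw [hhalf]
  linarith

end Setting

/-- The gradient of step `j` enters all later momenta with total weight `∑ β₁ ^ k` over `k < T - j`.
This is where the law of the output index comes from. -/
theorem one_sub_mul_sum_expSum (a : ℝ) (x : ℕ → ℝ) (T : ℕ) :
    (1 - a) * ∑ t ∈ Finset.range T, expSum a x t =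
      ∑ j ∈ Finset.range T, (1 - a ^ (T - j)) * x j := by
  cases T with
  | zero => simp
  | succ T =>
    have h1 := sum_expSum a x T
    have h2 : a * expSum a x T = ∑ j ∈ Finset.range (T + 1), a ^ (T + 1 - j) * x j := by
      rw [expSum_eq_sum, Finset.mul_sum, ← Finset.sum_range_reflect]
      refine Finset.sum_congr rfl fun j hj => ?_
      have hj' : j ≤ T := Nat.lt_succ_iff.1 (Finset.mem_range.1 hj)
      rw [show T + 1 - 1 - j = T - j by omega, show T - (T - j) = j by omega,
        show T + 1 - j = T - j + 1 by omega, pow_succ]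
      ring
    simp only [sub_mul, one_mul, Finset.sum_sub_distrib]
    rw [← h2]
    linarith

/-- The errors in the pathwise descent inequality, in dimension `d`, for entries of the stochastic
gradient whose squares are at most `X`. -/
def descentError (p : Params) (R L d X : ℝ) (T : ℕ) : ℝ :=
  maxStep p * (d * R *
    (T * firstMomentError p + secondMomentFactor p * (T - geomSum p.qV T))) +
  maxStep p * (2 * ((1 + p.qG) * R) / (√(1 - p.β₁) * (1 - p.β₁ / p.β₂) ^ (3 / 2 : ℝ)) *
    (d * logTerm (p.β₂ * (1 - p.qV)) p.ε X T)) +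
  (L / 2 * maxStep p ^ 2 +
      maxStep p ^ 3 * L ^ 2 * p.β₁ / (2 * ((1 + p.qG) * R) * (1 - p.β₁) ^ 2)) *
    (d * (momentFactor p * logTerm (p.β₂ * (1 - p.qV)) p.ε X T))

/-! ### The averaged descent inequality and the output index. -/

namespace Setting

variable {m n B : ℕ} {Ξ Ω : Type*} [MeasurableSpace Ξ] [MeasurableSpace Ω] {p : Params}
  {R L D : ℝ} {T : ℕ} {f : Mat m n → Ξ → ℝ} {P : Measure Ξ} {W₀ : Mat m n} {Q : Quantizers}
  {μ : Measure Ω} {ξ : ℕ → Fin B → Ω → Ξ} {τ : Ω → ℕ}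

theorem le_integral_mainTerm (h : Setting p R L D T f P W₀ Q μ ξ τ) (hp : p.Valid)
    (hL : 0 ≤ L) (t : ℕ) {Y : Ω → ℝ} {E : ℕ → ℝ}
    (hY : Y = fun ω => mainTerm p (gradBoundSq p R)
      (fun j i => gradient (objective f P) (run f Q p W₀ (fun t i => ξ t i ω) j).W i)
      (fun j i => runGrad f Q p W₀ (fun t i => ξ t i ω) j i) t)
    (hE : E = fun j => ∫ ω,
      ‖gradient (objective f P) (run f Q p W₀ (fun t i => ξ t i ω) j).W‖ ^ 2 ∂μ) :
    Integrable Y μ ∧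
    1 / (2 * ((1 + p.qG) * R * bigOmega p.β₂ (t + 1))) * expSum p.β₁ E t -
      (m : ℝ) * n * (R / √p.ε) * expSum p.β₁ (biasBound p R L D ((m : ℝ) * n)) t ≤
      ∫ ω, Y ω ∂μ := by
  have hterm := fun (k : ℕ) (i : Fin m × Fin n) =>
    h.le_integral_mainTerm_summand hp hL (t - k) k i rfl rfl rfl
  have hint := fun (i : Fin m × Fin n) (k : ℕ) => (hterm k i).2.1.const_mul (p.β₁ ^ k)
  rw [hY]
  refine ⟨integrable_finsetSum _ fun i _ => integrable_finsetSum _ fun k _ => hint i k, ?_⟩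
  simp only [mainTerm]
  rw [integral_finsetSum _ fun i _ => integrable_finsetSum _ fun k _ => hint i k]
  simp only [integral_finsetSum _ fun k _ => hint _ k]
  have hEi : ∀ j, E j = ∑ i, ∫ ω,
      gradient (objective f P) (run f Q p W₀ (fun t i => ξ t i ω) j).W i ^ 2 ∂μ := fun j => by
    rw [hE, ← integral_finsetSum _ fun i _ =>
      (h.le_integral_mainTerm_summand hp hL j 0 i rfl rfl rfl).1]
    simp only [EuclideanSpace.norm_sq_eq, Real.norm_eq_abs, sq_abs]
  rw [expSum_eq_sum, expSum_eq_sum, Finset.mul_sum, Finset.mul_sum, ← Finset.sum_sub_distrib,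
    Finset.sum_comm]
  refine Finset.sum_le_sum fun k hk => ?_
  have hkt : t - k + k = t := Nat.sub_add_cancel (Nat.lt_succ_iff.1 (Finset.mem_range.1 hk))
  simp only [integral_const_mul]
  rw [← Finset.mul_sum]
  have hsum := Finset.sum_le_sum fun i (_ : i ∈ Finset.univ) => (hterm k i).2.2
  rw [Finset.sum_sub_distrib, ← Finset.mul_sum, ← hEi, hkt] at hsum
  simp only [Finset.sum_const, Finset.card_univ, Fintype.card_prod, Fintype.card_fin,
    nsmul_eq_mul, Nat.cast_mul] at hsum
  refine le_trans (le_of_eq ?_) (mul_le_mul_of_nonneg_left hsum (pow_nonneg hp.β₁_nonneg k))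
  ring

/-- The pathwise upper bound and the lower bound in expectation are compared for the same quantity,
the sum of the main terms weighted by the step sizes. -/
theorem sum_weighted_norm_gradient_le (h : Setting p R L D T f P W₀ Q μ ξ τ) (hp : p.Valid)
    (hL : 0 ≤ L) {E : ℕ → ℝ} (hE : E = fun j => ∫ ω,
      ‖gradient (objective f P) (run f Q p W₀ (fun t i => ξ t i ω) j).W‖ ^ 2 ∂μ) :
    p.η / (2 * ((1 + p.qG) * R)) * ∑ j ∈ Finset.range T, (1 - p.β₁ ^ (T - j)) * E j ≤
      objective f P W₀ - (⨅ W, objective f P W) +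
        descentError p R L ((m : ℝ) * n) (gradBoundSq p R) T +
        maxStep p / (1 - p.β₁) * ((m : ℝ) * n * (R / √p.ε) *
          ∑ j ∈ Finset.range T, biasBound p R L D ((m : ℝ) * n) j) := by
  have := h.prob
  have hR0 : 0 < R := (Real.sqrt_pos.2 hp.ε_pos).trans h.R_gt
  have hA : 0 < (1 + p.qG) * R := mul_pos (by linarith [hp.qG_nonneg]) hR0
  have hβ : 0 < 1 - p.β₁ := by linarith [hp.β₁_lt]
  set Y : ℕ → Ω → ℝ := fun t ω => mainTerm p (gradBoundSq p R)
      (fun j i => gradient (objective f P) (run f Q p W₀ (fun t i => ξ t i ω) j).W i)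
      (fun j i => runGrad f Q p W₀ (fun t i => ξ t i ω) j i) t with hY
  set b := biasBound p R L D ((m : ℝ) * n) with hb
  set gap := objective f P W₀ - (⨅ W, objective f P W) with hgap
  have hmain := fun t => h.le_integral_mainTerm hp hL t (Y := Y t) rfl hE
  have hb0 : ∀ j, 0 ≤ b j := fun j => by
    have h1 := (norm_nonneg _).trans (h.norm_W_le hp (fun _ _ => Classical.choice
      h.nonempty_sample) j)
    have h2 := h.R_gt.le
    have := hp.qG_nonneg
    have := hp.qW_nonneg
    have : 0 ≤ R - √p.ε := by linarith
    simp only [hb, biasBound]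
    positivity
  have hpath : ∀ᵐ ω ∂μ, ∑ t ∈ Finset.range T, stepSize p (t + 1) * Y t ω ≤
      gap + descentError p R L ((m : ℝ) * n) (gradBoundSq p R) T := by
    filter_upwards [h.ae_abs_runGrad_le] with ω hω
    have h1 := (run_isTrajectory f Q p W₀ fun t i => ξ t i ω).sum_mainTerm_le hp h.quantM h.quantV
      (X := gradBoundSq p R) (A := (1 + p.qG) * R) (R := R) (L := L)
      (fun t i => by
        rw [gradBoundSq, ← sq_abs]
        exact pow_le_pow_left₀ (abs_nonneg _) (hω t i) 2) hA (hp.add_gradBoundSq_le h.R_gt) hL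
      h.problem.differentiable h.problem.smooth h.abs_gradient_le
      (fun W => ciInf_le h.problem.bddBelow W) T
    simp only [Fintype.card_prod, Fintype.card_fin, Nat.cast_mul] at h1
    rw [descentError, hgap, ← add_assoc, ← add_assoc]
    exact h1
  have hint : ∑ t ∈ Finset.range T, stepSize p (t + 1) * ∫ ω, Y t ω ∂μ ≤
      gap + descentError p R L ((m : ℝ) * n) (gradBoundSq p R) T := by
    have h1 := fun t => (hmain t).1.const_mul (stepSize p (t + 1))
    have h2 := integral_mono_ae (integrable_finsetSum (Finset.range T) fun t _ => h1 t)
      (integrable_const _) hpath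
    rw [integral_finsetSum _ fun t _ => h1 t, integral_const, probReal_univ, one_smul] at h2
    simpa only [integral_const_mul] using h2
  have hlow : ∀ t, p.η / (2 * ((1 + p.qG) * R)) * ((1 - p.β₁) * expSum p.β₁ E t) -
      maxStep p * ((m : ℝ) * n * (R / √p.ε) * expSum p.β₁ b t) ≤
      stepSize p (t + 1) * ∫ ω, Y t ω ∂μ := fun t => by
    have h1 := mul_le_mul_of_nonneg_left (hmain t).2 (hp.stepSize_nonneg (t + 1))
    have hΩ : bigOmega p.β₂ (t + 1) ≠ 0 :=
      (zero_lt_one.trans_le (one_le_bigOmega hp.β₂_pos.le t)).ne'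
    -- The factor `bigOmega` cancels, so the coefficient of the gradient norms no longer depends on
    -- `t`.
    have h2 : stepSize p (t + 1) * (1 / (2 * ((1 + p.qG) * R * bigOmega p.β₂ (t + 1))) *
        expSum p.β₁ E t) =
        p.η / (2 * ((1 + p.qG) * R)) * ((1 - p.β₁) * expSum p.β₁ E t) := by
      rw [stepSize]
      have := hA.ne'
      field_simp
    have h3 : 0 ≤ (m : ℝ) * n * (R / √p.ε) * expSum p.β₁ b t := by
      have := expSum_nonneg hp.β₁_nonneg hb0 t
      positivity
    have h4 := mul_le_mul_of_nonneg_right (hp.stepSize_le (t + 1)) h3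
    rw [mul_sub, h2] at h1
    linarith
  have hsum := (Finset.sum_le_sum fun t (_ : t ∈ Finset.range T) => hlow t).trans hint
  rw [Finset.sum_sub_distrib, ← Finset.mul_sum, ← Finset.mul_sum, ← Finset.mul_sum,
    ← Finset.mul_sum, one_sub_mul_sum_expSum] at hsum
  have hbias : maxStep p * ((m : ℝ) * n * (R / √p.ε) * ∑ t ∈ Finset.range T, expSum p.β₁ b t) ≤
      maxStep p / (1 - p.β₁) * ((m : ℝ) * n * (R / √p.ε) * ∑ j ∈ Finset.range T, b j) := by
    have h1 := sum_expSum_le hp.β₁_nonneg hp.β₁_lt hb0 T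
    have hm := hp.maxStep_nonneg
    calc _ ≤ maxStep p * ((m : ℝ) * n * (R / √p.ε) * (1 / (1 - p.β₁) *
          ∑ j ∈ Finset.range T, b j)) := by gcongr
      _ = _ := by ring
  linarith

/-! ### The random output index -/

theorem half_le_normalizer (h : Setting p R L D T f P W₀ Q μ ξ τ)
    (hT : 2 * p.β₁ / (1 - p.β₁) ≤ T) :
    (T : ℝ) / 2 ≤ ∑ i ∈ Finset.range T, (1 - p.β₁ ^ (T - i)) := by
  obtain ⟨h0, h1⟩ := h.β₁_mem
  have hβ : 0 < 1 - p.β₁ := by linarith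
  have h2 : ∑ i ∈ Finset.range T, p.β₁ ^ (T - i) ≤ p.β₁ / (1 - p.β₁) := by
    rw [← Finset.sum_range_reflect]
    calc _ = p.β₁ * ∑ j ∈ Finset.range T, p.β₁ ^ j := by
          rw [Finset.mul_sum]
          refine Finset.sum_congr rfl fun j hj => ?_
          have := Finset.mem_range.1 hj
          rw [show T - (T - 1 - j) = j + 1 by omega, pow_succ, mul_comm]
      _ ≤ p.β₁ * (1 / (1 - p.β₁)) := mul_le_mul_of_nonneg_left (sum_geom_le h0 h1 T) h0
      _ = _ := by ring
  rw [Finset.sum_sub_distrib]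
  simp only [Finset.sum_const, Finset.card_range, nsmul_eq_mul, mul_one]
  rw [mul_div_assoc] at hT
  linarith

theorem normalizer_pos (h : Setting p R L D T f P W₀ Q μ ξ τ) :
    0 < ∑ i ∈ Finset.range T, (1 - p.β₁ ^ (T - i)) := by
  obtain ⟨h0, h1⟩ := h.β₁_mem
  refine Finset.sum_pos (fun i hi => ?_) ⟨0, Finset.mem_range.2 h.T_pos⟩
  have := pow_lt_one₀ h0 h1 (n := T - i) (by have := Finset.mem_range.1 hi; omega)
  linarith

/-- The prescribed masses on `j < T` already add up to `1`. -/
theorem ae_index_lt (h : Setting p R L D T f P W₀ Q μ ξ τ) : ∀ᵐ ω ∂μ, τ ω < T := by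
  have := h.prob
  have hS := h.normalizer_pos
  have hm : ∀ j, MeasurableSet {ω | τ ω = j} := fun j =>
    h.index_measurable (measurableSet_singleton j)
  have hset : {ω | τ ω < T} = ⋃ j ∈ Finset.range T, {ω | τ ω = j} := by
    ext ω
    simp
  have hdisj : Set.PairwiseDisjoint (Finset.range T : Set ℕ) fun j => {ω | τ ω = j} :=
    fun i _ j _ hij => Set.disjoint_left.2
      fun ω (h1 : τ ω = i) (h2 : τ ω = j) => hij (h1.symm.trans h2)
  have h1 : μ.real {ω | τ ω < T} = 1 := by
    rw [hset, measureReal_biUnion_finset hdisj fun j _ => hm j,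
      Finset.sum_congr rfl fun j hj => h.index_law j (Finset.mem_range.1 hj), ← Finset.sum_div,
      div_self hS.ne']
  have h2 : MeasurableSet {ω | τ ω < T} := h.index_measurable measurableSet_Iio
  exact mem_ae_iff.2 ((prob_compl_eq_zero_iff h2).2 ((ENNReal.toReal_eq_one_iff _).1 h1))

theorem integral_gradNorm_sq (h : Setting p R L D T f P W₀ Q μ ξ τ) (hL : 0 ≤ L) :
    Integrable (fun ω => gradNorm p f P W₀ Q ξ τ ω ^ 2) μ ∧
    ∫ ω, gradNorm p f P W₀ Q ξ τ ω ^ 2 ∂μ =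
      (∑ j ∈ Finset.range T, (1 - p.β₁ ^ (T - j)) * ∫ ω,
        ‖gradient (objective f P) (run f Q p W₀ (fun t i => ξ t i ω) j).W‖ ^ 2 ∂μ) /
      ∑ i ∈ Finset.range T, (1 - p.β₁ ^ (T - i)) := by
  have := h.prob
  set N : ℕ → Ω → ℝ := fun j ω =>
    ‖gradient (objective f P) (run f Q p W₀ (fun t i => ξ t i ω) j).W‖ ^ 2 with hN
  set I : ℕ → Ω → ℝ := fun j ω => Set.indicator {j} (fun _ => (1 : ℝ)) (τ ω) with hI
  have hIm : ∀ j, Measurable (Set.indicator ({j} : Set ℕ) (fun _ => (1 : ℝ))) := fun j =>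
    measurable_of_countable _
  have hNm : ∀ j, Measurable fun q : ℕ → Fin B → Ξ =>
      ‖gradient (objective f P) (run f Q p W₀ q j).W‖ ^ 2 := fun j =>
    (h.measurable_D hL j).norm.pow_const 2
  have hNint : ∀ j, Integrable (N j) μ := fun j => h.integrable_norm_gradient_sq hL j
  have hind : ∀ j, IndepFun (I j) (N j) μ := fun j => h.index_indep.comp (hIm j) (hNm j)
  have hIint : ∀ j, Integrable (I j) μ := fun j =>
    Integrable.of_bound ((hIm j).comp h.index_measurable).aestronglyMeasurable 1
      (Filter.Eventually.of_forall fun ω => by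
        simp only [hI]
        by_cases hj : τ ω = j <;> simp [Set.indicator, hj])
  have hprod : ∀ j, Integrable (fun ω => I j ω * N j ω) μ := fun j =>
    (hind j).integrable_mul (hIint j) (hNint j)
  have hIval : ∀ j < T, ∫ ω, I j ω ∂μ =
      (1 - p.β₁ ^ (T - j)) / ∑ i ∈ Finset.range T, (1 - p.β₁ ^ (T - i)) := fun j hj => by
    rw [← h.index_law j hj]
    have : I j = Set.indicator {ω | τ ω = j} 1 := by
      funext ω
      by_cases hj : τ ω = j <;> simp [hI, Set.indicator, hj]
    have hm : MeasurableSet {ω | τ ω = j} := h.index_measurable (measurableSet_singleton j)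
    rw [this, integral_indicator_one hm]
  have hae : (fun ω => gradNorm p f P W₀ Q ξ τ ω ^ 2) =ᵐ[μ]
      fun ω => ∑ j ∈ Finset.range T, I j ω * N j ω := by
    filter_upwards [h.ae_index_lt] with ω hω
    rw [Finset.sum_eq_single (τ ω)]
    · simp [hI, hN, gradNorm]
    · intro j _ hj
      simp [hI, Set.indicator, hj.symm]
    · intro hn
      exact absurd (Finset.mem_range.2 hω) hn
  refine ⟨(integrable_congr hae).2 (integrable_finsetSum _ fun j _ => hprod j), ?_⟩
  rw [integral_congr_ae hae, integral_finsetSum _ fun j _ => hprod j, Finset.sum_div]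
  refine Finset.sum_congr rfl fun j hj => ?_
  rw [(hind j).integral_fun_mul_eq_mul_integral (hIint j).aestronglyMeasurable
    (hNint j).aestronglyMeasurable, hIval j (Finset.mem_range.1 hj), div_mul_eq_mul_div]

end Setting

/-! ### The explicit bound -/

theorem logTerm_mono {b ε X Y : ℝ} (hb1 : b < 1) (hε : 0 < ε) (hX : 0 ≤ X) (hXY : X ≤ Y)
    (T : ℕ) : logTerm b ε X T ≤ logTerm b ε Y T := by
  have h1 : 0 < 1 - b := by linarith
  unfold logTerm
  gcongr

theorem moment_errors_eq {p : Params} (hp : p.Valid) {R d T : ℝ} (hT : 0 < T) (Γ : ℝ) :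
    4 * ((1 + p.qG) * R) / (p.η * T) * (maxStep p * (d * R *
      (T * firstMomentError p + secondMomentFactor p * (T - Γ)))) =
    (4 * (1 + p.qG) * p.qM * d * R ^ 2 * (1 - p.β₁) * T / √(1 - p.β₂) *
      (√(ratio p * (1 + ratio p)) / ((1 + p.qM) * (1 - ratio p) ^ (3 / 2 : ℝ)))
    + 4 * (1 + p.qG) * d * R ^ 2 * (1 - p.β₁) * T /
      √((1 - p.β₁ ^ 2 / (p.β₂ * (1 - p.qV))) * (1 - p.β₂))
    - 4 * (1 + p.qG) * d * R ^ 2 * (1 - p.β₁) /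
      √((1 - p.β₁ ^ 2 / (p.β₂ * (1 - p.qV))) * (1 - p.β₂)) * Γ) / T := by
  have hη := hp.η_pos
  have hr := hp.ratio_lt_one
  have hr0 := hp.ratio_nonneg
  have hqM := hp.qM_nonneg
  have h1r : 0 < 1 - ratio p := by linarith
  have h1β₂ : 0 < 1 - p.β₂ := by linarith [hp.β₂_lt]
  have hk : p.β₁ ^ 2 < p.β₂ * (1 - p.qV) := by
    have := pow_le_pow_left₀ hp.β₁_nonneg hp.β₁_le_rate 2
    linarith [hp.ratio_lt']
  have hk1 : 0 < 1 - p.β₁ ^ 2 / (p.β₂ * (1 - p.qV)) := sub_pos.2 ((div_lt_one hp.rate_pos).2 hk)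
  have h3 : √((1 - ratio p) ^ 3) = √(1 - ratio p) ^ 3 := by
    rw [show (1 - ratio p) ^ 3 = (√(1 - ratio p) ^ 3) ^ 2 by
      rw [← pow_mul, mul_comm, pow_mul, Real.sq_sqrt h1r.le], Real.sqrt_sq (by positivity)]
  rw [Real.sqrt_mul hk1.le, rpow_three_halves h1r.le, maxStep, firstMomentError,
    secondMomentFactor, Real.sqrt_div (by positivity), h3]
  have := Real.sqrt_pos.2 h1r
  have := Real.sqrt_pos.2 h1β₂
  have := Real.sqrt_pos.2 hk1
  field_simp
  ring

/-- The argument yields `8` and `2` where `constC` has `24` and `4`; the middle coefficient is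
attained. -/
theorem constC_bound {p : Params} (hp : p.Valid) {R L d T Λ : ℝ} (hR : 0 < R)
    (hd : 0 ≤ d) (hT : 0 < T) (hΛ : 0 ≤ Λ) :
    4 * ((1 + p.qG) * R) / (p.η * T) *
      (maxStep p * (2 * ((1 + p.qG) * R) / (√(1 - p.β₁) * (1 - p.β₁ / p.β₂) ^ (3 / 2 : ℝ)) *
          (d * Λ)) +
        (L / 2 * maxStep p ^ 2 +
          maxStep p ^ 3 * L ^ 2 * p.β₁ / (2 * ((1 + p.qG) * R) * (1 - p.β₁) ^ 2)) *
        (d * (momentFactor p * Λ))) ≤ constC p R L d / T * Λ := by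
  have hη := hp.η_pos
  have hqG := hp.qG_nonneg
  have hβ₁ := hp.β₁_nonneg
  have h1β₁ : 0 < 1 - p.β₁ := by linarith [hp.β₁_lt]
  have h1β₂ : 0 < 1 - p.β₂ := by linarith [hp.β₂_lt]
  have ha : 0 < 1 - p.β₁ / p.β₂ := sub_pos.2 ((div_lt_one hp.β₂_pos).2 hp.β₁_lt_β₂)
  have hu : 0 < 1 - p.β₁ * (1 + p.qM) := by linarith [hp.rate_lt, hp.rate_le, hp.β₂_lt]
  have hv : 0 < 1 - p.β₁ * (1 + p.qM) / (p.β₂ * (1 - p.qV)) :=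
    sub_pos.2 ((div_lt_one hp.rate_pos).2 hp.rate_lt)
  rw [constC, maxStep, momentFactor, rpow_three_halves ha.le, rpow_three_halves h1β₂.le]
  set u := 1 - p.β₁ * (1 + p.qM)
  set v := 1 - p.β₁ * (1 + p.qM) / (p.β₂ * (1 - p.qV))
  have hα : 0 < √(1 - p.β₁ / p.β₂) := Real.sqrt_pos.2 ha
  set α := √(1 - p.β₁ / p.β₂)
  have hσ : 0 < √(1 - p.β₂) := Real.sqrt_pos.2 h1β₂
  have hσ2 : 1 - p.β₂ = √(1 - p.β₂) ^ 2 := (Real.sq_sqrt h1β₂.le).symm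
  set σ := √(1 - p.β₂)
  have hδ : 0 < √(1 - p.β₁) := Real.sqrt_pos.2 h1β₁
  have hδ2 : 1 - p.β₁ = √(1 - p.β₁) ^ 2 := (Real.sq_sqrt h1β₁.le).symm
  set δ := √(1 - p.β₁)
  rw [hσ2, hδ2]
  have hA : 0 < (1 + p.qG) * R := by positivity
  have e1 : 4 * ((1 + p.qG) * R) / (p.η * T) * (δ ^ 2 * p.η / σ * (2 * ((1 + p.qG) * R) /
      (δ * α ^ 3) * (d * Λ))) = 8 * d * ((1 + p.qG) * R) ^ 2 * δ / (α ^ 3 * σ) / T * Λ := by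
    field_simp; ring
  have e2 : 4 * ((1 + p.qG) * R) / (p.η * T) * (L / 2 * (δ ^ 2 * p.η / σ) ^ 2 *
      (d * (1 / (u * v) * Λ))) =
      2 * d * p.η * L * (1 + p.qG) * R * (δ ^ 2) ^ 2 / (u * v * σ ^ 2) / T * Λ := by
    field_simp; ring
  have e3 : 4 * ((1 + p.qG) * R) / (p.η * T) * ((δ ^ 2 * p.η / σ) ^ 3 * L ^ 2 * p.β₁ /
      (2 * ((1 + p.qG) * R) * (δ ^ 2) ^ 2) * (d * (1 / (u * v) * Λ))) =
      2 * d * p.η ^ 2 * L ^ 2 * p.β₁ * δ ^ 2 / (u * v * σ ^ 3) / T * Λ := by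
    have := hA.ne'
    field_simp; ring
  have i1 : 8 * d * ((1 + p.qG) * R) ^ 2 * δ / (α ^ 3 * σ) / T * Λ ≤
      24 * d * ((1 + p.qG) * R) ^ 2 * δ / (α ^ 3 * σ) / T * Λ := by
    gcongr; norm_num
  have i3 : 2 * d * p.η ^ 2 * L ^ 2 * p.β₁ * δ ^ 2 / (u * v * σ ^ 3) / T * Λ ≤
      4 * d * p.η ^ 2 * L ^ 2 * p.β₁ * δ ^ 2 / (u * v * σ ^ 3) / T * Λ := by
    gcongr; norm_num
  have hsplit : ∀ x y z : ℝ, (x + y + z) / T * Λ = x / T * Λ + y / T * Λ + z / T * Λ := by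
    intro x y z; ring
  rw [mul_add, add_mul (L / 2 * _), mul_add, e1, e2, e3, hsplit]
  linarith

theorem constC_nonneg {p : Params} (hp : p.Valid) {R L d : ℝ} (hR : 0 ≤ R) (hL : 0 ≤ L)
    (hd : 0 ≤ d) : 0 ≤ constC p R L d := by
  have hη := hp.η_pos
  have hqG := hp.qG_nonneg
  have hβ₁ := hp.β₁_nonneg
  have h1β₁ : 0 < 1 - p.β₁ := by linarith [hp.β₁_lt]
  have h1β₂ : 0 < 1 - p.β₂ := by linarith [hp.β₂_lt]
  have ha : 0 < 1 - p.β₁ / p.β₂ := sub_pos.2 ((div_lt_one hp.β₂_pos).2 hp.β₁_lt_β₂)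
  have hu : 0 < 1 - p.β₁ * (1 + p.qM) := by linarith [hp.rate_lt, hp.rate_le, hp.β₂_lt]
  have hv : 0 < 1 - p.β₁ * (1 + p.qM) / (p.β₂ * (1 - p.qV)) :=
    sub_pos.2 ((div_lt_one hp.rate_pos).2 hp.rate_lt)
  unfold constC
  positivity

theorem sum_biasBound_le {p : Params} (hp : p.Valid) {R L D d : ℝ} (hL : 0 ≤ L) (T : ℕ) :
    ∑ j ∈ Finset.range T, biasBound p R L D d j ≤
      T * (p.qG * R + L * (p.qW * (D + T / 2 * (maxStep p * √d / √(1 - ratio p))))) := by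
  have hm := hp.maxStep_nonneg
  have hqG := hp.qG_nonneg
  have hqW := hp.qW_nonneg
  have hsum : ∑ j ∈ Finset.range T, (j : ℝ) ≤ T * (T / 2) := by
    have h1 := Finset.sum_range_id_mul_two T
    have h2 : ((∑ j ∈ Finset.range T, j : ℕ) : ℝ) * 2 ≤ T * T := by
      have : (∑ j ∈ Finset.range T, j) * 2 ≤ T * T := by
        rw [h1]; exact Nat.mul_le_mul_left _ (Nat.sub_le _ _)
      exact_mod_cast this
    push_cast at h2
    linarith
  set κ := maxStep p * √d / √(1 - ratio p)
  have hκ : 0 ≤ κ := by positivity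
  have h0 : 0 ≤ p.qG * √p.ε := mul_nonneg hqG (Real.sqrt_nonneg _)
  have hle : ∀ j ∈ Finset.range T, biasBound p R L D d j ≤
      (p.qG * R + L * (p.qW * D)) + L * p.qW * κ * j := fun j _ => by
    unfold biasBound weightBound
    linarith
  refine (Finset.sum_le_sum hle).trans ?_
  rw [Finset.sum_add_distrib, ← Finset.mul_sum]
  simp only [Finset.sum_const, Finset.card_range, nsmul_eq_mul]
  have h1 := mul_le_mul_of_nonneg_left hsum (show 0 ≤ L * p.qW * κ by positivity)
  linarith

theorem bias_errors_le {p : Params} (hp : p.Valid) {R L D d : ℝ} (hR : 0 < R)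
    (hL : 0 ≤ L) (hd : 0 ≤ d) {T : ℕ} (hT : 0 < T) :
    4 * ((1 + p.qG) * R) / (p.η * T) * (maxStep p / (1 - p.β₁) * (d * (R / √p.ε) *
      ∑ j ∈ Finset.range T, biasBound p R L D d j)) ≤
    2 * p.qW * T * (1 - p.β₁) * d ^ (3 / 2 : ℝ) * p.η * L * (1 + p.qG) * R ^ 2 /
      (√p.ε * (1 - p.β₂) * √(1 - ratio p)) +
    4 * (1 + p.qG) * d / √(p.ε * (1 - p.β₂)) * (p.qG * R ^ 3 + L * p.qW * R ^ 2 * D) := by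
  have hη := hp.η_pos
  have hε := hp.ε_pos
  have hqG := hp.qG_nonneg
  have hm := hp.maxStep_nonneg
  have hT' : (0 : ℝ) < T := Nat.cast_pos.2 hT
  have h1β₁ : 0 < 1 - p.β₁ := by linarith [hp.β₁_lt]
  have h1β₂ : 0 < 1 - p.β₂ := by linarith [hp.β₂_lt]
  have h1r : 0 < 1 - ratio p := by linarith [hp.ratio_lt_one]
  refine (mul_le_mul_of_nonneg_left (mul_le_mul_of_nonneg_left (mul_le_mul_of_nonneg_left
    (sum_biasBound_le hp hL T) (by positivity)) (by positivity)) (by positivity)).trans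
    (le_of_eq ?_)
  have hd3 : d ^ (3 / 2 : ℝ) = d * √d := by
    rw [rpow_three_halves hd, pow_succ, Real.sq_sqrt hd]
  rw [hd3, Real.sqrt_mul hε.le, maxStep]
  have hρ := Real.sqrt_pos.2 h1r
  have hσ := Real.sqrt_pos.2 h1β₂
  have he := Real.sqrt_pos.2 hε
  have hσ2 : 1 - p.β₂ = √(1 - p.β₂) ^ 2 := (Real.sq_sqrt h1β₂.le).symm
  set σ := √(1 - p.β₂)
  rw [hσ2]
  field_simp
  ring

namespace Setting

variable {m n B : ℕ} {Ξ Ω : Type*} [MeasurableSpace Ξ] [MeasurableSpace Ω] {p : Params}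
  {R L D : ℝ} {T : ℕ} {f : Mat m n → Ξ → ℝ} {P : Measure Ξ} {W₀ : Mat m n} {Q : Quantizers}
  {μ : Measure Ω} {ξ : ℕ → Fin B → Ω → Ξ} {τ : Ω → ℕ}

theorem valid (h : Setting p R L D T f P W₀ Q μ ξ τ)
    (hr : p.β₁ ^ 2 * (1 + p.qM) ^ 2 < p.β₂ * (1 - p.qV))
    (hr' : p.β₁ * (1 + p.qM) < p.β₂ * (1 - p.qV)) : p.Valid where
  η_pos := h.η_pos
  β₁_nonneg := h.β₁_mem.1
  β₁_lt := h.β₁_mem.2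
  β₂_pos := h.β₂_mem.1
  β₂_lt := h.β₂_mem.2
  ε_pos := h.ε_pos
  qM_nonneg := h.quantM.nonneg
  qV_nonneg := h.quantV.nonneg
  qG_nonneg := h.quantG.nonneg
  qW_nonneg := h.quantW.nonneg
  ratio_lt := hr
  rate_lt := hr'

/-- No sign of `L` is assumed. In positive dimension smoothness forces `0 ≤ L`; in dimension zero,
where it may be negative, `|L|` serves instead. -/
theorem of_abs (h : Setting p R L D T f P W₀ Q μ ξ τ) : Setting p R |L| D T f P W₀ Q μ ξ τ :=
  { h with
    problem := { h.problem with
      smooth := fun X Y => (h.problem.smooth X Y).trans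
        (mul_le_mul_of_nonneg_right (le_abs_self L) (norm_nonneg _)) } }

theorem lipschitz_nonneg (h : Setting p R L D T f P W₀ Q μ ξ τ) (i : Fin m × Fin n) : 0 ≤ L := by
  have h1 := (norm_nonneg _).trans (h.problem.smooth (EuclideanSpace.single i 1) 0)
  simpa using h1

theorem integral_gradNorm_sq_le_of_nonneg (h : Setting p R L D T f P W₀ Q μ ξ τ) (hp : p.Valid)
    (hL : 0 ≤ L) (hT : 2 * p.β₁ / (1 - p.β₁) ≤ T) :
    ∫ ω, gradNorm p f P W₀ Q ξ τ ω ^ 2 ∂μ ≤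
      bound p R L D ((m : ℝ) * n) (objective f P W₀ - ⨅ W, objective f P W) T := by
  have hR : 0 < R := (Real.sqrt_pos.2 hp.ε_pos).trans h.R_gt
  have hη := hp.η_pos
  have hA : 0 < (1 + p.qG) * R := mul_pos (by linarith [hp.qG_nonneg]) hR
  have hT0 : (0 : ℝ) < T := Nat.cast_pos.2 h.T_pos
  have hd : (0 : ℝ) ≤ (m : ℝ) * n := by positivity
  rw [(h.integral_gradNorm_sq hL).2]
  have hmain := h.sum_weighted_norm_gradient_le hp hL rfl
  have hN := h.half_le_normalizer hT
  set S := ∑ j ∈ Finset.range T, (1 - p.β₁ ^ (T - j)) * ∫ ω,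
        ‖gradient (objective f P) (run f Q p W₀ (fun t i => ξ t i ω) j).W‖ ^ 2 ∂μ with hS
  have hS0 : 0 ≤ S := Finset.sum_nonneg fun j _ => mul_nonneg
    (sub_nonneg.2 (pow_le_one₀ hp.β₁_nonneg hp.β₁_lt.le)) (integral_nonneg fun ω => sq_nonneg _)
  have h1 : S / ∑ i ∈ Finset.range T, (1 - p.β₁ ^ (T - i)) ≤ S / (T / 2) := by gcongr
  have h2 : S / (T / 2) = 4 * ((1 + p.qG) * R) / (p.η * T) *
      (p.η / (2 * ((1 + p.qG) * R)) * S) := by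
    have : 0 < 1 + p.qG := by linarith [hp.qG_nonneg]
    field_simp
    ring
  have h3 := mul_le_mul_of_nonneg_left hmain
    (show 0 ≤ 4 * ((1 + p.qG) * R) / (p.η * T) by positivity)
  have hX0 : 0 ≤ gradBoundSq p R := sq_nonneg _
  -- The entries are bounded through `R - √ε`, while the bound is stated with the larger `R` inside
  -- the logarithm.
  have hΛ : logTerm (p.β₂ * (1 - p.qV)) p.ε (gradBoundSq p R) T ≤
      logTerm (p.β₂ * (1 - p.qV)) p.ε (((1 + p.qG) * R) ^ 2) T :=
    logTerm_mono (hp.rate_le.trans_lt hp.β₂_lt) hp.ε_pos hX0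
      (by linarith [hp.add_gradBoundSq_le h.R_gt, hp.ε_pos]) T
  have hΛ0 := logTerm_nonneg hp.rate_pos (hp.rate_le.trans_lt hp.β₂_lt) hp.ε_pos hX0 T
  have hmom := moment_errors_eq hp (R := R) (d := (m : ℝ) * n) hT0 (geomSum p.qV T)
  have hC := (constC_bound hp (L := L) hR hd hT0 hΛ0).trans (mul_le_mul_of_nonneg_left hΛ
    (div_nonneg (constC_nonneg hp hR.le hL hd) hT0.le))
  have hb := bias_errors_le hp (D := D) hR hL hd h.T_pos
  rw [h2] at h1
  refine h1.trans (h3.trans ?_)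
  set gap := objective f P W₀ - ⨅ W, objective f P W
  have hgap : 4 * ((1 + p.qG) * R) / (p.η * T) * gap = 4 * (1 + p.qG) * R * (gap / (p.η * T)) := by
    ring
  rw [mul_add, mul_add, hgap, descentError, add_assoc (maxStep p * _),
    mul_add (4 * ((1 + p.qG) * R) / (p.η * T)) (maxStep p * _), hmom, bound, Qtilde]
  change _ ≤ _ + constC p R L ((m : ℝ) * n) / T *
    logTerm (p.β₂ * (1 - p.qV)) p.ε (((1 + p.qG) * R) ^ 2) T
  linarith

theorem bound_eq_of_dim_eq_zero (p : Params) (R L L' D gap : ℝ) (T : ℕ) :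
    bound p R L D 0 gap T = bound p R L' D 0 gap T := by
  simp [bound, constC, Qtilde]

/-- The explicit bound. -/
theorem integral_gradNorm_sq_le (h : Setting p R L D T f P W₀ Q μ ξ τ)
    (hr : p.β₁ ^ 2 * (1 + p.qM) ^ 2 < p.β₂ * (1 - p.qV))
    (hr' : p.β₁ * (1 + p.qM) < p.β₂ * (1 - p.qV)) (hT : 2 * p.β₁ / (1 - p.β₁) ≤ T) :
    Integrable (fun ω => gradNorm p f P W₀ Q ξ τ ω ^ 2) μ ∧
    ∫ ω, gradNorm p f P W₀ Q ξ τ ω ^ 2 ∂μ ≤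
      bound p R L D ((m : ℝ) * n) (objective f P W₀ - ⨅ W, objective f P W) T := by
  have hp := h.valid hr hr'
  refine ⟨(h.of_abs.integral_gradNorm_sq (abs_nonneg L)).1, ?_⟩
  -- In dimension zero every term containing `L` vanishes, so passing to `|L|` does not change the
  -- bound.
  rcases isEmpty_or_nonempty (Fin m × Fin n) with he | ⟨⟨i⟩⟩
  · have hd : (m : ℝ) * n = 0 := by
      have := Fintype.card_eq_zero_iff.2 he
      rw [Fintype.card_prod, Fintype.card_fin, Fintype.card_fin] at this
      exact_mod_cast this
    have h1 := h.of_abs.integral_gradNorm_sq_le_of_nonneg hp (abs_nonneg L) hT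
    rw [hd] at h1 ⊢
    rwa [bound_eq_of_dim_eq_zero p R L |L|]
  · exact h.integral_gradNorm_sq_le_of_nonneg hp (h.lipschitz_nonneg i) hT

end Setting

/-! ### The rate -/

/-- Quantitative consequences of the schedule after `T = x ^ 2` steps; `g` is a lower bound for the
distance from `1` of the contraction factors. -/
structure Regime (p : Params) (g a₁ a₂ b₁ c x : ℝ) : Prop where
  valid : p.Valid
  one_le : 1 ≤ x
  g_pos : 0 < g
  a₁_pos : 0 < a₁
  a₂_nonneg : 0 ≤ a₂
  b₁_pos : 0 < b₁
  c_nonneg : 0 ≤ c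
  η_lower : a₁ / x ≤ p.η
  η_upper : p.η ≤ a₂ / x
  β₂_lower : b₁ / x ^ 2 ≤ 1 - p.β₂
  qG_le : p.qG ≤ c / x ^ 2
  qG_le_one : p.qG ≤ 1
  qM_le : p.qM ≤ c / x ^ 2
  qV_le : p.qV ≤ c / x ^ 4
  qW_le : p.qW ≤ c / x ^ 4
  le_ratio : g ≤ 1 - ratio p
  le_moment : g ≤ 1 - p.β₁ ^ 2 / (p.β₂ * (1 - p.qV))
  le_decay : g ≤ 1 - p.β₁ / p.β₂
  le_rate : g ≤ 1 - p.β₁ * (1 + p.qM)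
  le_rates : g ≤ 1 - p.β₁ * (1 + p.qM) / (p.β₂ * (1 - p.qV))

/-- Bernoulli gives `1 - (1 - q) ^ t ≤ q T` for every `t ≤ T`. With `q_V = O(T^(-2))` the difference
stays bounded. -/
theorem sub_geomSum_le {q : ℝ} (hq : 0 ≤ q) (hq1 : q ≤ 1) (T : ℕ) :
    T - geomSum q T ≤ q * (T : ℝ) ^ 2 := by
  have h1 : (T : ℝ) - geomSum q T = ∑ t ∈ Finset.Icc 1 T, (1 - (1 - q) ^ t) := by
    simp [geomSum]
  rw [h1]
  refine (Finset.sum_le_card_nsmul _ _ (q * T) fun t ht => ?_).trans (le_of_eq ?_)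
  · have h2 := one_add_mul_le_pow (a := -q) (by linarith) t
    have h3 : (t : ℝ) ≤ T := Nat.cast_le.2 (Finset.mem_Icc.1 ht).2
    rw [← sub_eq_add_neg] at h2
    nlinarith
  · rw [Nat.card_Icc, nsmul_eq_mul]
    push_cast [Nat.add_sub_cancel]
    ring

/-! ### Estimates of the single terms of the bound, with `x = √T`. -/

namespace Regime

variable {p : Params} {g a₁ a₂ b₁ c x : ℝ}

theorem le_sqrt (h : Regime p g a₁ a₂ b₁ c x) : √b₁ / x ≤ √(1 - p.β₂) := by
  have hx : 0 < x := zero_lt_one.trans_le h.one_le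
  have := Real.sqrt_le_sqrt h.β₂_lower
  rwa [Real.sqrt_div h.b₁_pos.le, Real.sqrt_sq hx.le] at this

theorem gap_term_le (h : Regime p g a₁ a₂ b₁ c x) {R gap gap' : ℝ} (hR : 0 ≤ R)
    (hgap : 0 ≤ gap) (hle : gap ≤ gap') :
    4 * (1 + p.qG) * R * (gap / (p.η * x ^ 2)) ≤ 8 * R * gap' / a₁ / x := by
  have hx : 0 < x := zero_lt_one.trans_le h.one_le
  have ha := h.a₁_pos
  have h1 : 1 + p.qG ≤ 2 := by linarith [h.qG_le_one]
  have hη := h.η_lower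
  have := h.valid.qG_nonneg
  have := h.valid.η_pos
  have hgap' := hgap.trans hle
  have : 0 ≤ gap / (p.η * x ^ 2) := by positivity
  calc _ ≤ 4 * 2 * R * (gap' / (a₁ / x * x ^ 2)) := by gcongr
    _ = _ := by field_simp; ring

theorem first_moment_term_le (h : Regime p g a₁ a₂ b₁ c x) {R d : ℝ} (hd : 0 ≤ d) :
    4 * (1 + p.qG) * p.qM * d * R ^ 2 * (1 - p.β₁) * x ^ 2 / √(1 - p.β₂) *
      (√(ratio p * (1 + ratio p)) / ((1 + p.qM) * (1 - ratio p) ^ (3 / 2 : ℝ))) / x ^ 2 ≤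
    8 * c * d * R ^ 2 * √2 / (√b₁ * √g ^ 3) / x := by
  have hx : 0 < x := zero_lt_one.trans_le h.one_le
  have hb := Real.sqrt_pos.2 h.b₁_pos
  have hg := Real.sqrt_pos.2 h.g_pos
  have h1 : 1 + p.qG ≤ 2 := by linarith [h.qG_le_one]
  have hqG := h.valid.qG_nonneg
  have hqM := h.valid.qM_nonneg
  have hr0 := h.valid.ratio_nonneg
  have hr1 := h.valid.ratio_lt_one
  have hβ₁ : 1 - p.β₁ ≤ 1 := by linarith [h.valid.β₁_nonneg]
  have hβ₁' : 0 ≤ 1 - p.β₁ := by linarith [h.valid.β₁_lt]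
  have hc := h.c_nonneg
  have hσ := h.le_sqrt
  have hM := h.qM_le
  have hsq : √(ratio p * (1 + ratio p)) ≤ √2 := Real.sqrt_le_sqrt (by nlinarith)
  have hrg := Real.sqrt_le_sqrt h.le_ratio
  have hM1 : 1 ≤ 1 + p.qM := by linarith
  rw [rpow_three_halves (by linarith)]
  calc _ ≤ 4 * 2 * (c / x ^ 2) * d * R ^ 2 * 1 * x ^ 2 / (√b₁ / x) *
      (√2 / (1 * √g ^ 3)) / x ^ 2 := by gcongr
    _ = _ := by field_simp; ring

theorem second_moment_term_le (h : Regime p g a₁ a₂ b₁ c x) {R d S : ℝ} (hd : 0 ≤ d)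
    (hS : x ^ 2 - S ≤ p.qV * (x ^ 2) ^ 2) :
    (4 * (1 + p.qG) * d * R ^ 2 * (1 - p.β₁) * x ^ 2 /
      √((1 - p.β₁ ^ 2 / (p.β₂ * (1 - p.qV))) * (1 - p.β₂))
    - 4 * (1 + p.qG) * d * R ^ 2 * (1 - p.β₁) /
      √((1 - p.β₁ ^ 2 / (p.β₂ * (1 - p.qV))) * (1 - p.β₂)) * S) / x ^ 2 ≤
    8 * c * d * R ^ 2 / (√b₁ * √g) / x := by
  have hx : 0 < x := zero_lt_one.trans_le h.one_le
  have hb := Real.sqrt_pos.2 h.b₁_pos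
  have hg := Real.sqrt_pos.2 h.g_pos
  have h1 : 1 + p.qG ≤ 2 := by linarith [h.qG_le_one]
  have hqG := h.valid.qG_nonneg
  have hβ₁ : 1 - p.β₁ ≤ 1 := by linarith [h.valid.β₁_nonneg]
  have hβ₁' : 0 ≤ 1 - p.β₁ := by linarith [h.valid.β₁_lt]
  have hc := h.c_nonneg
  have hσ := h.le_sqrt
  have hmg := Real.sqrt_le_sqrt h.le_moment
  have hk0 : 0 ≤ 1 - p.β₁ ^ 2 / (p.β₂ * (1 - p.qV)) := h.g_pos.le.trans h.le_moment
  have hS' : x ^ 2 - S ≤ c := by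
    refine hS.trans ((mul_le_mul_of_nonneg_right h.qV_le (sq_nonneg _)).trans (le_of_eq ?_))
    field_simp
  rw [Real.sqrt_mul hk0]
  set k := √(1 - p.β₁ ^ 2 / (p.β₂ * (1 - p.qV)))
  have hsplit : (4 * (1 + p.qG) * d * R ^ 2 * (1 - p.β₁) * x ^ 2 / (k * √(1 - p.β₂)) -
      4 * (1 + p.qG) * d * R ^ 2 * (1 - p.β₁) / (k * √(1 - p.β₂)) * S) / x ^ 2 =
      4 * (1 + p.qG) * d * R ^ 2 * (1 - p.β₁) / (k * √(1 - p.β₂)) * (x ^ 2 - S) / x ^ 2 := by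
    ring
  rw [hsplit]
  calc _ ≤ 4 * (1 + p.qG) * d * R ^ 2 * (1 - p.β₁) / (k * √(1 - p.β₂)) * c / x ^ 2 := by
        gcongr
    _ ≤ 4 * 2 * d * R ^ 2 * 1 / (√g * (√b₁ / x)) * c / x ^ 2 := by gcongr
    _ = _ := by field_simp; ring

theorem weight_drift_term_le (h : Regime p g a₁ a₂ b₁ c x) {R L d : ℝ} (hL : 0 ≤ L)
    (hd : 0 ≤ d) :
    2 * p.qW * x ^ 2 * (1 - p.β₁) * d ^ (3 / 2 : ℝ) * p.η * L * (1 + p.qG) * R ^ 2 /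
      (√p.ε * (1 - p.β₂) * √(1 - ratio p)) ≤
    4 * c * d ^ (3 / 2 : ℝ) * a₂ * L * R ^ 2 / (√p.ε * b₁ * √g) / x := by
  have hx : 0 < x := zero_lt_one.trans_le h.one_le
  have hb := h.b₁_pos
  have hg := Real.sqrt_pos.2 h.g_pos
  have h1 : 1 + p.qG ≤ 2 := by linarith [h.qG_le_one]
  have hqG := h.valid.qG_nonneg
  have hqW := h.valid.qW_nonneg
  have hη := h.valid.η_pos
  have hε := Real.sqrt_pos.2 h.valid.ε_pos
  have hβ₁ : 1 - p.β₁ ≤ 1 := by linarith [h.valid.β₁_nonneg]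
  have hβ₁' : 0 ≤ 1 - p.β₁ := by linarith [h.valid.β₁_lt]
  have hc := h.c_nonneg
  have ha := h.a₂_nonneg
  have hW := h.qW_le
  have hηu := h.η_upper
  have hβ₂ := h.β₂_lower
  have hβ₂0 : 0 ≤ 1 - p.β₂ := by linarith [h.valid.β₂_lt]
  have hrg := Real.sqrt_le_sqrt h.le_ratio
  have hd3 : 0 ≤ d ^ (3 / 2 : ℝ) := Real.rpow_nonneg hd _
  calc _ ≤ 2 * (c / x ^ 4) * x ^ 2 * 1 * d ^ (3 / 2 : ℝ) * (a₂ / x) * L * 2 * R ^ 2 /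
      (√p.ε * (b₁ / x ^ 2) * √g) := by gcongr
    _ = _ := by field_simp; ring

theorem bias_term_le (h : Regime p g a₁ a₂ b₁ c x) {R L D d : ℝ} (hR : 0 ≤ R) (hL : 0 ≤ L)
    (hD : 0 ≤ D) (hd : 0 ≤ d) :
    4 * (1 + p.qG) * d / √(p.ε * (1 - p.β₂)) * (p.qG * R ^ 3 + L * p.qW * R ^ 2 * D) ≤
    8 * d * c * (R ^ 3 + L * R ^ 2 * D) / (√p.ε * √b₁) / x := by
  have hx : 0 < x := zero_lt_one.trans_le h.one_le
  have hb := Real.sqrt_pos.2 h.b₁_pos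
  have h1 : 1 + p.qG ≤ 2 := by linarith [h.qG_le_one]
  have hqG := h.valid.qG_nonneg
  have hqW := h.valid.qW_nonneg
  have hε := Real.sqrt_pos.2 h.valid.ε_pos
  have hc := h.c_nonneg
  have hσ := h.le_sqrt
  have hG := h.qG_le
  have hW : p.qW ≤ c / x ^ 2 := h.qW_le.trans (by
    have : x ^ 2 ≤ x ^ 4 := pow_le_pow_right₀ h.one_le (by norm_num)
    gcongr)
  rw [Real.sqrt_mul h.valid.ε_pos.le]
  calc _ ≤ 4 * 2 * d / (√p.ε * (√b₁ / x)) * (c / x ^ 2 * R ^ 3 + L * (c / x ^ 2) * R ^ 2 * D) := by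
        gcongr
    _ = _ := by field_simp; ring

/-- All three parts of `constC` are of the same order `x`, so after division by `T = x ^ 2` the
logarithmic term is of order `log T / x`. -/
theorem constC_le (h : Regime p g a₁ a₂ b₁ c x) {R L d : ℝ} (hR : 0 ≤ R) (hL : 0 ≤ L)
    (hd : 0 ≤ d) : constC p R L d ≤ (96 * d * R ^ 2 / (√g ^ 3 * √b₁) +
      4 * d * a₂ * L * R / (g * g * b₁) + 4 * d * a₂ ^ 2 * L ^ 2 / (g * g * √b₁ ^ 3)) * x := by
  have hx : 0 < x := zero_lt_one.trans_le h.one_le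
  have hb := h.b₁_pos
  have hsb := Real.sqrt_pos.2 h.b₁_pos
  have hg := h.g_pos
  have hsg := Real.sqrt_pos.2 h.g_pos
  have h1 : 1 + p.qG ≤ 2 := by linarith [h.qG_le_one]
  have hqG := h.valid.qG_nonneg
  have hη := h.valid.η_pos
  have hβ₁0 := h.valid.β₁_nonneg
  have hβ₁1 := h.valid.β₁_lt.le
  have hβ₁ : 1 - p.β₁ ≤ 1 := by linarith
  have hβ₁' : 0 ≤ 1 - p.β₁ := by linarith
  have hsβ₁ : √(1 - p.β₁) ≤ 1 := Real.sqrt_le_one.2 hβ₁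
  have ha := h.a₂_nonneg
  have hσ := h.le_sqrt
  have hηu := h.η_upper
  have hβ₂ := h.β₂_lower
  have hdg := Real.sqrt_le_sqrt h.le_decay
  have hu := h.le_rate
  have hv := h.le_rates
  have hβ₂0 : 0 ≤ 1 - p.β₂ := by linarith [h.valid.β₂_lt]
  have hu0 := hg.le.trans hu
  have hv0 := hg.le.trans hv
  rw [constC, rpow_three_halves (hg.le.trans h.le_decay), rpow_three_halves hβ₂0]
  set u := 1 - p.β₁ * (1 + p.qM)
  set v := 1 - p.β₁ * (1 + p.qM) / (p.β₂ * (1 - p.qV))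
  calc _ ≤ 24 * d * (2 * R) ^ 2 * 1 / (√g ^ 3 * (√b₁ / x)) +
        2 * d * (a₂ / x) * L * 2 * R * 1 ^ 2 / (g * g * (b₁ / x ^ 2)) +
        4 * d * (a₂ / x) ^ 2 * L ^ 2 * 1 * 1 / (g * g * (√b₁ / x) ^ 3) := by gcongr
    _ = _ := by field_simp; ring

theorem logTerm_le (h : Regime p g a₁ a₂ b₁ c x) {R b₂ : ℝ} (hR : 0 ≤ R)
    (hβ₂ : 1 - p.β₂ ≤ b₂ / x ^ 2) (hb : 1 / 2 ≤ p.β₂ * (1 - p.qV)) {T : ℕ} (hT : (T : ℝ) = x ^ 2)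
    (hlog : 1 ≤ Real.log T) :
    logTerm (p.β₂ * (1 - p.qV)) p.ε (((1 + p.qG) * R) ^ 2) T ≤
      (Real.log (1 + 4 * R ^ 2 / (p.ε * b₁)) + 1 + 2 * (b₂ + c)) * Real.log T := by
  have hx : 0 < x := zero_lt_one.trans_le h.one_le
  have hx2 : 1 ≤ x ^ 2 := one_le_pow₀ h.one_le
  have hε := h.valid.ε_pos
  have hb₁ := h.b₁_pos
  have h1 : 1 + p.qG ≤ 2 := by linarith [h.qG_le_one]
  have hqG := h.valid.qG_nonneg
  have hb0 : 0 < p.β₂ * (1 - p.qV) := h.valid.rate_pos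
  have hb1 : b₁ / x ^ 2 ≤ 1 - p.β₂ * (1 - p.qV) := by
    linarith [h.β₂_lower, h.valid.rate_le]
  have hκ : 1 ≤ 1 + 4 * R ^ 2 / (p.ε * b₁) := le_add_of_nonneg_right (by positivity)
  have hlog1 : Real.log (1 + ((1 + p.qG) * R) ^ 2 / (p.ε * (1 - p.β₂ * (1 - p.qV)))) ≤
      Real.log (1 + 4 * R ^ 2 / (p.ε * b₁)) + Real.log T := by
    rw [hT, ← Real.log_mul (by positivity) (by positivity)]
    have h2 : 0 < 1 - p.β₂ * (1 - p.qV) := lt_of_lt_of_le (by positivity) hb1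
    refine Real.log_le_log (by positivity) ?_
    calc _ ≤ x ^ 2 + (2 * R) ^ 2 / (p.ε * (b₁ / x ^ 2)) := by gcongr
      _ = _ := by field_simp; ring
  -- By `-log b ≤ 1 / b - 1`, with `1 / b ≤ 2` and `1 - b = O(1 / T)`, these `T` logarithms cost
  -- only a constant.
  have hlog2 : -(T * Real.log (p.β₂ * (1 - p.qV))) ≤ 2 * (b₂ + c) := by
    have h2 := Real.one_sub_inv_le_log_of_pos hb0
    have h3 : 1 - p.β₂ * (1 - p.qV) ≤ (b₂ + c) / x ^ 2 := by
      have h4 : p.qV ≤ c / x ^ 2 := h.qV_le.trans (by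
        have : x ^ 2 ≤ x ^ 4 := pow_le_pow_right₀ h.one_le (by norm_num)
        have := h.c_nonneg
        gcongr)
      have h5 : p.β₂ * p.qV ≤ p.qV := mul_le_of_le_one_left h.valid.qV_nonneg h.valid.β₂_lt.le
      rw [add_div]
      linarith
    have h4 : (p.β₂ * (1 - p.qV))⁻¹ - 1 ≤ 2 * ((b₂ + c) / x ^ 2) := by
      have h5 : (p.β₂ * (1 - p.qV))⁻¹ - 1 =
          (p.β₂ * (1 - p.qV))⁻¹ * (1 - p.β₂ * (1 - p.qV)) := by
        rw [mul_one_sub (p.β₂ * (1 - p.qV))⁻¹, inv_mul_cancel₀ hb0.ne']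
      have h6 : (p.β₂ * (1 - p.qV))⁻¹ ≤ 2 := by
        rw [inv_le_comm₀ hb0 two_pos]
        linarith
      have h7 : 0 ≤ 1 - p.β₂ * (1 - p.qV) := le_trans (by positivity) hb1
      rw [h5]
      gcongr
    have h5 : -Real.log (p.β₂ * (1 - p.qV)) ≤ 2 * ((b₂ + c) / x ^ 2) := by linarith
    have h6 := mul_le_mul_of_nonneg_left h5 (sq_nonneg x)
    rw [hT]
    refine le_trans (le_of_eq (by ring)) (h6.trans (le_of_eq ?_))
    field_simp
  have hbc : 0 ≤ b₂ + c := by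
    have h2 : 0 ≤ b₂ / x ^ 2 := by linarith [h.valid.β₂_lt]
    have h3 : 0 ≤ b₂ := by
      have := mul_nonneg h2 (sq_nonneg x)
      rwa [div_mul_cancel₀ _ (by positivity)] at this
    linarith [h.c_nonneg]
  have hlκ := Real.log_nonneg hκ
  unfold logTerm
  nlinarith

end Regime

/-- The coefficient of `1 / √T` in the bound along the schedule. -/
def rateCoeff (β₁ ε R L D gap a₁ a₂ b₁ c d : ℝ) : ℝ :=
  8 * R * gap / a₁ + 8 * c * d * R ^ 2 * √2 / (√b₁ * √((1 - β₁) / 2) ^ 3) +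
    8 * c * d * R ^ 2 / (√b₁ * √((1 - β₁) / 2)) +
    4 * c * d ^ (3 / 2 : ℝ) * a₂ * L * R ^ 2 / (√ε * b₁ * √((1 - β₁) / 2)) +
    8 * d * c * (R ^ 3 + L * R ^ 2 * D) / (√ε * √b₁)

/-- The coefficient of `log T / √T` in the bound along the schedule. -/
def rateLogCoeff (β₁ ε R L a₂ b₁ b₂ c d : ℝ) : ℝ :=
  (96 * d * R ^ 2 / (√((1 - β₁) / 2) ^ 3 * √b₁) +
      4 * d * a₂ * L * R / ((1 - β₁) / 2 * ((1 - β₁) / 2) * b₁) +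
      4 * d * a₂ ^ 2 * L ^ 2 / ((1 - β₁) / 2 * ((1 - β₁) / 2) * √b₁ ^ 3)) *
    (Real.log (1 + 4 * R ^ 2 / (ε * b₁)) + 1 + 2 * (b₂ + c))

theorem Regime.bound_le {p : Params} {a₁ a₂ b₁ c x : ℝ}
    (h : Regime p ((1 - p.β₁) / 2) a₁ a₂ b₁ c x) {R L D d gap gap' b₂ : ℝ} (hR : 0 ≤ R)
    (hL : 0 ≤ L) (hD : 0 ≤ D) (hd : 0 ≤ d) (hgap : 0 ≤ gap) (hle : gap ≤ gap')
    (hβ₂ : 1 - p.β₂ ≤ b₂ / x ^ 2) (hb : 1 / 2 ≤ p.β₂ * (1 - p.qV)) {T : ℕ} (hT : (T : ℝ) = x ^ 2)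
    (hlog : 1 ≤ Real.log T) :
    bound p R L D d gap T ≤ (|rateCoeff p.β₁ p.ε R L D gap' a₁ a₂ b₁ c d| +
      rateLogCoeff p.β₁ p.ε R L a₂ b₁ b₂ c d) * Real.log T / x := by
  have hx : 0 < x := zero_lt_one.trans_le h.one_le
  have h1 := h.gap_term_le hR hgap hle
  have h2 := h.first_moment_term_le (R := R) hd
  have h3 := h.second_moment_term_le (R := R) (S := geomSum p.qV T) hd (by
    have := sub_geomSum_le h.valid.qV_nonneg h.valid.qV_lt.le T
    rwa [hT] at this)
  have h4 := h.weight_drift_term_le (R := R) hL hd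
  have h5 := h.bias_term_le hR hL hD hd
  have h6 := h.constC_le hR hL hd
  have h7 := h.logTerm_le hR hβ₂ hb hT hlog
  have hC := constC_nonneg h.valid hR hL hd
  have hΛ0 := logTerm_nonneg h.valid.rate_pos (h.valid.rate_le.trans_lt h.valid.β₂_lt)
    h.valid.ε_pos (sq_nonneg ((1 + p.qG) * R)) T
  have h8 : constC p R L d / x ^ 2 *
      logTerm (p.β₂ * (1 - p.qV)) p.ε (((1 + p.qG) * R) ^ 2) T ≤
      rateLogCoeff p.β₁ p.ε R L a₂ b₁ b₂ c d * Real.log T / x := by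
    refine (mul_le_mul (div_le_div_of_nonneg_right h6 (sq_nonneg x)) h7 hΛ0
      (div_nonneg (hC.trans h6) (sq_nonneg x))).trans (le_of_eq ?_)
    rw [rateLogCoeff]
    field_simp
  have h9 : rateCoeff p.β₁ p.ε R L D gap' a₁ a₂ b₁ c d / x ≤
      |rateCoeff p.β₁ p.ε R L D gap' a₁ a₂ b₁ c d| * Real.log T / x := by
    gcongr
    exact (le_abs_self _).trans (le_mul_of_one_le_right (abs_nonneg _) hlog)
  have h10 : bound p R L D d gap T = 4 * (1 + p.qG) * R * (gap / (p.η * x ^ 2)) +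
      4 * (1 + p.qG) * p.qM * d * R ^ 2 * (1 - p.β₁) * x ^ 2 / √(1 - p.β₂) *
        (√(ratio p * (1 + ratio p)) / ((1 + p.qM) * (1 - ratio p) ^ (3 / 2 : ℝ))) / x ^ 2 +
      (4 * (1 + p.qG) * d * R ^ 2 * (1 - p.β₁) * x ^ 2 /
        √((1 - p.β₁ ^ 2 / (p.β₂ * (1 - p.qV))) * (1 - p.β₂))
      - 4 * (1 + p.qG) * d * R ^ 2 * (1 - p.β₁) /
        √((1 - p.β₁ ^ 2 / (p.β₂ * (1 - p.qV))) * (1 - p.β₂)) * geomSum p.qV T) / x ^ 2 +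
      2 * p.qW * x ^ 2 * (1 - p.β₁) * d ^ (3 / 2 : ℝ) * p.η * L * (1 + p.qG) * R ^ 2 /
        (√p.ε * (1 - p.β₂) * √(1 - ratio p)) +
      4 * (1 + p.qG) * d / √(p.ε * (1 - p.β₂)) * (p.qG * R ^ 3 + L * p.qW * R ^ 2 * D) +
      constC p R L d / x ^ 2 *
        logTerm (p.β₂ * (1 - p.qV)) p.ε (((1 + p.qG) * R) ^ 2) T := by
    rw [bound, Qtilde, logTerm, hT]
    ring
  have h11 : rateCoeff p.β₁ p.ε R L D gap' a₁ a₂ b₁ c d / x =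
      8 * R * gap' / a₁ / x +
      8 * c * d * R ^ 2 * √2 / (√b₁ * √((1 - p.β₁) / 2) ^ 3) / x +
      8 * c * d * R ^ 2 / (√b₁ * √((1 - p.β₁) / 2)) / x +
      4 * c * d ^ (3 / 2 : ℝ) * a₂ * L * R ^ 2 / (√p.ε * b₁ * √((1 - p.β₁) / 2)) / x +
      8 * d * c * (R ^ 3 + L * R ^ 2 * D) / (√p.ε * √b₁) / x := by
    rw [rateCoeff]
    ring
  have hsplit : ∀ u v w : ℝ, (u + v) * w / x = u * w / x + v * w / x := fun u v w => by ring
  rw [h10, hsplit]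
  linarith

namespace Setting

variable {m n B : ℕ} {Ξ Ω : Type*} [MeasurableSpace Ξ] [MeasurableSpace Ω] {p : Params}
  {R L D : ℝ} {T : ℕ} {f : Mat m n → Ξ → ℝ} {P : Measure Ξ} {W₀ : Mat m n} {Q : Quantizers}
  {μ : Measure Ω} {ξ : ℕ → Fin B → Ω → Ξ} {τ : Ω → ℕ} {a₁ a₂ b₁ b₂ c : ℝ}

theorem regime (h : Setting p R L D T f P W₀ Q μ ξ τ) (hs : Schedule p a₁ a₂ b₁ b₂ c T)
    (ha₁ : 0 < a₁) (hb₁ : 0 < b₁) (hbT : b₂ / T ≤ (1 - p.β₁) / 8)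
    (hcT : c / T ≤ (1 - p.β₁) / 8) :
    Regime p ((1 - p.β₁) / 2) a₁ a₂ b₁ c (√(T : ℝ)) ∧ 1 / 2 ≤ p.β₂ * (1 - p.qV) := by
  have hT1 : (1 : ℝ) ≤ T := Nat.one_le_cast.2 h.T_pos
  have hT0 : (0 : ℝ) < T := zero_lt_one.trans_le hT1
  have hx2 : √(T : ℝ) ^ 2 = T := Real.sq_sqrt hT0.le
  have hx4 : √(T : ℝ) ^ 4 = (T : ℝ) ^ 2 := by
    rw [show √(T : ℝ) ^ 4 = (√(T : ℝ) ^ 2) ^ 2 by ring, hx2]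
  have hx : 1 ≤ √(T : ℝ) := Real.one_le_sqrt.2 hT1
  have hη := h.η_pos
  have hβ₁ := h.β₁_mem.1
  have hβ₁' := h.β₁_mem.2
  have hβ₂ := h.β₂_mem.2
  have hqG := h.quantG.nonneg
  have hqM := h.quantM.nonneg
  have hqV := h.quantV.nonneg
  have hc : 0 ≤ c := by
    have := mul_nonneg (hqG.trans hs.qG_le) hT0.le
    rwa [div_mul_cancel₀ _ hT0.ne'] at this
  have ha₂ : 0 ≤ a₂ := by
    have := mul_nonneg (hη.le.trans hs.η_upper) (zero_le_one.trans hx)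
    rwa [div_mul_cancel₀ _ (by positivity)] at this
  have hcT' : c / (T : ℝ) ^ 2 ≤ (1 - p.β₁) / 8 := by
    refine le_trans ?_ hcT
    have : (T : ℝ) ≤ (T : ℝ) ^ 2 := by nlinarith
    gcongr
  have hqM' := hs.qM_le.trans hcT
  have hqV' := hs.qV_le.trans hcT'
  have hβ₂' := hs.β₂_upper.trans hbT
  set γ := 1 - p.β₁ with hγ
  -- Both `1 - β₂` and `q_V` are at most `γ / 8`.
  have hb : 1 - γ / 4 ≤ p.β₂ * (1 - p.qV) := by nlinarith
  have hbβ : p.β₂ * (1 - p.qV) ≤ p.β₂ :=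
    mul_le_of_le_one_right h.β₂_mem.1.le (by linarith)
  have hb0 : 0 < p.β₂ * (1 - p.qV) := by linarith
  have hp₁ : p.β₁ * (1 + p.qM) ≤ 1 - 7 * γ / 8 := by nlinarith
  have hp₁0 : 0 ≤ p.β₁ * (1 + p.qM) := by positivity
  have hβp : p.β₁ ≤ p.β₁ * (1 + p.qM) := le_mul_of_one_le_right hβ₁ (by linarith)
  have hrate : p.β₁ * (1 + p.qM) < p.β₂ * (1 - p.qV) := by linarith
  have hsq : (p.β₁ * (1 + p.qM)) ^ 2 ≤ p.β₁ * (1 + p.qM) := by nlinarith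
  have hratio : p.β₁ ^ 2 * (1 + p.qM) ^ 2 < p.β₂ * (1 - p.qV) := by
    rw [← mul_pow]
    exact hsq.trans_lt hrate
  -- It suffices that `1 - 7γ/8 ≤ (1 - γ/2)(1 - γ/4)`. This quotient dominates the other three, so
  -- one estimate serves `le_ratio`, `le_moment` and `le_decay`.
  have hquot : p.β₁ * (1 + p.qM) / (p.β₂ * (1 - p.qV)) ≤ 1 - γ / 2 := by
    rw [div_le_iff₀ hb0]
    nlinarith
  refine ⟨{ valid := h.valid hratio hrate
            one_le := hx
            g_pos := by linarith
            a₁_pos := ha₁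
            a₂_nonneg := ha₂
            b₁_pos := hb₁
            c_nonneg := hc
            η_lower := hs.η_lower
            η_upper := hs.η_upper
            β₂_lower := by rw [hx2]; exact hs.β₂_lower
            qG_le := by rw [hx2]; exact hs.qG_le
            qG_le_one := by linarith [hs.qG_le]
            qM_le := by rw [hx2]; exact hs.qM_le
            qV_le := by rw [hx4]; exact hs.qV_le
            qW_le := by rw [hx4]; exact hs.qW_le
            le_ratio := ?_
            le_moment := ?_
            le_decay := ?_
            le_rate := by linarith
            le_rates := by linarith }, by linarith⟩
  · have : ratio p ≤ p.β₁ * (1 + p.qM) / (p.β₂ * (1 - p.qV)) := by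
      rw [ratio_eq]
      gcongr
    linarith
  · have : p.β₁ ^ 2 / (p.β₂ * (1 - p.qV)) ≤ p.β₁ * (1 + p.qM) / (p.β₂ * (1 - p.qV)) := by
      gcongr
      nlinarith
    linarith
  · have : p.β₁ / p.β₂ ≤ p.β₁ * (1 + p.qM) / (p.β₂ * (1 - p.qV)) := by gcongr
    linarith

theorem integral_gradNorm_sq_le_rate (h : Setting p R L D T f P W₀ Q μ ξ τ)
    (hs : Schedule p a₁ a₂ b₁ b₂ c T) (ha₁ : 0 < a₁) (hb₁ : 0 < b₁)
    (hbT : b₂ / T ≤ (1 - p.β₁) / 8) (hcT : c / T ≤ (1 - p.β₁) / 8)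
    (hT : 2 * p.β₁ / (1 - p.β₁) ≤ T) (hT3 : 3 ≤ T) {gap : ℝ}
    (hgap : objective f P W₀ - (⨅ W, objective f P W) ≤ gap) :
    Integrable (fun ω => gradNorm p f P W₀ Q ξ τ ω ^ 2) μ ∧
    ∫ ω, gradNorm p f P W₀ Q ξ τ ω ^ 2 ∂μ ≤
      (|rateCoeff p.β₁ p.ε R |L| D gap a₁ a₂ b₁ c ((m : ℝ) * n)| +
        rateLogCoeff p.β₁ p.ε R |L| a₂ b₁ b₂ c ((m : ℝ) * n)) * Real.log T / √(T : ℝ) := by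
  obtain ⟨hreg, hb⟩ := h.regime hs ha₁ hb₁ hbT hcT
  have hR : 0 < R := (Real.sqrt_pos.2 h.ε_pos).trans h.R_gt
  have hx2 : √(T : ℝ) ^ 2 = T := Real.sq_sqrt (Nat.cast_nonneg _)
  have hlog : 1 ≤ Real.log T := by
    have h3 : (3 : ℝ) ≤ T := by exact_mod_cast hT3
    rw [Real.le_log_iff_exp_le (by linarith)]
    linarith [Real.exp_one_lt_d9]
  obtain ⟨hint, hle⟩ := h.of_abs.integral_gradNorm_sq_le hreg.valid.ratio_lt hreg.valid.rate_lt hT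
  exact ⟨hint, hle.trans (hreg.bound_le hR.le (abs_nonneg L) ((norm_nonneg _).trans h.init)
    (by positivity) (sub_nonneg.2 (ciInf_le h.problem.bddBelow W₀)) hgap
    (by rw [hx2]; exact hs.β₂_upper) hb hx2.symm hlog)⟩

end Setting

/-- The mean is controlled by the second moment. -/
theorem integral_le_of_integral_sq_le {Ω : Type*} [MeasurableSpace Ω] {μ : Measure Ω}
    [IsProbabilityMeasure μ] {N : Ω → ℝ} (hN : ∀ ω, 0 ≤ N ω)
    (hint : Integrable (fun ω => N ω ^ 2) μ) {s : ℝ} (hs : 0 < s)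
    (hle : ∫ ω, N ω ^ 2 ∂μ ≤ s ^ 2) : Integrable N μ ∧ ∫ ω, N ω ∂μ ≤ s := by
  -- AM-GM gives domination by an integrable function and the bound on the mean at once.
  have hdom : ∀ ω, N ω ≤ (N ω ^ 2 + s ^ 2) / (2 * s) := fun ω => by
    rw [le_div_iff₀ (by positivity)]
    nlinarith [sq_nonneg (N ω - s)]
  have hint' : Integrable (fun ω => (N ω ^ 2 + s ^ 2) / (2 * s)) μ :=
    (hint.add (integrable_const _)).div_const _
  -- Measurability is only known for the square and is recovered by taking the root of a nonnegative
  -- function.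
  have hmeas : AEStronglyMeasurable N μ := by
    have : N = fun ω => √(N ω ^ 2) := by
      funext ω
      rw [Real.sqrt_sq (hN ω)]
    rw [this]
    exact Real.continuous_sqrt.comp_aestronglyMeasurable hint.1
  have hI : Integrable N μ := hint'.mono' hmeas (Filter.Eventually.of_forall fun ω => by
    rw [Real.norm_of_nonneg (hN ω)]
    exact hdom ω)
  refine ⟨hI, (integral_mono hI hint' hdom).trans ?_⟩
  rw [integral_div, integral_add hint (integrable_const _), integral_const, probReal_univ,
    one_smul, div_le_iff₀ (by positivity)]
  nlinarith

/-- The number of steps after which the schedule bounds apply. -/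
def rateStart (β₁ b₂ c : ℝ) : ℕ := max 3 ⌈8 * (|b₂| + |c| + 1) / (1 - β₁)⌉₊

theorem Setting.integral_gradNorm_le_rate {m n B : ℕ} {Ξ Ω : Type*} [MeasurableSpace Ξ]
    [MeasurableSpace Ω] {p : Params} {R L D : ℝ} {T : ℕ} {f : Mat m n → Ξ → ℝ} {P : Measure Ξ}
    {W₀ : Mat m n} {Q : Quantizers} {μ : Measure Ω} {ξ : ℕ → Fin B → Ω → Ξ} {τ : Ω → ℕ}
    {a₁ a₂ b₁ b₂ c gap : ℝ} (h : Setting p R L D T f P W₀ Q μ ξ τ)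
    (hs : Schedule p a₁ a₂ b₁ b₂ c T) (ha₁ : 0 < a₁) (hb₁ : 0 < b₁)
    (hT : rateStart p.β₁ b₂ c ≤ T)
    (hgap : objective f P W₀ - (⨅ W, objective f P W) ≤ gap) :
    Integrable (fun ω => gradNorm p f P W₀ Q ξ τ ω) μ ∧
    ∫ ω, gradNorm p f P W₀ Q ξ τ ω ∂μ ≤
      √(|rateCoeff p.β₁ p.ε R |L| D gap a₁ a₂ b₁ c ((m : ℝ) * n)| +
        |rateLogCoeff p.β₁ p.ε R |L| a₂ b₁ b₂ c ((m : ℝ) * n)| + 1) *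
        (T : ℝ) ^ (-(1 / 4) : ℝ) * Real.log T := by
  have := h.prob
  have hT3 : 3 ≤ T := (le_max_left _ _).trans hT
  have hT3' : (3 : ℝ) ≤ T := by exact_mod_cast hT3
  have hT0 : (0 : ℝ) < T := by linarith
  have hβ₁ := h.β₁_mem.1
  have hγ : 0 < 1 - p.β₁ := by linarith [h.β₁_mem.2]
  -- The terms `|b₂|` and `|c|` give the two smallness conditions, and the `1` gives `2β₁/(1 - β₁) ≤
  -- T`.
  have hTge : 8 * (|b₂| + |c| + 1) ≤ T * (1 - p.β₁) := by
    rw [← div_le_iff₀ hγ]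
    exact (Nat.le_ceil _).trans (Nat.cast_le.2 ((le_max_right _ _).trans hT))
  have hbT : b₂ / T ≤ (1 - p.β₁) / 8 := by
    rw [div_le_iff₀ hT0]
    linarith [le_abs_self b₂, abs_nonneg c]
  have hcT : c / T ≤ (1 - p.β₁) / 8 := by
    rw [div_le_iff₀ hT0]
    linarith [le_abs_self c, abs_nonneg b₂]
  have hT2 : 2 * p.β₁ / (1 - p.β₁) ≤ T := by
    rw [div_le_iff₀ hγ]
    linarith [abs_nonneg b₂, abs_nonneg c]
  obtain ⟨hint, hle⟩ := h.integral_gradNorm_sq_le_rate hs ha₁ hb₁ hbT hcT hT2 hT3 hgap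
  have hlog : 1 ≤ Real.log T := by
    rw [Real.le_log_iff_exp_le hT0]
    linarith [Real.exp_one_lt_d9]
  set A := |rateCoeff p.β₁ p.ε R |L| D gap a₁ a₂ b₁ c ((m : ℝ) * n)|
  set E := rateLogCoeff p.β₁ p.ε R |L| a₂ b₁ b₂ c ((m : ℝ) * n)
  have hA : 0 ≤ A := abs_nonneg _
  have hK : 0 < A + |E| + 1 := by positivity
  have hquarter : ((T : ℝ) ^ (-(1 / 4) : ℝ)) ^ 2 = 1 / √(T : ℝ) := by
    rw [← Real.rpow_natCast, ← Real.rpow_mul hT0.le, Real.sqrt_eq_rpow,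
      one_div ((T : ℝ) ^ (1 / 2 : ℝ)), ← Real.rpow_neg hT0.le]
    norm_num
  refine integral_le_of_integral_sq_le (fun ω => norm_nonneg _) hint
    (by have := Real.sqrt_pos.2 hK; positivity) (hle.trans ?_)
  rw [mul_pow, mul_pow, hquarter, Real.sq_sqrt hK.le]
  have hx : 0 < √(T : ℝ) := Real.sqrt_pos.2 hT0
  -- Raising `log T` to `log T ^ 2` makes its root the integer power `k = 1`.
  calc (A + E) * Real.log T / √(T : ℝ) ≤ (A + |E| + 1) * Real.log T ^ 2 / √(T : ℝ) := by
        have h1 : A + E ≤ A + |E| + 1 := by linarith [le_abs_self E]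
        have h2 : Real.log T ≤ Real.log T ^ 2 := by nlinarith
        have h3 : 0 ≤ Real.log T := by linarith
        exact div_le_div_of_nonneg_right (mul_le_mul h1 h2 h3 hK.le) hx.le
    _ = _ := by ring

end QAdam

end

/-! ### The two claims. -/

theorem theorem1 (m n : ℕ) :
    -- the explicit bound
    (∀ (B : ℕ) (Ξ Ω : Type*) [MeasurableSpace Ξ] [MeasurableSpace Ω]
      (p : QAdam.Params) (R L D : ℝ) (T : ℕ) (f : QAdam.Mat m n → Ξ → ℝ) (P : Measure Ξ)
      (W₀ : QAdam.Mat m n) (Q : QAdam.Quantizers) (μ : Measure Ω)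
      (ξ : ℕ → Fin B → Ω → Ξ) (τ : Ω → ℕ),
      QAdam.Setting p R L D T f P W₀ Q μ ξ τ →
      p.β₁ ^ 2 * (1 + p.qM) ^ 2 < p.β₂ * (1 - p.qV) →
      p.β₁ * (1 + p.qM) < p.β₂ * (1 - p.qV) →
      2 * p.β₁ / (1 - p.β₁) ≤ T →
      Integrable (fun ω => QAdam.gradNorm p f P W₀ Q ξ τ ω ^ 2) μ ∧
      ∫ ω, QAdam.gradNorm p f P W₀ Q ξ τ ω ^ 2 ∂μ ≤
        QAdam.bound p R L D ((m : ℝ) * n)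
          (QAdam.objective f P W₀ - ⨅ W, QAdam.objective f P W) T) ∧
    -- the rate, with constants that depend only on the quantities listed before them
    (∀ (β₁ ε R L D gap a₁ a₂ b₁ b₂ c : ℝ), 0 < a₁ → 0 < b₁ →
      ∃ (K : ℝ) (k T₀ : ℕ), ∀ (B : ℕ) (Ξ Ω : Type*) [MeasurableSpace Ξ] [MeasurableSpace Ω]
        (p : QAdam.Params) (T : ℕ) (f : QAdam.Mat m n → Ξ → ℝ) (P : Measure Ξ)
        (W₀ : QAdam.Mat m n) (Q : QAdam.Quantizers) (μ : Measure Ω)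
        (ξ : ℕ → Fin B → Ω → Ξ) (τ : Ω → ℕ),
        p.β₁ = β₁ → p.ε = ε → T₀ ≤ T →
        QAdam.Schedule p a₁ a₂ b₁ b₂ c T →
        QAdam.Setting p R L D T f P W₀ Q μ ξ τ →
        QAdam.objective f P W₀ - (⨅ W, QAdam.objective f P W) ≤ gap →
        Integrable (fun ω => QAdam.gradNorm p f P W₀ Q ξ τ ω) μ ∧
        ∫ ω, QAdam.gradNorm p f P W₀ Q ξ τ ω ∂μ ≤
          K * (T : ℝ) ^ (-(1 / 4) : ℝ) * Real.log T ^ k) := by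
  refine ⟨fun B Ξ Ω _ _ p R L D T f P W₀ Q μ ξ τ h hr hr' hT =>
    h.integral_gradNorm_sq_le hr hr' hT, fun β₁ ε R L D gap a₁ a₂ b₁ b₂ c ha₁ hb₁ => ?_⟩
  refine ⟨√(|QAdam.rateCoeff β₁ ε R |L| D gap a₁ a₂ b₁ c ((m : ℝ) * n)| +
    |QAdam.rateLogCoeff β₁ ε R |L| a₂ b₁ b₂ c ((m : ℝ) * n)| + 1), 1,
    QAdam.rateStart β₁ b₂ c, ?_⟩
  rintro B Ξ Ω _ _ p T f P W₀ Q μ ξ τ rfl rfl hT hs h hgap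
  rw [pow_one]
  exact h.integral_gradNorm_le_rate hs ha₁ hb₁ hT hgap
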